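/- Let $n\ge 0$, $0\le k\le n$, $r\ge 1$. Let $\Omega\subset\mathbb R^n$ be an open set with $\Omega=\operatorname{int}\overline\Omega$ (for example, a bounded domain that is starlike with respect to a ball). Let $\Omega_h$ be a geometrically conforming simplicial mesh of $\Omega$: a finite set of closed $n$-simplices with union $\overline\Omega$, any two of which are disjoint or meet in the common face spanned by their common vertices. Put $h=\max_{K\in\Omega_h}\operatorname{diam}K$, and assume that $\Omega_h$ is shape-regular with constant $\sigma$, i.e. each $K\in\Omega_h$ contains a ball of some radius $\rho_K>0$ with $\operatorname{diam}K\le\sigma\rho_K$. Write $\Lambda^k$ for the $k$-forms on $\mathbb R^n$ with constant coefficients. For a form $w=\sum_\alpha w_\alpha\,dx^\alpha$ ($\alpha$ running over the increasing multi-indices) put $\|w\|^2=\sum_\alpha\|w_\alpha\|_{L^2(\Omega)}^2$ and $\|w\|_{H^1}^2=\sum_\alpha\|w_\alpha\|_{H^1(\Omega)}^2$, where $\|w_\alpha\|_{H^1(\Omega)}^2=\|w_\alpha\|_{L^2(\Omega)}^2+\sum_{i=1}^n\|\partial_iw_\alpha\|_{L^2(\Omega)}^2$; derivatives, and the exterior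 derivative $d$, are weak derivatives on $\Omega$. Let $P_s\Lambda^k$ be the $k$-forms whose coefficients are polynomials of degree at most $s$, and let $P_r^-\Lambda^k=P_{r-1}\Lambda^k+\kappa P_{r-1}\Lambda^{k+1}$, where $\kappa$ is contraction with the position vector field $x$. Define $$V_h^{(k)}=\{u\in L^2(\Omega,\Lambda^k): du\in L^2(\Omega,\Lambda^{k+1}),\ u|_K\in P_r^-\Lambda^k\text{ for all }K\in\Omega_h\},$$ and let $V_h^{(0),k}$ be the space of continuous $k$-forms on $\Omega$ whose coefficients lie in $H^1(\Omega)$ and whose restriction to each $K\in\Omega_h$ lies in $P_r\Lambda^k$ (the vector Lagrange space of degree $r$). For $v_h\in V_h^{(0),k}$, a canonical interpolant of $v_h$ is a form $\Pi_hv_h\in V_h^{(k)}$ such that, for every $K\in\Omega_h$, every face $f$ of $K$ of dimension $d_f$ with $k\le d_f\le\min(n,r+k-1)$, and every $q\in P_{r+k-d_f-1}\Lambda^{d_f-k}(f)$, $$\int_f\operatorname{tr}_f\big((\Pi_hv_h)|_K\big)\wedge q=\int_f\operatorname{tr}_f\big(v_h|_K\big)\wedge q .$$ Then each $v_h\in V_h^{(0),k}$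 has a canonical interpolant $\Pi_hv_h\in V_h^{(k)}$, unique up to equality almost everywhere, and there is a constant $C>0$ depending only on $n$, $k$, $r$ and $\sigma$ (not on $\Omega$, $h$ or the mesh) such that for all $v_h\in V_h^{(0),k}$ $$\|\Pi_hv_h\|\le C\|v_h\|,\qquad \|\Pi_hv_h-v_h\|\le C\,h\,\|v_h\|_{H^1},\qquad \|d\,\Pi_hv_h\|\le C\,\|v_h\|_{H^1}.$$ -/

import Mathlib

open MeasureTheory Set
open scoped ContDiff

noncomputable section

namespace FEEC

/-- Euclidean `n`-space. -/
abbrev E (n : ℕ) : Type := EuclideanSpace ℝ (Fin n)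

/-- Constant-coefficient (algebraic) `k`-forms on `ℝⁿ`. -/
abbrev Form (n k : ℕ) : Type := E n [⋀^Fin k]→L[ℝ] ℝ

/-- The `i`-th standard basis vector of `ℝⁿ`. -/
def basisVec {n : ℕ} (i : Fin n) : E n := EuclideanSpace.single i (1 : ℝ)

/-- The component `w_α` of a `k`-form `w = ∑_α w_α dx^α`; increasing multi-indices `α` are
strictly increasing maps `Fin k → Fin n`. -/
def comp {n k : ℕ} (w : E n → Form n k) (α : Fin k ↪o Fin n) (x : E n) : ℝ :=
  w x (fun i => basisVec (α i))

/-! ### Weak derivatives and norms -/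

/-- Smooth test functions with compact support in `Ω`. -/
def IsTest {n : ℕ} (Ω : Set (E n)) (φ : E n → ℝ) : Prop :=
  ContDiff ℝ ∞ φ ∧ HasCompactSupport φ ∧ tsupport φ ⊆ Ω

/-- `f ∈ L²(Ω)`. -/
def MemL2 {n : ℕ} (Ω : Set (E n)) (f : E n → ℝ) : Prop :=
  MemLp f 2 (volume.restrict Ω)

/-- `g` is the weak partial derivative `∂_i f` in `Ω`. -/
def HasWeakPartial {n : ℕ} (Ω : Set (E n)) (i : Fin n) (f g : E n → ℝ) : Prop :=
  ∀ φ : E n → ℝ, IsTest Ω φ →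
    ∫ x in Ω, f x * fderiv ℝ φ x (basisVec i) = - ∫ x in Ω, g x * φ x

/-- `f ∈ H¹(Ω)`. -/
def MemH1 {n : ℕ} (Ω : Set (E n)) (f : E n → ℝ) : Prop :=
  MemL2 Ω f ∧ ∀ i, ∃ g, MemL2 Ω g ∧ HasWeakPartial Ω i f g

/-- A choice of the weak partial derivative in `L²(Ω)` (unique almost everywhere, and meaningful
for `f ∈ H¹(Ω)`). -/
def weakPartial {n : ℕ} (Ω : Set (E n)) (i : Fin n) (f : E n → ℝ) : E n → ℝ :=
  Classical.epsilon fun g => MemL2 Ω g ∧ HasWeakPartial Ω i f g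

/-- `w ∈ L²(Ω, Λᵏ)`. -/
def MemL2Form {n k : ℕ} (Ω : Set (E n)) (w : E n → Form n k) : Prop :=
  ∀ α, MemL2 Ω (comp w α)

/-- `w ∈ H¹(Ω, Λᵏ)`. -/
def MemH1Form {n k : ℕ} (Ω : Set (E n)) (w : E n → Form n k) : Prop :=
  ∀ α, MemH1 Ω (comp w α)

/-- The `L²(Ω, Λᵏ)` norm (of a form in that space). -/
def l2Norm {n k : ℕ} (Ω : Set (E n)) (w : E n → Form n k) : ℝ :=
  √ (∑ α, ∫ x in Ω, comp w α x ^ 2)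

/-- The `H¹(Ω, Λᵏ)` norm (of a form in that space). -/
def h1Norm {n k : ℕ} (Ω : Set (E n)) (w : E n → Form n k) : ℝ :=
  √ (∑ α, ((∫ x in Ω, comp w α x ^ 2)
      + ∑ i, ∫ x in Ω, weakPartial Ω i (comp w α) x ^ 2))

/-- The constant-coefficient product `ξ ∧ w` of a covector with a `k`-form, normalised as in
Mathlib's `extDeriv`: `(ξ ∧ w)(v₀, …, v_k) = ∑ᵢ (-1)ⁱ ξ(vᵢ) w(…, v̂ᵢ, …)`. -/
def covectorWedge {n k : ℕ} (ξ : E n →L[ℝ] ℝ) (w : Form n k) : Form n (k + 1) :=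
  ContinuousAlternatingMap.alternatizeUncurryFin (ξ.smulRight w)

/-- `η = dw` in the sense of distributions on `Ω`:
`∫_Ω φ η = - ∫_Ω dφ ∧ w` for every scalar test function `φ`; componentwise this is
`dw = ∑ᵢ ∑_α ∂ᵢ w_α dxⁱ ∧ dx^α` with distributional derivatives. -/
def HasWeakExtDeriv {n k : ℕ} (Ω : Set (E n)) (w : E n → Form n k)
    (η : E n → Form n (k + 1)) : Prop :=
  ∀ φ : E n → ℝ, IsTest Ω φ →
    ∫ x in Ω, φ x • η x = - ∫ x in Ω, covectorWedge (fderiv ℝ φ x) (w x)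

/-- `w ∈ H(d, Ω, Λᵏ)`: both `w` and its weak exterior derivative are square integrable. -/
def MemHd {n k : ℕ} (Ω : Set (E n)) (w : E n → Form n k) : Prop :=
  MemL2Form Ω w ∧ ∃ η, MemL2Form Ω η ∧ HasWeakExtDeriv Ω w η

/-- A choice of the weak exterior derivative in `L²` (unique almost everywhere, and meaningful
for `w ∈ H(d, Ω, Λᵏ)`). -/
def weakExtDeriv {n k : ℕ} (Ω : Set (E n)) (w : E n → Form n k) : E n → Form n (k + 1) :=
  Classical.epsilon fun η => MemL2Form Ω η ∧ HasWeakExtDeriv Ω w η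

/-! ### Polynomial forms -/

/-- `p ∈ P_s`: a polynomial function of degree at most `s`. -/
def IsPoly {n : ℕ} (s : ℕ) (p : E n → ℝ) : Prop :=
  ∃ P : MvPolynomial (Fin n) ℝ, P.totalDegree ≤ s ∧
    ∀ x : E n, p x = MvPolynomial.eval (fun i => x i) P

/-- `w ∈ P_s Λᵏ`. -/
def IsPolyForm {n k : ℕ} (s : ℕ) (w : E n → Form n k) : Prop :=
  ∀ α, IsPoly s (comp w α)

/-- The Koszul operator: contraction with the position vector field. -/
def koszul {n k : ℕ} (w : E n → Form n (k + 1)) (x : E n) : Form n k :=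
  (w x).curryLeft x

/-- `w ∈ P_r⁻ Λᵏ = P_{r-1} Λᵏ + κ P_{r-1} Λᵏ⁺¹` (for `r ≥ 1`). Since `κ P_{r-2} Λᵏ⁺¹` lies in
`P_{r-1} Λᵏ`, this is also `P_{r-1} Λᵏ + κ H_{r-1} Λᵏ⁺¹` with `H` the homogeneous polynomials. -/
def IsTrimmedForm {n k : ℕ} (r : ℕ) (w : E n → Form n k) : Prop :=
  ∃ (a : E n → Form n k) (b : E n → Form n (k + 1)),
    IsPolyForm (r - 1) a ∧ IsPolyForm (r - 1) b ∧ ∀ x, w x = a x + koszul b x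

/-! ### Meshes -/

/-- The closed simplex with vertex set `K`. -/
def simplex {n : ℕ} (K : Finset (E n)) : Set (E n) := convexHull ℝ (K : Set (E n))

/-- `T` (a finite set of vertex sets of `n`-simplices) is a geometrically conforming simplicial
mesh of `Ω`: two elements meet in the simplex spanned by their common vertices (a common face, or
the empty set), and the elements cover exactly the closure of `Ω`. -/
structure IsMesh {n : ℕ} (Ω : Set (E n)) (T : Finset (Finset (E n))) : Prop where
  card_eq : ∀ K ∈ T, K.card = n + 1
  affineIndependent : ∀ K ∈ T, AffineIndependent ℝ (fun a : K => (a : E n))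
  conforming : ∀ K ∈ T, ∀ L ∈ T,
    simplex K ∩ simplex L = convexHull ℝ ((K : Set (E n)) ∩ (L : Set (E n)))
  cover : ⋃ K ∈ T, simplex K = closure Ω

/-- Shape regularity with constant `σ`: each element `K` contains a ball of radius `ρ` with
`diam K ≤ σ ρ`. -/
def ShapeRegular {n : ℕ} (σ : ℝ) (T : Finset (Finset (E n))) : Prop :=
  ∀ K ∈ T, ∃ (c : E n) (ρ : ℝ), 0 < ρ ∧ Metric.ball c ρ ⊆ simplex K ∧
    Metric.diam (simplex K) ≤ σ * ρ

/-- The mesh size `h`, the maximal diameter of an element. -/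
def meshSize {n : ℕ} (T : Finset (Finset (E n))) : ℝ :=
  ⨆ K : T, Metric.diam (simplex K.1)

/-! ### Finite element spaces -/

/-- `w = p` almost everywhere on the element `K`, that is, `w|_K = p` as `L²` forms. -/
def EqOnElement {n k : ℕ} (K : Finset (E n)) (w p : E n → Form n k) : Prop :=
  w =ᵐ[volume.restrict (simplex K)] p

/-- `v ∈ V_h^{(0),k}`: the components lie in the Lagrange finite element space of degree `r`, that
is, in `H¹(Ω)`, with polynomial restrictions of degree at most `r` to each element. Such a form has
a representative which is continuous on `Ω`, and `v` is that representative. -/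
structure MemLagrange {n k : ℕ} (Ω : Set (E n)) (T : Finset (Finset (E n))) (r : ℕ)
    (v : E n → Form n k) : Prop where
  continuousOn : ContinuousOn v Ω
  memH1 : MemH1Form Ω v
  piecewise : ∀ K ∈ T, ∃ p, IsPolyForm r p ∧ EqOnElement K v p

/-- `u ∈ V_h^{(k)}`: `u ∈ H(d, Ω, Λᵏ)` and `u|_K ∈ P_r⁻ Λᵏ` for each element `K`. -/
structure MemVh {n k : ℕ} (Ω : Set (E n)) (T : Finset (Finset (E n))) (r : ℕ)
    (u : E n → Form n k) : Prop where
  memHd : MemHd Ω u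
  piecewise : ∀ K ∈ T, ∃ p, IsTrimmedForm r p ∧ EqOnElement K u p

/-! ### Degrees of freedom and the canonical interpolant -/

/-- The wedge product of a `k`-form and an `m`-form (sum over shuffles). -/
def wedge {n k m : ℕ} (w : Form n k) (q : Form n m) : E n [⋀^Fin (k + m)]→ₗ[ℝ] ℝ :=
  ((LinearMap.mul' ℝ ℝ).compAlternatingMap
    (w.toAlternatingMap.domCoprod q.toAlternatingMap)).domDomCongr finSumFinEquiv

/-- The integral `∫_f w` of a `d`-form `w` over the `d`-simplex `f` with ordered vertices
`a₀, …, a_d`: the integral over the unit `d`-simplex of the pullback of `w` under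
`t ↦ a₀ + ∑ᵢ tᵢ (aᵢ - a₀)`. -/
def faceIntegral {n d : ℕ} (a : Fin (d + 1) → E n) (w : E n → E n [⋀^Fin d]→ₗ[ℝ] ℝ) : ℝ :=
  ∫ t in {t : Fin d → ℝ | (∀ i, 0 ≤ t i) ∧ ∑ i, t i ≤ 1},
    w (a 0 + ∑ i, t i • (a i.succ - a 0)) (fun i => a i.succ - a 0)

/-- The polynomial forms `p`, `p'` on the element `K` have the same degrees of freedom of
`P_r⁻ Λᵏ`, which are `w ↦ ∫_f tr_f w ∧ q` for the faces `f` of `K` of each dimension `d ≥ k` and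
`q ∈ P_{r+k-d-1} Λ^{d-k}(f)`. Here `d = k + m` and `s = r + k - d - 1 ≥ 0`; every polynomial form on
`f` is the trace of one of the same degree on `ℝⁿ`. -/
def SameDofs {n k : ℕ} (r : ℕ) (K : Finset (E n)) (p p' : E n → Form n k) : Prop :=
  ∀ m s : ℕ, s + m + 1 = r →
    ∀ a : Fin (k + m + 1) → E n, Function.Injective a → (∀ i, a i ∈ K) →
      ∀ q : E n → Form n m, IsPolyForm s q →
        faceIntegral a (fun x => wedge (p x) (q x)) =
          faceIntegral a (fun x => wedge (p' x) (q x))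

/-- `u = Π_h v`: `u` is a function in `V_h^{(k)}` which has on each element the degrees of freedom
of the piecewise polynomial form `v`. -/
structure IsCanonicalInterpolant {n k : ℕ} (Ω : Set (E n)) (T : Finset (Finset (E n))) (r : ℕ)
    (v u : E n → Form n k) : Prop where
  memVh : MemVh Ω T r u
  dofs : ∀ K ∈ T, ∃ p p', IsPolyForm r p ∧ EqOnElement K v p ∧
    IsTrimmedForm r p' ∧ EqOnElement K u p' ∧ SameDofs r K p' p

end FEEC

end

noncomputable section

namespace FEEC

/-! ### Alternating maps in coordinates -/

/-! The core is unisolvence: a form in `P_r⁻Λᵏ` on a simplex whose degrees of freedom all vanish has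
zero trace there (`zeroTrace_of_faceMoments`). The induction is on the dimension of the face. The
trace of a trimmed form is trimmed, so one may consider a trimmed form `W` on the unit `d`-simplex
with zero traces on all facets and zero moments up to degree `r+k-d-1`. The coefficient of `dx^ρ` in
`dW` is divisible by every coordinate outside `ρ`, and Stokes' theorem makes its moments vanish up
to degree `r+k-d`. Writing it as that product of coordinates times `Q` and testing with `Q` itself
gives a nonnegative integrand with integral zero, hence `dW = 0`
(`polyExtDeriv_eq_zero_of_moments`). By Cartan's formula `dκ + κd` multiplies the part of `W` with
polynomial degree `j` by `j + k`; here it equals `dκW`, and `κW` has degree at most `r` because `κκ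
= 0`, so `W` has degree at most `r-1` (`totalDegree_le_of_extDeriv_eq_zero`). The divisibility
argument, applied now to the coefficients of `W`, gives `W = 0`.

For existence on one simplex, the degrees of freedom are prescribed face by face in increasing
dimension. The correction on a face is a combination of bubble forms, products of barycentric
coordinates with Whitney forms, whose trace vanishes on every face not containing the given one.
Unisolvence makes the linear system for the coefficients injective, and it is square
(`exists_bubble_moments`, `exists_trimmed_faceMoments`).

For conformity on the mesh, let two elements share a facet meeting `Ω` in its relative interior.
Continuity of `v` makes its two polynomial pieces agree on the plane of the facet, so the two local
interpolants have the same degrees of freedom there, and by unisolvence the same trace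
(`zeroTrace_facet`). Integrating by parts on each element, the facet terms cancel, and the
elementwise exterior derivative is the weak one. That the conormals of the elements sharing a facet
add up to zero is read off from the divergence theorem for one bump function, without counting
neighbours (`sum_conormal_eq_zero`).

For the estimates, pairs (polynomial form, interpolant) on the reference simplex form a
finite-dimensional space, so a bound between two seminorms needs only an inclusion of kernels. This
holds because constant forms are reproduced. An affine pullback changes the norms by powers of `‖B‖`
and `‖B⁻¹‖`, with `‖B‖ ‖B⁻¹‖ ≤ 4nσ`; the approximation error leaves one unmatched factor `‖B‖ ≤ nh`.
The Jacobian is the same on both sides. Summing over the elements, and identifying weak derivatives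
with elementwise ones, gives the theorem. -/

/-- The `k × k` minor of a list of vectors of `ℝᵈ` with columns `σ`. -/
def minor {d k : ℕ} (σ : Fin k → Fin d) : (Fin d → ℝ) [⋀^Fin k]→ₗ[ℝ] ℝ :=
  Matrix.detRowAlternating.compLinearMap (LinearMap.funLeft ℝ ℝ σ)

theorem minor_apply {d k : ℕ} (σ : Fin k → Fin d) (v : Fin k → Fin d → ℝ) :
    minor σ v = Matrix.det (Matrix.of fun i j => v i (σ j)) := rfl

theorem minor_eq_zero_of_col {d k : ℕ} (σ : Fin k → Fin d) (v : Fin k → Fin d → ℝ) (j : Fin k)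
    (h : ∀ i, v i (σ j) = 0) : minor σ v = 0 := by
  rw [minor_apply]
  exact Matrix.det_eq_zero_of_column_eq_zero j h

theorem minor_eq_zero_of_row {d k : ℕ} (σ : Fin k → Fin d) (v : Fin k → Fin d → ℝ) (i : Fin k)
    (h : ∀ j, v i (σ j) = 0) : minor σ v = 0 := by
  rw [minor_apply]
  exact Matrix.det_eq_zero_of_row_eq_zero i h

theorem orderEmb_eq_of_range {d k : ℕ} {σ τ : Fin k ↪o Fin d}
    (h : ∀ j, ∃ i, τ i = σ j) : σ = τ := by
  have hs : Finset.univ.map σ.toEmbedding ⊆ Finset.univ.map τ.toEmbedding := by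
    intro x hx
    simp only [Finset.mem_map, Finset.mem_univ, true_and] at hx ⊢
    obtain ⟨j, rfl⟩ := hx
    exact h j
  have he := Finset.eq_of_subset_of_card_le hs (by simp)
  have hr : Set.range σ = Set.range τ := by
    ext x
    have := congrArg (fun s => x ∈ s) he
    simpa using this
  have := (OrderEmbedding.range_inj (f := σ) (g := τ)).1 hr
  exact this

theorem minor_single {d k : ℕ} (σ τ : Fin k ↪o Fin d) :
    minor σ (fun i => Pi.single (τ i) 1) = if σ = τ then 1 else 0 := by
  split_ifs with h
  · subst h
    rw [minor_apply]
    have : (Matrix.of fun i j => (Pi.single (σ i) (1 : ℝ) : Fin d → ℝ) (σ j)) = 1 := by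
      ext i j
      simp [Matrix.one_apply, Pi.single_apply, eq_comm]
    rw [this, Matrix.det_one]
  · have : ∃ j, ∀ i, τ i ≠ σ j := by
      by_contra hc
      push Not at hc
      exact h (orderEmb_eq_of_range hc)
    obtain ⟨j, hj⟩ := this
    exact minor_eq_zero_of_col _ _ j fun i => by
      simp [(hj i).symm]

theorem exists_orderEmb_comp_perm {d k : ℕ} (J : Fin k → Fin d) (hJ : Function.Injective J) :
    ∃ (σ : Fin k ↪o Fin d) (π : Equiv.Perm (Fin k)), J = σ ∘ π := by
  have hm : StrictMono (J ∘ Tuple.sort J) :=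
    (Tuple.monotone_sort J).strictMono_of_injective
      (hJ.comp (Tuple.sort J).injective)
  refine ⟨OrderEmbedding.ofStrictMono _ hm, (Tuple.sort J)⁻¹, ?_⟩
  ext i
  simp

/-- A tuple of distinct basis vectors is a permutation of an increasing one, which changes the value
only by a sign. -/
theorem alternating_ext {V N : Type*} [AddCommGroup V] [Module ℝ V] [AddCommGroup N] [Module ℝ N]
    {d k : ℕ} (b : Module.Basis (Fin d) ℝ V)
    {f g : V [⋀^Fin k]→ₗ[ℝ] N}
    (h : ∀ σ : Fin k ↪o Fin d, (f fun i => b (σ i)) = g fun i => b (σ i)) : f = g := by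
  refine b.ext_alternating fun J hJ => ?_
  obtain ⟨σ, π, rfl⟩ := exists_orderEmb_comp_perm J hJ
  have h1 := f.map_perm (fun i => b (σ i)) π
  have h2 := g.map_perm (fun i => b (σ i)) π
  simp only [Function.comp_def] at h1 h2 ⊢
  rw [h1, h2, h]

theorem alternatingMap_sum_apply {ι V : Type*} [AddCommGroup V] [Module ℝ V] {k : ℕ}
    (s : Finset ι) (f : ι → V [⋀^Fin k]→ₗ[ℝ] ℝ) (v : Fin k → V) :
    (∑ i ∈ s, f i) v = ∑ i ∈ s, f i v := by
  classical
  induction s using Finset.induction_on with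
  | empty => simp
  | insert i s hi ih => simp [Finset.sum_insert hi, ih]

theorem alternating_expand {V : Type*} [AddCommGroup V] [Module ℝ V]
    {d k : ℕ} (b : Module.Basis (Fin d) ℝ V) (f : V [⋀^Fin k]→ₗ[ℝ] ℝ) (v : Fin k → V) :
    f v = ∑ σ : Fin k ↪o Fin d, f (fun i => b (σ i)) * minor σ (fun i => b.equivFun (v i)) := by
  have : f = ∑ σ : Fin k ↪o Fin d, f (fun i => b (σ i)) •
      (minor σ).compLinearMap (b.equivFun : V →ₗ[ℝ] Fin d → ℝ) := by
    refine alternating_ext b fun τ => ?_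
    simp only [alternatingMap_sum_apply, AlternatingMap.smul_apply,
      AlternatingMap.compLinearMap_apply]
    have : ∀ σ : Fin k ↪o Fin d, minor σ
        ((b.equivFun : V →ₗ[ℝ] Fin d → ℝ) ∘ fun i => b (τ i)) = if σ = τ then 1 else 0 := by
      intro σ
      rw [← minor_single]
      congr 1
      ext i j
      simp [Pi.single_apply, eq_comm]
    change _ = ∑ σ : Fin k ↪o Fin d, f (fun i => b (σ i)) • minor σ
        ((b.equivFun : V →ₗ[ℝ] Fin d → ℝ) ∘ fun i => b (τ i))
    simp only [this]
    simp
  conv_lhs => rw [this]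
  simp [alternatingMap_sum_apply]

/-! ### Forms in coordinates -/

/-- The standard basis of `ℝⁿ`. -/
def stdBasis (n : ℕ) : Module.Basis (Fin n) ℝ (E n) :=
  (EuclideanSpace.basisFun (Fin n) ℝ).toBasis

@[simp] theorem stdBasis_apply {n : ℕ} (i : Fin n) : stdBasis n i = basisVec i := by
  simp [stdBasis, basisVec]

@[simp] theorem stdBasis_equivFun {n : ℕ} (x : E n) (i : Fin n) :
    (stdBasis n).equivFun x i = x i := by
  simp [stdBasis]

theorem sum_coord_smul_basisVec {n : ℕ} (x : E n) : ∑ i, x i • basisVec i = x := by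
  have := (stdBasis n).sum_equivFun x
  simpa using this

@[simp] theorem basisVec_apply {n : ℕ} (i j : Fin n) :
    (basisVec i : E n) j = if j = i then 1 else 0 := by
  simp [basisVec]

/-- The constant form `dx^σ`. -/
def dx {n k : ℕ} (σ : Fin k ↪o Fin n) : Form n k :=
  { (minor σ).compLinearMap ((stdBasis n).equivFun : E n →ₗ[ℝ] Fin n → ℝ) with
    cont := by
      change Continuous fun v : Fin k → E n => Matrix.det (Matrix.of fun i j =>
        (stdBasis n).equivFun (v i) (σ j))
      simp only [stdBasis_equivFun]
      refine Continuous.matrix_det (continuous_matrix fun i j => ?_)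
      simp only [Matrix.of_apply]
      fun_prop }

theorem dx_apply {n k : ℕ} (σ : Fin k ↪o Fin n) (v : Fin k → E n) :
    dx σ v = minor σ (fun i => (stdBasis n).equivFun (v i)) := rfl

/-- An algebraic alternating map on `ℝⁿ` as a form. -/
def toForm {n k : ℕ} (f : E n [⋀^Fin k]→ₗ[ℝ] ℝ) : Form n k :=
  ∑ σ : Fin k ↪o Fin n, f (fun i => basisVec (σ i)) • dx σ

@[simp] theorem toForm_apply {n k : ℕ} (f : E n [⋀^Fin k]→ₗ[ℝ] ℝ) (v : Fin k → E n) :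
    toForm f v = f v := by
  rw [alternating_expand (stdBasis n) f v]
  simp [toForm, dx_apply]

theorem form_expand {n k : ℕ} (w : Form n k) :
    w = ∑ σ : Fin k ↪o Fin n, w (fun i => basisVec (σ i)) • dx σ := by
  ext v
  exact (toForm_apply w.toAlternatingMap v).symm

theorem form_expand_fun {n k : ℕ} (w : E n → Form n k) :
    w = fun x => ∑ σ : Fin k ↪o Fin n, comp w σ x • dx σ := by
  ext1 x
  exact form_expand (w x)

theorem form_ext {n k : ℕ} {w w' : Form n k}
    (h : ∀ σ : Fin k ↪o Fin n, w (fun i => basisVec (σ i)) = w' fun i => basisVec (σ i)) :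
    w = w' := by
  rw [form_expand w, form_expand w']
  simp [h]

theorem norm_basisVec {n : ℕ} (i : Fin n) : ‖(basisVec i : E n)‖ = 1 := by
  simp [basisVec]

theorem abs_comp_le {n k : ℕ} (w : E n → Form n k) (σ : Fin k ↪o Fin n) (x : E n) :
    |comp w σ x| ≤ ‖w x‖ := by
  have := (w x).le_opNorm (fun i => basisVec (σ i))
  simp only [norm_basisVec, Finset.prod_const_one, mul_one] at this
  exact this

theorem sum_sq_comp_le {n k : ℕ} : ∃ C : ℝ, 0 < C ∧ ∀ (w : E n → Form n k) (x : E n),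
    ∑ σ, comp w σ x ^ 2 ≤ C * ‖w x‖ ^ 2 := by
  refine ⟨Fintype.card (Fin k ↪o Fin n) + 1, by positivity, fun w x => ?_⟩
  calc ∑ σ, comp w σ x ^ 2 ≤ ∑ _σ : Fin k ↪o Fin n, ‖w x‖ ^ 2 :=
        Finset.sum_le_sum fun σ _ => by
          rw [← sq_abs]
          gcongr
          exact abs_comp_le w σ x
    _ = Fintype.card (Fin k ↪o Fin n) * ‖w x‖ ^ 2 := by simp
    _ ≤ _ := by nlinarith [sq_nonneg ‖w x‖]

theorem norm_sum_smul_sq_le {ι F : Type*} [Fintype ι] [NormedAddCommGroup F] [NormedSpace ℝ F]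
    (f : ι → F) : ∃ C : ℝ, 0 < C ∧ ∀ c : ι → ℝ, ‖∑ i, c i • f i‖ ^ 2 ≤ C * ∑ i, c i ^ 2 := by
  refine ⟨∑ i, ‖f i‖ ^ 2 + 1, by positivity, fun c => ?_⟩
  have h1 : ‖∑ i, c i • f i‖ ≤ ∑ i, |c i| * ‖f i‖ := by
    refine (norm_sum_le _ _).trans (le_of_eq ?_)
    simp [norm_smul]
  calc ‖∑ i, c i • f i‖ ^ 2 ≤ (∑ i, |c i| * ‖f i‖) ^ 2 := by gcongr
    _ ≤ (∑ i, |c i| ^ 2) * ∑ i, ‖f i‖ ^ 2 := Finset.sum_mul_sq_le_sq_mul_sq _ _ _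
    _ ≤ _ := by
      simp only [sq_abs]
      have : 0 ≤ ∑ i, c i ^ 2 := by positivity
      nlinarith

theorem norm_sq_le_comp {n k : ℕ} : ∃ C : ℝ, 0 < C ∧ ∀ (w : E n → Form n k) (x : E n),
    ‖w x‖ ^ 2 ≤ C * ∑ σ, comp w σ x ^ 2 := by
  obtain ⟨C, hC, h⟩ := norm_sum_smul_sq_le (fun σ : Fin k ↪o Fin n => dx σ)
  refine ⟨C, hC, fun w x => ?_⟩
  rw [form_expand (w x)]
  exact h fun σ => comp w σ x

/-! ### Polynomial functions -/

/-- `f` is a polynomial function of degree at most `s` on `ℝᵈ`. -/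
def PolyFun {d : ℕ} (s : ℕ) (f : (Fin d → ℝ) → ℝ) : Prop :=
  ∃ P : MvPolynomial (Fin d) ℝ, P.totalDegree ≤ s ∧ ∀ t, f t = MvPolynomial.eval t P

theorem polyFun_eval {d s : ℕ} {P : MvPolynomial (Fin d) ℝ} (h : P.totalDegree ≤ s) :
    PolyFun s fun t => MvPolynomial.eval t P := ⟨P, h, fun _ => rfl⟩

theorem isPoly_iff {n s : ℕ} {p : E n → ℝ} :
    IsPoly s p ↔ PolyFun s fun t => p (WithLp.toLp 2 t) := by
  constructor
  · rintro ⟨P, hP, h⟩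
    exact ⟨P, hP, fun t => h _⟩
  · rintro ⟨P, hP, h⟩
    exact ⟨P, hP, fun x => h x.ofLp⟩

/-! ### Closure properties and the identity theorem for polynomial functions on coordinate space. -/

section Closure

variable {d s s' : ℕ} {f g : (Fin d → ℝ) → ℝ}

theorem PolyFun.mono (hf : PolyFun s f) (h : s ≤ s') : PolyFun s' f := by
  obtain ⟨P, hP, hf⟩ := hf
  exact ⟨P, hP.trans h, hf⟩

theorem polyFun_const (c : ℝ) : PolyFun s fun _ : Fin d → ℝ => c :=
  ⟨MvPolynomial.C c, by simp, fun t => by simp⟩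

theorem PolyFun.add (hf : PolyFun s f) (hg : PolyFun s g) : PolyFun s fun t => f t + g t := by
  obtain ⟨P, hP, hf⟩ := hf
  obtain ⟨Q, hQ, hg⟩ := hg
  exact ⟨P + Q, (MvPolynomial.totalDegree_add _ _).trans (max_le hP hQ), fun t => by
    simp [hf, hg]⟩

theorem PolyFun.mul (hf : PolyFun s f) (hg : PolyFun s' g) :
    PolyFun (s + s') fun t => f t * g t := by
  obtain ⟨P, hP, hf⟩ := hf
  obtain ⟨Q, hQ, hg⟩ := hg
  exact ⟨P * Q, (MvPolynomial.totalDegree_mul _ _).trans (add_le_add hP hQ), fun t => by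
    simp [hf, hg]⟩

theorem PolyFun.mul_const (hf : PolyFun s f) (c : ℝ) : PolyFun s fun t => f t * c :=
  (hf.mul (polyFun_const (s := 0) c)).mono (by simp)

theorem PolyFun.const_mul (hf : PolyFun s f) (c : ℝ) : PolyFun s fun t => c * f t := by
  simpa [mul_comm] using hf.mul_const c

theorem PolyFun.sub (hf : PolyFun s f) (hg : PolyFun s g) : PolyFun s fun t => f t - g t := by
  simpa [sub_eq_add_neg] using hf.add (hg.const_mul (-1))

theorem PolyFun.sum {ι : Type*} {S : Finset ι} {F : ι → (Fin d → ℝ) → ℝ}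
    (h : ∀ i ∈ S, PolyFun s (F i)) : PolyFun s fun t => ∑ i ∈ S, F i t := by
  classical
  induction S using Finset.induction_on with
  | empty => simpa using polyFun_const 0
  | insert i S hi ih =>
    simp only [Finset.sum_insert hi]
    exact (h i (by simp)).add (ih fun j hj => h j (by simp [hj]))

theorem polyFun_coord (i : Fin d) (hs : 1 ≤ s) : PolyFun s fun t : Fin d → ℝ => t i :=
  ⟨MvPolynomial.X i, by simpa using hs, fun t => by simp⟩

theorem PolyFun.prod {ι : Type*} {S : Finset ι} {F : ι → (Fin d → ℝ) → ℝ}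
    (h : ∀ i ∈ S, PolyFun 1 (F i)) : PolyFun S.card fun t => ∏ i ∈ S, F i t := by
  classical
  induction S using Finset.induction_on with
  | empty => simpa using polyFun_const 1
  | insert i S hi ih =>
    simp only [Finset.prod_insert hi, Finset.card_insert_of_notMem hi]
    have := (h i (by simp)).mul (ih fun j hj => h j (by simp [hj]))
    rwa [add_comm] at this

theorem PolyFun.contDiff (hf : PolyFun s f) : ContDiff ℝ ∞ f := by
  obtain ⟨P, -, hf⟩ := hf
  have : f = fun t => MvPolynomial.eval t P := funext hf
  rw [this]
  have h := (AnalyticOnNhd.eval_mvPolynomial (𝕜 := ℝ) P).contDiffOn (n := ∞) uniqueDiffOn_univ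
  exact contDiffOn_univ.1 h

theorem PolyFun.continuous (hf : PolyFun s f) : Continuous f := hf.contDiff.continuous

theorem PolyFun.comp {m : ℕ} {G : (Fin m → ℝ) → Fin d → ℝ} (hf : PolyFun s f)
    (hG : ∀ i, PolyFun 1 fun t => G t i) : PolyFun s fun t => f (G t) := by
  obtain ⟨P, hP, hf⟩ := hf
  have : (fun t => f (G t)) = fun t => ∑ e ∈ P.support, P.coeff e * ∏ i, G t i ^ e i := by
    ext t
    rw [hf, MvPolynomial.eval_eq']
  rw [this]
  refine PolyFun.sum fun e he => ?_
  refine PolyFun.const_mul ?_ _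
  have hpow : ∀ (i : Fin d) (N : ℕ), PolyFun N fun t => G t i ^ N := by
    intro i N
    induction N with
    | zero => simpa using polyFun_const 1
    | succ N ih => simpa [pow_succ] using ih.mul (hG i)
  have hprod : ∀ S : Finset (Fin d), PolyFun (∑ i ∈ S, e i) fun t => ∏ i ∈ S, G t i ^ e i := by
    intro S
    induction S using Finset.induction_on with
    | empty => simpa using polyFun_const 1
    | insert i S hi ih =>
      simp only [Finset.prod_insert hi, Finset.sum_insert hi]
      exact (hpow i _).mul ih
  refine (hprod Finset.univ).mono (le_trans ?_ hP)
  have := MvPolynomial.le_totalDegree he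
  rwa [Finsupp.sum_fintype _ _ (fun _ => rfl)] at this

theorem polyFun_affine {X : Type*} [AddCommGroup X] [Module ℝ X] (L : (Fin d → ℝ) →ₗ[ℝ] X)
    (φ : X →ₗ[ℝ] ℝ) (x : X) (hs : 1 ≤ s) : PolyFun s fun t => φ (x + L t) := by
  have : (fun t => φ (x + L t)) = fun t => φ x + ∑ i, t i * φ (L (Pi.single i 1)) := by
    ext t
    rw [map_add]
    conv_lhs => rw [pi_eq_sum_univ' t]
    simp
  rw [this]
  exact (polyFun_const _).add (PolyFun.sum fun i _ => (polyFun_coord i hs).mul_const _)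

theorem PolyFun.eq_zero_of_isOpen {U : Set (Fin d → ℝ)} (hU : IsOpen U) (hne : U.Nonempty)
    {P : MvPolynomial (Fin d) ℝ} (h : ∀ t ∈ U, MvPolynomial.eval t P = 0) : P = 0 := by
  obtain ⟨t, ht⟩ := hne
  obtain ⟨ε, hε, hball⟩ := Metric.isOpen_iff.1 hU t ht
  refine MvPolynomial.funext_set (fun i => Metric.ball (t i) ε) (fun i => ?_) fun x hx => ?_
  · rw [Real.ball_eq_Ioo]
    exact Set.Ioo_infinite (by linarith)
  · rw [map_zero]
    refine h x (hball ?_)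
    rw [ball_pi _ hε]
    exact hx

end Closure

/-! ### Polynomial functions on Euclidean space and affine substitutions. -/

section IsPolyClosure

variable {n s s' : ℕ} {f g : E n → ℝ}

/-- The coordinates of `ℝⁿ` as a linear map. -/
def ofLpL (n : ℕ) : E n →ₗ[ℝ] Fin n → ℝ := ((stdBasis n).equivFun : E n →ₗ[ℝ] Fin n → ℝ)

theorem ofLpL_apply (x : E n) : ofLpL n x = x.ofLp := by
  ext i
  simp [ofLpL, -stdBasis_equivFun, stdBasis]

theorem IsPoly.comp_affine {d : ℕ} (hf : IsPoly s f) (x : E n) (L : (Fin d → ℝ) →ₗ[ℝ] E n) :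
    PolyFun s fun t => f (x + L t) := by
  have h := (isPoly_iff.1 hf).comp (G := fun t => (x + L t).ofLp) fun i =>
    polyFun_affine L ((LinearMap.proj i).comp (ofLpL n)) x le_rfl |> fun h => by
      simpa [ofLpL_apply] using h
  exact h

theorem PolyFun.comp_isPoly {d : ℕ} {f : (Fin d → ℝ) → ℝ} (hf : PolyFun s f)
    (c : Fin d → ℝ) (L : E n →ₗ[ℝ] Fin d → ℝ) : IsPoly s fun x => f (c + L x) := by
  rw [isPoly_iff]
  refine hf.comp (G := fun t => c + L (WithLp.toLp 2 t)) fun i => ?_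
  exact polyFun_affine (L.comp (WithLp.linearEquiv 2 ℝ (Fin n → ℝ)).symm.toLinearMap)
    (LinearMap.proj i) c le_rfl

theorem IsPoly.comp_isPoly {m : ℕ} (hf : IsPoly s f) (x : E n) (L : E m →ₗ[ℝ] E n) :
    IsPoly s fun y => f (x + L y) := by
  rw [isPoly_iff]
  exact hf.comp_affine x (L.comp (WithLp.linearEquiv 2 ℝ (Fin m → ℝ)).symm.toLinearMap)

theorem IsPoly.mono (hf : IsPoly s f) (h : s ≤ s') : IsPoly s' f :=
  isPoly_iff.2 ((isPoly_iff.1 hf).mono h)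

theorem isPoly_const (c : ℝ) : IsPoly s fun _ : E n => c := isPoly_iff.2 (polyFun_const c)

theorem IsPoly.add (hf : IsPoly s f) (hg : IsPoly s g) : IsPoly s fun x => f x + g x :=
  isPoly_iff.2 ((isPoly_iff.1 hf).add (isPoly_iff.1 hg))

theorem IsPoly.sub (hf : IsPoly s f) (hg : IsPoly s g) : IsPoly s fun x => f x - g x :=
  isPoly_iff.2 ((isPoly_iff.1 hf).sub (isPoly_iff.1 hg))

theorem IsPoly.mul (hf : IsPoly s f) (hg : IsPoly s' g) : IsPoly (s + s') fun x => f x * g x :=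
  isPoly_iff.2 ((isPoly_iff.1 hf).mul (isPoly_iff.1 hg))

theorem IsPoly.mul_const (hf : IsPoly s f) (c : ℝ) : IsPoly s fun x => f x * c :=
  isPoly_iff.2 ((isPoly_iff.1 hf).mul_const c)

theorem IsPoly.const_mul (hf : IsPoly s f) (c : ℝ) : IsPoly s fun x => c * f x :=
  isPoly_iff.2 ((isPoly_iff.1 hf).const_mul c)

theorem IsPoly.sum {ι : Type*} {S : Finset ι} {F : ι → E n → ℝ}
    (h : ∀ i ∈ S, IsPoly s (F i)) : IsPoly s fun x => ∑ i ∈ S, F i x :=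
  isPoly_iff.2 (PolyFun.sum fun i hi => isPoly_iff.1 (h i hi))

theorem IsPoly.contDiff (hf : IsPoly s f) : ContDiff ℝ ∞ f := by
  have := (isPoly_iff.1 hf).contDiff
  exact this.comp (EuclideanSpace.equiv (Fin n) ℝ).contDiff

end IsPolyClosure

/-! ### Polynomial forms -/

section IsPolyForm

variable {n k s s' r : ℕ} {w w' : E n → Form n k}

theorem isPolyForm_iff : IsPolyForm s w ↔ ∀ v : Fin k → E n, IsPoly s fun x => w x v := by
  refine ⟨fun h v => ?_, fun h α => h _⟩
  have : (fun x => w x v) = fun x => ∑ σ : Fin k ↪o Fin n, comp w σ x * dx σ v := by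
    ext x
    conv_lhs => rw [form_expand (w x)]
    simp [comp]
  rw [this]
  exact IsPoly.sum fun σ _ => (h σ).mul_const _

theorem IsPolyForm.mono (h : IsPolyForm s w) (hs : s ≤ s') : IsPolyForm s' w :=
  fun α => (h α).mono hs

theorem IsPolyForm.add (h : IsPolyForm s w) (h' : IsPolyForm s w') :
    IsPolyForm s fun x => w x + w' x := fun α => (h α).add (h' α)

theorem IsPolyForm.sub (h : IsPolyForm s w) (h' : IsPolyForm s w') :
    IsPolyForm s fun x => w x - w' x := fun α => (h α).sub (h' α)

theorem IsPolyForm.const_smul (h : IsPolyForm s w) (c : ℝ) :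
    IsPolyForm s fun x => c • w x := fun α => (h α).const_mul c

theorem isPolyForm_const (w : Form n k) : IsPolyForm s fun _ => w :=
  fun _ => isPoly_const _

theorem IsPolyForm.smul {f : E n → ℝ} (hf : IsPoly s f) (h : IsPolyForm s' w) :
    IsPolyForm (s + s') fun x => f x • w x := fun α => hf.mul (h α)

theorem IsPolyForm.contDiff (h : IsPolyForm s w) : ContDiff ℝ ∞ w := by
  rw [form_expand_fun w]
  exact ContDiff.sum fun σ _ => (h σ).contDiff.smul contDiff_const

theorem IsPolyForm.continuous (h : IsPolyForm s w) : Continuous w := h.contDiff.continuous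

theorem koszul_apply (b : E n → Form n (k + 1)) (x : E n) (v : Fin k → E n) :
    koszul b x v = b x (Fin.cons x v) := rfl

theorem koszul_expand (b : E n → Form n (k + 1)) (x : E n) (v : Fin k → E n) :
    koszul b x v = ∑ i, x i * b x (Fin.cons (basisVec i) v) := by
  have h := congrArg (fun y => (b x).curryLeft y v) (sum_coord_smul_basisVec x)
  simp only [map_sum, map_smul, ContinuousAlternatingMap.sum_apply,
    ContinuousAlternatingMap.smul_apply] at h
  exact h.symm

theorem IsPolyForm.koszul {b : E n → Form n (k + 1)} (h : IsPolyForm s b) :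
    IsPolyForm (s + 1) (koszul b) := by
  rw [isPolyForm_iff] at h ⊢
  intro v
  simp only [koszul_expand]
  refine IsPoly.sum fun i _ => ?_
  rw [add_comm]
  exact IsPoly.mul (isPoly_iff.2 (polyFun_coord i le_rfl)) (h _)

theorem IsTrimmedForm.isPolyForm (hr : 1 ≤ r) (h : IsTrimmedForm r w) : IsPolyForm r w := by
  obtain ⟨a, b, ha, hb, hw⟩ := h
  have : w = fun x => a x + FEEC.koszul b x := funext hw
  rw [this]
  have hb' := hb.koszul
  rw [Nat.sub_add_cancel hr] at hb'
  exact (ha.mono (by omega)).add hb'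

theorem IsTrimmedForm.add (h : IsTrimmedForm r w) (h' : IsTrimmedForm r w') :
    IsTrimmedForm r fun x => w x + w' x := by
  obtain ⟨a, b, ha, hb, hw⟩ := h
  obtain ⟨a', b', ha', hb', hw'⟩ := h'
  refine ⟨_, _, ha.add ha', hb.add hb', fun x => ?_⟩
  ext v
  simp [hw, hw', koszul_apply]
  ring

theorem IsTrimmedForm.const_smul (h : IsTrimmedForm r w) (c : ℝ) :
    IsTrimmedForm r fun x => c • w x := by
  obtain ⟨a, b, ha, hb, hw⟩ := h
  refine ⟨_, _, ha.const_smul c, hb.const_smul c, fun x => ?_⟩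
  ext v
  simp [hw, koszul_apply]

theorem IsTrimmedForm.sub (h : IsTrimmedForm r w) (h' : IsTrimmedForm r w') :
    IsTrimmedForm r fun x => w x - w' x := by
  have e : (fun x => w x - w' x) = fun x => w x + (-1 : ℝ) • w' x := by
    ext x v
    simp [sub_eq_add_neg]
  rw [e]
  exact h.add (h'.const_smul (-1))

theorem IsPolyForm.isTrimmedForm (h : IsPolyForm (r - 1) w) : IsTrimmedForm r w :=
  ⟨w, fun _ => 0, h, isPolyForm_const 0, fun x => by ext v; simp [koszul_apply]⟩

theorem IsTrimmedForm.sum {ι : Type*} {S : Finset ι} {F : ι → E n → Form n k}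
    (h : ∀ i ∈ S, IsTrimmedForm r (F i)) : IsTrimmedForm r fun x => ∑ i ∈ S, F i x := by
  classical
  induction S using Finset.induction_on with
  | empty => simpa using IsPolyForm.isTrimmedForm (isPolyForm_const (0 : Form n k))
  | insert i S hi ih =>
    simp only [Finset.sum_insert hi]
    exact (h i (by simp)).add (ih fun j hj => h j (by simp [hj]))

/-- The pullback of a form under the affine map `y ↦ x + B y`. -/
def pullback (x : E n) (B : E n →L[ℝ] E n) (w : E n → Form n k) (y : E n) : Form n k :=
  (w (x + B y)).compContinuousLinearMap B

@[simp] theorem pullback_apply (x : E n) (B : E n →L[ℝ] E n) (w : E n → Form n k) (y : E n)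
    (v : Fin k → E n) : pullback x B w y v = w (x + B y) fun i => B (v i) := rfl

theorem IsPolyForm.pullback (h : IsPolyForm s w) (x : E n) (B : E n →L[ℝ] E n) :
    IsPolyForm s (pullback x B w) := by
  rw [isPolyForm_iff] at h ⊢
  intro v
  simp only [pullback_apply]
  exact (h _).comp_isPoly x B.toLinearMap

/-- Contraction with the position field commutes with linear pullback. The translation `x`
contributes only the contraction of `b` with a constant vector, which does not raise the degree and
joins the untwisted summand. -/
theorem IsTrimmedForm.pullback (h : IsTrimmedForm r w) (x : E n) (B : E n →L[ℝ] E n) :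
    IsTrimmedForm r (pullback x B w) := by
  obtain ⟨a, b, ha, hb, hw⟩ := h
  have hb' : IsPolyForm (r - 1) fun y => (b y).curryLeft x := by
    rw [isPolyForm_iff] at hb ⊢
    exact fun v => hb _
  refine ⟨_, FEEC.pullback x B b, (ha.pullback x B).add (hb'.pullback x B), hb.pullback x B,
    fun y => ?_⟩
  ext v
  have h1 : (b (x + B y)) (Fin.cons (x + B y) fun i => B (v i)) =
      (b (x + B y)).curryLeft x (fun i => B (v i)) +
        (b (x + B y)).curryLeft (B y) (fun i => B (v i)) := by
    rw [← ContinuousAlternatingMap.add_apply, ← map_add]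
    rfl
  have h2 : (fun i => B ((Fin.cons y v : Fin (k + 1) → E n) i)) =
      Fin.cons (B y) fun i => B (v i) := by
    ext1 i
    refine Fin.cases ?_ (fun i => ?_) i <;> simp
  simp only [pullback_apply, hw, koszul_apply, ContinuousAlternatingMap.add_apply, h1, h2]
  rw [add_assoc]
  rfl

end IsPolyForm

/-! ### Affine changes of variables -/

/-- The factor `c` is a ratio of Haar measures and is never computed as a determinant: later it is
forced to be `1`, absorbed into a conormal, or present on both sides of an estimate. -/
theorem exists_integral_affine {V W : Type*} [NormedAddCommGroup V] [NormedSpace ℝ V]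
    [FiniteDimensional ℝ V] [MeasurableSpace V] [BorelSpace V] [NormedAddCommGroup W]
    [NormedSpace ℝ W] [FiniteDimensional ℝ W] [MeasurableSpace W] [BorelSpace W]
    (μ : Measure V) [μ.IsAddHaarMeasure] (ν : Measure W) [ν.IsAddHaarMeasure]
    (L : V ≃L[ℝ] W) (x : W) : ∃ c : ℝ, 0 < c ∧
      (∀ (f : W → ℝ) (S : Set W), MeasurableSet S →
        ∫ y in S, f y ∂ν = c * ∫ v in (fun v => x + L v) ⁻¹' S, f (x + L v) ∂μ) ∧
      (∀ S : Set W, ν S = ENNReal.ofReal c * μ ((fun v => x + L v) ⁻¹' S)) := by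
  have := L.isAddHaarMeasure_map μ
  have hc := Measure.isAddLeftInvariant_eq_smul ν (μ.map L)
  have hcpos := Measure.addHaarScalarFactor_pos_of_isAddHaarMeasure ν (μ.map L)
  set c := Measure.addHaarScalarFactor ν (μ.map L)
  let Φ : V ≃ₜ W := L.toHomeomorph.trans (Homeomorph.addLeft x)
  have hΦ : ∀ v, Φ v = x + L v := fun _ => rfl
  have hmap : μ.map Φ = μ.map L := by
    have : (Φ : V → W) = (fun y => x + y) ∘ L := rfl
    rw [this, ← Measure.map_map (measurable_const_add x) L.continuous.measurable,
      map_add_left_eq_self]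
  refine ⟨c, hcpos, fun f S hS => ?_, fun S => ?_⟩
  · rw [hc, ← hmap, Measure.restrict_smul, integral_smul_nnreal_measure,
      Φ.measurableEmbedding.setIntegral_map]
    rfl
  · rw [ENNReal.ofReal_coe_nnreal, hc, ← hmap, Measure.smul_apply,
      Φ.measurableEmbedding.map_apply]
    rfl

/-! ### The unit simplex -/

/-- The unit simplex of `ℝᵈ`. -/
def unitSimplex (d : ℕ) : Set (Fin d → ℝ) := {t | (∀ i, 0 ≤ t i) ∧ ∑ i, t i ≤ 1}

/-- The interior of the unit simplex. -/
def unitSimplexInt (d : ℕ) : Set (Fin d → ℝ) := {t | (∀ i, 0 < t i) ∧ ∑ i, t i < 1}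

/-- The barycentric coordinates of a point with respect to the unit simplex. -/
def bary {d : ℕ} (t : Fin d → ℝ) : Fin (d + 1) → ℝ := Fin.cons (1 - ∑ i, t i) t

/-- The linear part of `bary`. -/
def bary0 {d : ℕ} (t : Fin d → ℝ) : Fin (d + 1) → ℝ := Fin.cons (-∑ i, t i) t

section UnitSimplex

variable {d : ℕ}

@[simp] theorem bary_zero (t : Fin d → ℝ) : bary t 0 = 1 - ∑ i, t i := rfl
@[simp] theorem bary_succ (t : Fin d → ℝ) (i : Fin d) : bary t i.succ = t i := rfl
@[simp] theorem bary0_zero (t : Fin d → ℝ) : bary0 t 0 = -∑ i, t i := rfl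
@[simp] theorem bary0_succ (t : Fin d → ℝ) (i : Fin d) : bary0 t i.succ = t i := rfl

@[simp] theorem sum_bary (t : Fin d → ℝ) : ∑ j, bary t j = 1 := by simp [Fin.sum_univ_succ]

@[simp] theorem sum_bary0 (t : Fin d → ℝ) : ∑ j, bary0 t j = 0 := by simp [Fin.sum_univ_succ]

theorem bary_tail {c : Fin (d + 1) → ℝ} (h : ∑ j, c j = 1) : bary (Fin.tail c) = c := by
  ext j
  refine Fin.cases ?_ (fun i => ?_) j
  · rw [Fin.sum_univ_succ] at h
    simp only [bary_zero, Fin.tail]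
    linarith
  · rfl

theorem bary0_tail {c : Fin (d + 1) → ℝ} (h : ∑ j, c j = 0) : bary0 (Fin.tail c) = c := by
  ext j
  refine Fin.cases ?_ (fun i => ?_) j
  · rw [Fin.sum_univ_succ] at h
    simp only [bary0_zero, Fin.tail]
    linarith
  · rfl

theorem bary0_add (u v : Fin d → ℝ) : bary0 (u + v) = bary0 u + bary0 v := by
  ext j
  refine Fin.cases ?_ (fun i => ?_) j <;> simp [Finset.sum_add_distrib, add_comm]

theorem bary0_smul (c : ℝ) (u : Fin d → ℝ) : bary0 (c • u) = c • bary0 u := by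
  ext j
  refine Fin.cases ?_ (fun i => ?_) j <;> simp [Finset.mul_sum]

theorem bary_add (t u : Fin d → ℝ) : bary (t + u) = bary t + bary0 u := by
  ext j
  refine Fin.cases ?_ (fun i => ?_) j <;> simp [Finset.sum_add_distrib]
  ring

theorem mem_unitSimplex_iff {t : Fin d → ℝ} : t ∈ unitSimplex d ↔ ∀ j, 0 ≤ bary t j := by
  simp [unitSimplex, Fin.forall_fin_succ, and_comm]

theorem mem_unitSimplexInt_iff {t : Fin d → ℝ} : t ∈ unitSimplexInt d ↔ ∀ j, 0 < bary t j := by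
  simp [unitSimplexInt, Fin.forall_fin_succ, and_comm]

theorem isClosed_unitSimplex : IsClosed (unitSimplex d) := by
  have h : unitSimplex d = (⋂ i, {t | 0 ≤ t i}) ∩ {t | ∑ i, t i ≤ 1} := by
    ext t
    simp [unitSimplex]
  rw [h]
  refine IsClosed.inter ?_ ?_
  · exact isClosed_iInter fun i => isClosed_le continuous_const (continuous_apply i)
  · exact isClosed_le (by fun_prop) continuous_const

theorem isCompact_unitSimplex : IsCompact (unitSimplex d) := by
  refine (isCompact_Icc (a := (0 : Fin d → ℝ)) (b := 1)).of_isClosed_subset isClosed_unitSimplex ?_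
  intro t ht
  refine ⟨fun i => ht.1 i, fun i => le_trans ?_ ht.2⟩
  exact Finset.single_le_sum (f := t) (fun j _ => ht.1 j) (Finset.mem_univ i)

theorem measurableSet_unitSimplex : MeasurableSet (unitSimplex d) :=
  isClosed_unitSimplex.measurableSet

theorem isOpen_unitSimplexInt : IsOpen (unitSimplexInt d) := by
  have h : unitSimplexInt d = (⋂ i, {t | 0 < t i}) ∩ {t | ∑ i, t i < 1} := by
    ext t
    simp [unitSimplexInt]
  rw [h]
  refine IsOpen.inter ?_ ?_
  · exact isOpen_iInter_of_finite fun i => isOpen_lt continuous_const (continuous_apply i)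
  · exact isOpen_lt (by fun_prop) continuous_const

theorem unitSimplexInt_subset : unitSimplexInt d ⊆ unitSimplex d :=
  fun _ ht => ⟨fun i => (ht.1 i).le, ht.2.le⟩

theorem unitSimplexInt_nonempty : (unitSimplexInt d).Nonempty := by
  refine ⟨fun _ => 1 / (d + 1), fun i => by positivity, ?_⟩
  simp only [Finset.sum_const, Finset.card_univ, Fintype.card_fin, nsmul_eq_mul, mul_one_div]
  rw [div_lt_one (by positivity)]
  linarith

theorem unitSimplex_subset_closure : unitSimplex d ⊆ closure (unitSimplexInt d) := by
  intro t ht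
  obtain ⟨z, hz⟩ := unitSimplexInt_nonempty (d := d)
  have hlim : Filter.Tendsto (fun ε : ℝ => t + ε • (z - t)) (nhdsWithin 0 (Set.Ioo 0 1))
      (nhds t) := by
    have : Continuous fun ε : ℝ => t + ε • (z - t) := by fun_prop
    have h := this.tendsto 0
    simp only [zero_smul, add_zero] at h
    exact h.mono_left nhdsWithin_le_nhds
  have : (nhdsWithin (0 : ℝ) (Set.Ioo 0 1)).NeBot := by
    rw [← mem_closure_iff_nhdsWithin_neBot, closure_Ioo (by norm_num)]
    simp
  refine mem_closure_of_tendsto hlim ?_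
  filter_upwards [self_mem_nhdsWithin] with ε hε
  refine ⟨fun i => ?_, ?_⟩
  · have h1 := ht.1 i
    have h2 := hz.1 i
    simp only [Pi.add_apply, Pi.smul_apply, Pi.sub_apply, smul_eq_mul]
    nlinarith [hε.1, hε.2, mul_pos hε.1 h2, mul_nonneg (sub_nonneg.2 hε.2.le) h1]
  · have h1 := ht.2
    have h2 := hz.2
    simp only [Pi.add_apply, Pi.smul_apply, Pi.sub_apply, smul_eq_mul, Finset.sum_add_distrib,
      ← Finset.mul_sum, Finset.sum_sub_distrib]
    nlinarith [hε.1, hε.2, mul_pos hε.1 (sub_pos.2 h2),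
      mul_nonneg (sub_nonneg.2 hε.2.le) (sub_nonneg.2 h1)]

theorem volume_unitSimplex_pos : 0 < volume (unitSimplex d) :=
  (isOpen_unitSimplexInt.measure_pos _ unitSimplexInt_nonempty).trans_le
    (measure_mono unitSimplexInt_subset)

theorem volume_unitSimplex_lt_top : volume (unitSimplex d) < ⊤ := isCompact_unitSimplex.measure_lt_top

theorem integrableOn_unitSimplex {F : Type*} [NormedAddCommGroup F] {f : (Fin d → ℝ) → F}
    (hf : Continuous f) : IntegrableOn f (unitSimplex d) :=
  hf.continuousOn.integrableOn_compact isCompact_unitSimplex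

theorem eq_zero_on_unitSimplex {f : (Fin d → ℝ) → ℝ} (hf : Continuous f)
    (h : ∀ t ∈ unitSimplexInt d, f t = 0) : ∀ t ∈ unitSimplex d, f t = 0 := by
  intro t ht
  have hcl : IsClosed {t | f t = 0} := isClosed_eq hf continuous_const
  exact closure_minimal (fun t ht => h t ht) hcl (unitSimplex_subset_closure ht)

theorem eq_zero_of_integral_unitSimplex {f : (Fin d → ℝ) → ℝ} (hf : Continuous f)
    (h0 : ∀ t ∈ unitSimplex d, 0 ≤ f t) (h : ∫ t in unitSimplex d, f t = 0) :
    ∀ t ∈ unitSimplex d, f t = 0 := by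
  refine eq_zero_on_unitSimplex hf fun t ht => ?_
  rw [setIntegral_eq_zero_iff_of_nonneg_ae
    ((ae_restrict_iff' measurableSet_unitSimplex).2 (ae_of_all _ h0))
    (integrableOn_unitSimplex hf)] at h
  have h' : f =ᵐ[volume.restrict (unitSimplexInt d)] fun _ => 0 :=
    h.filter_mono (ae_mono (Measure.restrict_mono unitSimplexInt_subset le_rfl))
  exact Measure.eqOn_open_of_ae_eq h' isOpen_unitSimplexInt hf.continuousOn
    continuousOn_const ht

/-- The affine map of the unit simplex permuting its vertices. -/
def permMap (π : Equiv.Perm (Fin (d + 1))) (t : Fin d → ℝ) : Fin d → ℝ := fun i => bary t (π i.succ)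

theorem bary_permMap (π : Equiv.Perm (Fin (d + 1))) (t : Fin d → ℝ) :
    bary (permMap π t) = bary t ∘ π := by
  have : permMap π t = Fin.tail (bary t ∘ π) := rfl
  rw [this, bary_tail]
  simp only [Function.comp_apply]
  rw [Equiv.sum_comp π (bary t), sum_bary]

theorem permMap_permMap_symm (π : Equiv.Perm (Fin (d + 1))) (t : Fin d → ℝ) :
    permMap π (permMap π.symm t) = t := by
  have : bary (permMap π (permMap π.symm t)) = bary t := by
    rw [bary_permMap, bary_permMap]
    ext j
    simp
  exact congrArg Fin.tail this

theorem permMap_mem_iff (π : Equiv.Perm (Fin (d + 1))) (t : Fin d → ℝ) :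
    permMap π t ∈ unitSimplex d ↔ t ∈ unitSimplex d := by
  rw [mem_unitSimplex_iff, mem_unitSimplex_iff, bary_permMap]
  exact ⟨fun h j => by simpa using h (π.symm j), fun h j => h _⟩

theorem polyFun_bary (j : Fin (d + 1)) : PolyFun 1 fun t : Fin d → ℝ => bary t j := by
  refine Fin.cases ?_ (fun i => ?_) j
  · exact (polyFun_const 1).sub (PolyFun.sum fun i _ => polyFun_coord i le_rfl)
  · exact polyFun_coord i le_rfl

theorem continuous_bary : Continuous (bary : (Fin d → ℝ) → Fin (d + 1) → ℝ) :=
  continuous_pi fun j => (polyFun_bary j).continuous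

/-- The linear part of `permMap`. -/
def permLin (π : Equiv.Perm (Fin (d + 1))) : (Fin d → ℝ) →ₗ[ℝ] Fin d → ℝ where
  toFun u := fun i => bary0 u (π i.succ)
  map_add' u v := by
    ext i
    simp [bary0_add]
  map_smul' c u := by
    ext i
    simp [bary0_smul]

theorem permMap_eq (π : Equiv.Perm (Fin (d + 1))) (t : Fin d → ℝ) :
    permMap π t = permMap π 0 + permLin π t := by
  ext i
  change bary t (π i.succ) = bary 0 (π i.succ) + bary0 t (π i.succ)
  have := bary_add 0 t
  rw [zero_add] at this
  rw [this, Pi.add_apply]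

/-- An affine bijection preserving a set of finite positive volume has Haar factor `1`. -/
theorem integral_permMap (π : Equiv.Perm (Fin (d + 1))) (f : (Fin d → ℝ) → ℝ) :
    ∫ t in unitSimplex d, f (permMap π t) = ∫ t in unitSimplex d, f t := by
  have hsurj : Function.Surjective (permLin π) := by
    intro u
    refine ⟨permMap π.symm (permMap π 0 + u) , ?_⟩
    have := permMap_permMap_symm π (permMap π 0 + u)
    rw [permMap_eq] at this
    exact add_left_cancel this
  have hinj : Function.Injective (permLin π) :=
    LinearMap.injective_iff_surjective.2 hsurj
  let L := (LinearEquiv.ofBijective (permLin π) ⟨hinj, hsurj⟩).toContinuousLinearEquiv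
  obtain ⟨c, hc, hint, hvol⟩ := exists_integral_affine volume volume L (permMap π 0)
  have hL : ∀ t, permMap π 0 + L t = permMap π t := fun t => (permMap_eq π t).symm
  have hpre : (fun v => permMap π 0 + L v) ⁻¹' unitSimplex d = unitSimplex d := by
    ext t
    simp only [hL, Set.mem_preimage, permMap_mem_iff]
  have h1 := hvol (unitSimplex d)
  rw [hpre] at h1
  have hc1 : c = 1 := by
    have h2 : 1 * volume (unitSimplex d) = ENNReal.ofReal c * volume (unitSimplex d) := by
      rw [one_mul]; exact h1
    have h3 := (ENNReal.mul_left_inj volume_unitSimplex_pos.ne' volume_unitSimplex_lt_top.ne).1 h2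
    have h4 := ENNReal.ofReal_eq_one.1 h3.symm
    exact h4
  rw [hint f _ measurableSet_unitSimplex, hpre, hc1, one_mul]
  simp only [hL]

end UnitSimplex

/-! ### The divergence theorem on the unit simplex -/

section Divergence

variable {d : ℕ}

/-- The parametrization of the face `{bary · j = 0}` of the unit simplex by the unit simplex. -/
def faceEmb (j : Fin (d + 2)) (s : Fin d → ℝ) : Fin (d + 1) → ℝ :=
  Fin.tail (j.insertNth 0 (bary s) : Fin (d + 2) → ℝ)

theorem bary_faceEmb (j : Fin (d + 2)) (s : Fin d → ℝ) :
    bary (faceEmb j s) = (j.insertNth 0 (bary s) : Fin (d + 2) → ℝ) := by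
  refine bary_tail ?_
  rw [Fin.sum_univ_succAbove _ j]
  simp

theorem continuous_faceEmb (j : Fin (d + 2)) : Continuous (faceEmb j : (Fin d → ℝ) → _) := by
  refine continuous_pi fun i => ?_
  have : Continuous fun s : Fin d → ℝ => (j.insertNth 0 (bary s) : Fin (d + 2) → ℝ) :=
    Continuous.finInsertNth j continuous_const continuous_bary
  exact (continuous_apply i.succ).comp this

theorem insertNth_mem_unitSimplex (i : Fin (d + 1)) (y : ℝ) (s : Fin d → ℝ) :
    (i.insertNth y s : Fin (d + 1) → ℝ) ∈ unitSimplex (d + 1) ↔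
      s ∈ unitSimplex d ∧ y ∈ Icc 0 (1 - ∑ l, s l) := by
  have h1 : ∑ l, (i.insertNth y s : Fin (d + 1) → ℝ) l = y + ∑ l, s l := by
    rw [Fin.sum_univ_succAbove _ i]
    simp
  have h2 : (∀ l, 0 ≤ (i.insertNth y s : Fin (d + 1) → ℝ) l) ↔ 0 ≤ y ∧ ∀ l, 0 ≤ s l := by
    rw [Fin.forall_iff_succAbove i]
    simp
  change (_ ∧ _) ↔ (_ ∧ _) ∧ _ ∧ _
  rw [h1, h2]
  constructor
  · rintro ⟨⟨h3, h4⟩, h5⟩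
    exact ⟨⟨h4, by linarith⟩, h3, by linarith⟩
  · rintro ⟨⟨h3, h4⟩, h5, h6⟩
    exact ⟨⟨h5, h3⟩, by linarith⟩

theorem setIntegral_unitSimplex_succ (i : Fin (d + 1)) {g : (Fin (d + 1) → ℝ) → ℝ}
    (hg : Continuous g) :
    ∫ t in unitSimplex (d + 1), g t = ∫ s in unitSimplex d,
      ∫ y in (0 : ℝ)..(1 - ∑ l, s l), g (i.insertNth y s) := by
  have hmp := (volume_preserving_piFinSuccAbove (fun _ : Fin (d + 1) => ℝ) i).symm
  have hint : Integrable ((unitSimplex (d + 1)).indicator g) :=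
    (integrable_indicator_iff measurableSet_unitSimplex).2 (integrableOn_unitSimplex hg)
  have hint' := (hmp.integrable_comp_emb (MeasurableEquiv.measurableEmbedding _)).2 hint
  rw [← integral_indicator measurableSet_unitSimplex, ← hmp.integral_comp
    (MeasurableEquiv.measurableEmbedding _)]
  rw [Measure.volume_eq_prod] at hint' ⊢
  rw [integral_prod_symm _ (by exact hint'), ← integral_indicator measurableSet_unitSimplex]
  refine integral_congr_ae (ae_of_all _ fun s => ?_)
  have hval : ∀ y : ℝ, (MeasurableEquiv.piFinSuccAbove (fun _ : Fin (d + 1) => ℝ) i).symm (y, s) =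
      (i.insertNth y s : Fin (d + 1) → ℝ) := fun _ => rfl
  by_cases hs : s ∈ unitSimplex d
  · rw [Set.indicator_of_mem hs, intervalIntegral.integral_of_le (by linarith [hs.2]),
      ← integral_Icc_eq_integral_Ioc, ← integral_indicator measurableSet_Icc]
    refine integral_congr_ae (ae_of_all _ fun y => ?_)
    beta_reduce
    rw [hval]
    by_cases hy : y ∈ Icc 0 (1 - ∑ l, s l)
    · rw [Set.indicator_of_mem hy, Set.indicator_of_mem]
      exact (insertNth_mem_unitSimplex i y s).2 ⟨hs, hy⟩
    · rw [Set.indicator_of_notMem hy, Set.indicator_of_notMem]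
      exact fun h => hy ((insertNth_mem_unitSimplex i y s).1 h).2
  · rw [Set.indicator_of_notMem hs]
    refine (integral_congr_ae (ae_of_all _ fun y => ?_)).trans (integral_zero _ _)
    rw [hval, Set.indicator_of_notMem]
    exact fun h => hs ((insertNth_mem_unitSimplex i y s).1 h).1

/-- Both sides parametrize the slanted face opposite the vertex `0`, and the parametrizations differ
by a cyclic permutation of its vertices. -/
theorem integral_faceEmb_zero (i : Fin (d + 1)) (f : (Fin (d + 1) → ℝ) → ℝ) :
    ∫ s in unitSimplex d, f (i.insertNth (1 - ∑ l, s l) s) =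
      ∫ s in unitSimplex d, f (faceEmb 0 s) := by
  have h : ∀ s : Fin d → ℝ, (i.insertNth (1 - ∑ l, s l) s : Fin (d + 1) → ℝ) =
      faceEmb 0 (permMap i.cycleRange s) := by
    intro s
    have h0 : ∀ s : Fin d → ℝ, faceEmb 0 s = bary s := by
      intro s
      simp [faceEmb]
    rw [h0, bary_permMap, ← Fin.cons_comp_cycleRange]
    rfl
  simp only [h]
  exact integral_permMap i.cycleRange fun s => f (faceEmb 0 s)

/-- Fubini along the `i`-th axis and the fundamental theorem of calculus: a line in this direction
enters the simplex through the face `t i = 0` and leaves it through the face opposite the vertex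
`0`. No area factor occurs, since both faces are integrated in affine parametrization. -/
theorem integral_partial_unitSimplex (i : Fin (d + 1)) {f : (Fin (d + 1) → ℝ) → ℝ}
    (hf : ContDiff ℝ 1 f) :
    ∫ t in unitSimplex (d + 1), fderiv ℝ f t (Pi.single i 1) =
      (∫ s in unitSimplex d, f (faceEmb 0 s)) - ∫ s in unitSimplex d, f (faceEmb i.succ s) := by
  have hcont : Continuous fun t => fderiv ℝ f t (Pi.single i 1) :=
    (hf.continuous_fderiv (by norm_num)).clm_apply continuous_const
  rw [setIntegral_unitSimplex_succ i hcont]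
  have hder : ∀ (s : Fin d → ℝ) (y : ℝ), HasDerivAt (fun y => f (i.insertNth y s))
      (fderiv ℝ f (i.insertNth y s) (Pi.single i 1)) y := by
    intro s y
    have h1 : HasDerivAt (fun y : ℝ => (i.insertNth y s : Fin (d + 1) → ℝ)) (Pi.single i 1) y := by
      rw [hasDerivAt_pi]
      intro l
      refine Fin.succAboveCases i ?_ (fun l => ?_) l
      · simpa using hasDerivAt_id' y
      · simpa using hasDerivAt_const y (s l)
    exact ((hf.differentiable (by norm_num)).differentiableAt.hasFDerivAt.comp_hasDerivAt y h1)
  have hftc : ∀ s : Fin d → ℝ, ∫ y in (0 : ℝ)..(1 - ∑ l, s l),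
      fderiv ℝ f (i.insertNth y s) (Pi.single i 1) =
      f (i.insertNth (1 - ∑ l, s l) s) - f (faceEmb i.succ s) := by
    intro s
    rw [intervalIntegral.integral_eq_sub_of_hasDerivAt (fun y _ => hder s y)]
    · have : faceEmb i.succ s = i.insertNth 0 s := by
        ext l
        simp [faceEmb, bary, Fin.tail, Fin.insertNth_succ_cons]
      rw [this]
    · refine Continuous.intervalIntegrable ?_ _ _
      exact hcont.comp (Continuous.finInsertNth i continuous_id continuous_const)
  simp only [hftc]
  rw [integral_sub, integral_faceEmb_zero]
  · refine integrableOn_unitSimplex (hf.continuous.comp ?_)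
    exact Continuous.finInsertNth i (by fun_prop) continuous_id
  · exact integrableOn_unitSimplex (hf.continuous.comp (continuous_faceEmb _))

/-- The rates of change of the barycentric coordinates along `u` play the role of inward conormals,
whence the minus sign. -/
theorem integral_fderiv_unitSimplex {f : (Fin (d + 1) → ℝ) → ℝ} (hf : ContDiff ℝ 1 f)
    (u : Fin (d + 1) → ℝ) :
    ∫ t in unitSimplex (d + 1), fderiv ℝ f t u =
      -∑ j, bary0 u j * ∫ s in unitSimplex d, f (faceEmb j s) := by
  have h1 : ∀ t, fderiv ℝ f t u = ∑ i, u i * fderiv ℝ f t (Pi.single i 1) := by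
    intro t
    conv_lhs => rw [pi_eq_sum_univ' u]
    simp
  simp only [h1]
  rw [integral_finsetSum]
  · simp only [integral_const_mul, integral_partial_unitSimplex _ hf]
    rw [Fin.sum_univ_succ (f := fun j => bary0 u j * _)]
    simp only [bary0_zero, bary0_succ, mul_sub, Finset.sum_sub_distrib, ← Finset.sum_mul]
    ring
  · intro i _
    refine integrableOn_unitSimplex (continuous_const.mul ?_)
    exact (hf.continuous_fderiv (by norm_num)).clm_apply continuous_const

end Divergence

/-! ### Divisibility and derivatives of polynomials -/

section Polynomials

open MvPolynomial

variable {d : ℕ}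

/-- The remainder modulo `X i` does not involve the `i`-th variable, so it is determined by its
values on `t i = 0`, where it equals `P`. -/
theorem X_dvd_of_eval {i : Fin d} {P : MvPolynomial (Fin d) ℝ}
    (h : ∀ t : Fin d → ℝ, t i = 0 → eval t P = 0) : X i ∣ P := by
  rw [X_dvd_iff_modMonomial_eq_zero]
  refine MvPolynomial.funext fun t => ?_
  have hmod : ∀ t : Fin d → ℝ, eval t (P.modMonomial (Finsupp.single i 1)) =
      eval (Function.update t i 0) (P.modMonomial (Finsupp.single i 1)) := by
    intro t
    rw [eval_eq', eval_eq']
    refine Finset.sum_congr rfl fun e he => ?_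
    have hei : e i = 0 := by
      by_contra hne
      refine (mem_support_iff.1 he) (coeff_modMonomial_of_le _ ?_)
      rw [Finsupp.single_le_iff]
      omega
    congr 1
    refine Finset.prod_congr rfl fun l _ => ?_
    by_cases hl : l = i
    · subst hl; simp [hei]
    · simp [Function.update_of_ne hl]
  have h2 := congrArg (eval (Function.update t i 0)) (divMonomial_add_modMonomial P (Finsupp.single i 1))
  rw [map_add, map_mul, h _ (by simp)] at h2
  have h3 : eval (Function.update t i 0) (monomial (Finsupp.single i 1) (1 : ℝ)) = 0 := by
    rw [← X]; simp
  rw [h3, zero_mul, zero_add] at h2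
  rw [hmod, h2, map_zero]

theorem totalDegree_prod_X (I : Finset (Fin d)) :
    (∏ i ∈ I, (X i : MvPolynomial (Fin d) ℝ)).totalDegree = I.card := by
  induction I using Finset.induction_on with
  | empty => simp
  | insert i I hi ih =>
    rw [Finset.prod_insert hi, totalDegree_mul_of_isDomain (X_ne_zero i)
      (Finset.prod_ne_zero_iff.2 fun _ _ => X_ne_zero _), ih, totalDegree_X,
      Finset.card_insert_of_notMem hi, add_comm]

theorem prod_X_dvd {I : Finset (Fin d)} {P : MvPolynomial (Fin d) ℝ} (h : ∀ i ∈ I, X i ∣ P) :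
    (∏ i ∈ I, (X i : MvPolynomial (Fin d) ℝ)) ∣ P := by
  induction I using Finset.induction_on with
  | empty => simp
  | insert i I hi ih =>
    obtain ⟨Q, rfl⟩ := ih fun j hj => h j (by simp [hj])
    have h1 := h i (by simp)
    rw [Finset.prod_insert hi, mul_comm (X i)]
    refine mul_dvd_mul_left _ ?_
    refine (X_prime.dvd_mul.1 h1).resolve_left fun h2 => ?_
    obtain ⟨j, hj, hij⟩ := (X_prime.dvd_finsetProd_iff _).1 h2
    rw [X_dvd_X] at hij
    exact hi (hij ▸ hj)

theorem hasFDerivAt_eval (P : MvPolynomial (Fin d) ℝ) (t : Fin d → ℝ) :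
    HasFDerivAt (fun t => eval t P)
      (∑ i, eval t (pderiv i P) • (ContinuousLinearMap.proj i : (Fin d → ℝ) →L[ℝ] ℝ)) t := by
  induction P using MvPolynomial.induction_on with
  | C a => simpa using hasFDerivAt_const a t
  | add P Q hP hQ =>
    have := hP.add hQ
    simp only [map_add, add_smul, Finset.sum_add_distrib]
    exact this
  | mul_X P j hP =>
    have h1 : HasFDerivAt (fun t : Fin d → ℝ => t j)
      (ContinuousLinearMap.proj j : (Fin d → ℝ) →L[ℝ] ℝ) t := hasFDerivAt_apply j t
    have := hP.mul h1
    simp only [map_mul, eval_X]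
    refine this.congr_fderiv ?_
    ext u
    simp only [add_apply, smul_apply,
      sum_apply, ContinuousLinearMap.proj_apply, smul_eq_mul,
      Derivation.leibniz, map_add, map_mul, eval_X, pderiv_X, add_mul, Finset.sum_add_distrib,
      Finset.mul_sum, mul_assoc]
    congr 1
    rw [Finset.sum_eq_single j] <;> simp +contextual [eq_comm]

theorem fderiv_eval_single (P : MvPolynomial (Fin d) ℝ) (t : Fin d → ℝ) (i : Fin d) :
    fderiv ℝ (fun t => eval t P) t (Pi.single i 1) = eval t (pderiv i P) := by
  rw [(hasFDerivAt_eval P t).fderiv]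
  simp [Pi.single_apply]

theorem totalDegree_pderiv (i : Fin d) (P : MvPolynomial (Fin d) ℝ) :
    (pderiv i P).totalDegree ≤ P.totalDegree - 1 := by
  rw [totalDegree, Finset.sup_le_iff]
  intro m hm
  have hne := mem_support_iff.1 hm
  rw [coeff_pderiv] at hne
  have h2 : m + Finsupp.single i 1 ∈ P.support := by
    rw [mem_support_iff]
    intro h
    simp [h] at hne
  have := le_totalDegree h2
  rw [Finsupp.sum_add_index' (by simp) (by simp)] at this
  simp at this
  omega

theorem coeff_sum_X_mul_pderiv (P : MvPolynomial (Fin d) ℝ) (m : Fin d →₀ ℕ) :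
    (∑ i, X i * pderiv i P).coeff m = (m.degree : ℝ) * P.coeff m := by
  induction P using MvPolynomial.induction_on' with
  | monomial e a =>
    simp only [X_mul_pderiv_monomial, coeff_sum, coeff_smul, coeff_monomial]
    split_ifs with h
    · subst h
      simp [Finsupp.degree_eq_sum, Finset.sum_mul]
    · simp
  | add P Q hP hQ => simp only [map_add, mul_add, Finset.sum_add_distrib, coeff_add, hP, hQ]

/-- The Euler operator plus `k` multiplies each coefficient of degree `e` by `e + k`. This is
nonzero for `e ≥ r ≥ 1`, where `S` has no coefficients. -/
theorem totalDegree_le_of_euler {P S : MvPolynomial (Fin d) ℝ} {r : ℕ} (hr : 1 ≤ r) (k : ℕ)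
    (hS : S.totalDegree ≤ r - 1) (h : ∑ i, X i * pderiv i P + (k : ℝ) • P = S) :
    P.totalDegree ≤ r - 1 := by
  rw [totalDegree, Finset.sup_le_iff]
  intro m hm
  by_contra hlt
  have hdeg : r ≤ m.degree := by
    rw [Finsupp.degree_eq_sum, ← Finsupp.sum_fintype m (fun _ e => e) (fun _ => rfl)]
    omega
  have h1 := congrArg (coeff m) h
  rw [coeff_add, coeff_sum_X_mul_pderiv, coeff_smul, smul_eq_mul, ← add_mul] at h1
  have h2 : S.coeff m = 0 := by
    refine coeff_eq_zero_of_totalDegree_lt (lt_of_le_of_lt hS ?_)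
    change r - 1 < m.sum fun _ e => e
    omega
  rw [h2] at h1
  have h3 : ((m.degree : ℝ) + k) ≠ 0 := by
    have : (1 : ℝ) ≤ m.degree := by exact_mod_cast hr.trans hdeg
    positivity
  exact (mem_support_iff.1 hm) ((mul_eq_zero.1 h1).resolve_left h3)

/-- Write `P = (∏ X i) Q` and test with `g = Q`, which satisfies exactly the allowed degree bound:
the integrand `(∏ t i) Q²` is nonnegative on the simplex, so `Q` vanishes. -/
theorem eq_zero_of_moments {I : Finset (Fin d)} {P : MvPolynomial (Fin d) ℝ} {s : ℕ}
    (hP : P.totalDegree ≤ s) (hdvd : ∀ i ∈ I, X i ∣ P)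
    (hM : ∀ g : MvPolynomial (Fin d) ℝ, g.totalDegree + I.card ≤ s →
      ∫ t in unitSimplex d, eval t P * eval t g = 0) : P = 0 := by
  obtain ⟨Q, rfl⟩ := prod_X_dvd hdvd
  by_cases hQ : Q = 0
  · rw [hQ, mul_zero]
  exfalso
  have hne : (∏ i ∈ I, (X i : MvPolynomial (Fin d) ℝ)) ≠ 0 :=
    Finset.prod_ne_zero_iff.2 fun _ _ => X_ne_zero _
  rw [totalDegree_mul_of_isDomain hne hQ, totalDegree_prod_X] at hP
  have h0 := hM Q (by omega)
  have hc : Continuous fun t : Fin d → ℝ =>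
      eval t ((∏ i ∈ I, (X i : MvPolynomial (Fin d) ℝ)) * Q) * eval t Q :=
    (continuous_eval _).mul (continuous_eval _)
  have hz := eq_zero_of_integral_unitSimplex hc (fun t ht => by
    rw [map_mul, mul_assoc]
    refine mul_nonneg ?_ (mul_self_nonneg _)
    rw [map_prod]
    exact Finset.prod_nonneg fun i _ => by simpa using ht.1 i) h0
  refine hQ (PolyFun.eq_zero_of_isOpen isOpen_unitSimplexInt unitSimplexInt_nonempty fun t ht => ?_)
  have h1 := hz t (unitSimplexInt_subset ht)
  rw [map_mul, mul_assoc] at h1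
  have h2 : eval t (∏ i ∈ I, (X i : MvPolynomial (Fin d) ℝ)) ≠ 0 := by
    rw [map_prod]
    exact Finset.prod_ne_zero_iff.2 fun i _ => by simpa using (ht.1 i).ne'
  exact mul_self_eq_zero.1 ((mul_eq_zero.1 h1).resolve_left h2)

end Polynomials

/-! ### Covectors and traces -/

theorem alternating_map_sub_smul {V : Type*} [AddCommGroup V] [Module ℝ V] {k : ℕ}
    (F : V [⋀^Fin k]→ₗ[ℝ] ℝ) (v : Fin k → V) (c : Fin k → ℝ) (l₀ : Fin k) :
    F (fun i => if i = l₀ then v i else v i - c i • v l₀) = F v := by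
  have key : ∀ S : Finset (Fin k), l₀ ∉ S →
      F (fun i => if i ∈ S then v i - c i • v l₀ else v i) = F v := by
    intro S
    induction S using Finset.induction_on with
    | empty => simp
    | insert i S hi ih =>
      intro hl
      simp only [Finset.mem_insert, not_or] at hl
      rw [← ih hl.2]
      set w : Fin k → V := fun i => if i ∈ S then v i - c i • v l₀ else v i with hw
      have h1 : (fun j => if j ∈ insert i S then v j - c j • v l₀ else v j) =
          Function.update w i (w i - c i • v l₀) := by
        ext1 j
        by_cases hj : j = i
        · subst hj
          simp [hw, hi]
        · simp [hj, hw]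
      have h2 : F (Function.update w i (v l₀)) = 0 := by
        refine F.map_eq_zero_of_eq _ (i := i) (j := l₀) ?_ (Ne.symm hl.1)
        simp [Function.update_of_ne hl.1, hw, hl.2]
      rw [h1, F.map_update_sub, F.map_update_smul, h2, Function.update_eq_self]
      simp
  have := key (Finset.univ.erase l₀) (by simp)
  rw [← this]
  congr 1
  ext1 i
  by_cases h : i = l₀ <;> simp [h]

/-- The sum is `(ξ ∧ w)(v)`. If `ξ (v l₀) ≠ 0`, subtracting multiples of `v l₀` moves all the other
vectors into the kernel of `ξ` without changing the value; only the term `l₀` survives, and there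
`w` is evaluated on the kernel. -/
theorem covector_wedge_eq_zero {V : Type*} [AddCommGroup V] [Module ℝ V] {k : ℕ}
    (ξ : V →ₗ[ℝ] ℝ) (w : V [⋀^Fin k]→ₗ[ℝ] ℝ)
    (h : ∀ v : Fin k → V, (∀ i, ξ (v i) = 0) → w v = 0) (v : Fin (k + 1) → V) :
    ∑ l : Fin (k + 1), (-1 : ℝ) ^ (l : ℕ) * (ξ (v l) * w (l.removeNth v)) = 0 := by
  let F := AlternatingMap.alternatizeUncurryFin (ξ.smulRight w)
  have hF : ∀ v, F v = ∑ l : Fin (k + 1), (-1 : ℝ) ^ (l : ℕ) * (ξ (v l) * w (l.removeNth v)) := by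
    intro v
    simp only [F, AlternatingMap.alternatizeUncurryFin_apply, LinearMap.smulRight_apply,
      AlternatingMap.smul_apply, smul_eq_mul, zsmul_eq_mul]
    push_cast
    rfl
  rw [← hF]
  by_cases hv : ∀ l, ξ (v l) = 0
  · rw [hF]
    simp [hv]
  · push Not at hv
    obtain ⟨l₀, hl₀⟩ := hv
    rw [← alternating_map_sub_smul F v (fun i => ξ (v i) / ξ (v l₀)) l₀, hF]
    have hz : ∀ i, i ≠ l₀ → ξ (v i - (ξ (v i) / ξ (v l₀)) • v l₀) = 0 := by
      intro i _
      rw [map_sub, map_smul, smul_eq_mul, div_mul_cancel₀ _ hl₀, sub_self]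
    refine Finset.sum_eq_zero fun l _ => ?_
    by_cases hl : l = l₀
    · subst hl
      rw [h _ fun i => ?_]
      · simp
      · simp only [Fin.removeNth_apply, Fin.succAbove_ne, if_false]
        exact hz _ (Fin.succAbove_ne _ _)
    · simp only [hl, if_false, hz l hl]
      simp

/-! ### Trimmed forms on the unit simplex with vanishing traces and moments -/

section Trimmed

open MvPolynomial

variable {d k r : ℕ}

/-- The basis tuple `(e_{J 0}, …, e_{J (k - 1)})` of `ℝᵈ`. -/
def stdTuple (J : Fin k → Fin d) : Fin k → Fin d → ℝ := fun i => Pi.single (J i) 1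

theorem alternating_expand_pi (f : (Fin d → ℝ) [⋀^Fin k]→ₗ[ℝ] ℝ) (v : Fin k → Fin d → ℝ) :
    f v = ∑ σ : Fin k ↪o Fin d, f (stdTuple σ) * minor σ v := by
  have := alternating_expand (Pi.basisFun ℝ (Fin d)) f v
  simp only [Pi.basisFun_apply] at this
  exact this

/-- The polynomial `∑_σ (dx^σ)(v) P_σ`, the value at `v` of the form with coefficients `P_σ`. -/
def polyVal (P : (Fin k ↪o Fin d) → MvPolynomial (Fin d) ℝ) (v : Fin k → Fin d → ℝ) :
    MvPolynomial (Fin d) ℝ := ∑ σ : Fin k ↪o Fin d, C (minor σ v) * P σ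

theorem polyVal_stdTuple (P : (Fin k ↪o Fin d) → MvPolynomial (Fin d) ℝ) (σ : Fin k ↪o Fin d) :
    polyVal P (stdTuple σ) = P σ := by
  have : ∀ τ : Fin k ↪o Fin d, minor τ (stdTuple σ) = if τ = σ then 1 else 0 :=
    fun τ => minor_single τ σ
  simp [polyVal, this]

/-- The differential at `t` of the form with coefficients `P_σ`. -/
def polyDiff (P : (Fin k ↪o Fin d) → MvPolynomial (Fin d) ℝ) (t : Fin d → ℝ) :
    (Fin d → ℝ) →ₗ[ℝ] (Fin d → ℝ) [⋀^Fin k]→ₗ[ℝ] ℝ :=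
  ∑ i, ∑ σ : Fin k ↪o Fin d, (LinearMap.proj i : (Fin d → ℝ) →ₗ[ℝ] ℝ).smulRight
    (eval t (pderiv i (P σ)) • minor (σ : Fin k → Fin d))

theorem polyDiff_apply (P : (Fin k ↪o Fin d) → MvPolynomial (Fin d) ℝ) (t u : Fin d → ℝ)
    (v : Fin k → Fin d → ℝ) :
    polyDiff P t u v = ∑ i, u i * eval t (pderiv i (polyVal P v)) := by
  simp only [polyDiff, LinearMap.sum_apply, LinearMap.smulRight_apply, LinearMap.proj_apply,
    alternatingMap_sum_apply, AlternatingMap.smul_apply, smul_eq_mul, polyVal, map_sum,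
    Finset.mul_sum, pderiv_C_mul, map_mul, eval_C]
  refine Finset.sum_congr rfl fun i _ => Finset.sum_congr rfl fun σ _ => by ring

/-- The coefficient of `dx^ρ` in the exterior derivative of the form with coefficients `P_σ`. -/
def polyExtDeriv (P : (Fin k ↪o Fin d) → MvPolynomial (Fin d) ℝ) (ρ : Fin (k + 1) ↪o Fin d) :
    MvPolynomial (Fin d) ℝ :=
  ∑ l : Fin (k + 1), C ((-1 : ℝ) ^ (l : ℕ)) * pderiv (ρ l) (P ((Fin.succAboveOrderEmb l).trans ρ))

theorem eval_polyExtDeriv (P : (Fin k ↪o Fin d) → MvPolynomial (Fin d) ℝ)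
    (ρ : Fin (k + 1) ↪o Fin d) (t : Fin d → ℝ) :
    AlternatingMap.alternatizeUncurryFin (polyDiff P t) (stdTuple ρ) =
      eval t (polyExtDeriv P ρ) := by
  simp only [AlternatingMap.alternatizeUncurryFin_apply, polyExtDeriv, map_sum, map_mul, eval_C]
  refine Finset.sum_congr rfl fun l _ => ?_
  rw [zsmul_eq_mul]
  push_cast
  congr 1
  have h1 : (l.removeNth (stdTuple ρ) : Fin k → Fin d → ℝ) =
      stdTuple ((Fin.succAboveOrderEmb l).trans ρ) := rfl
  rw [polyDiff_apply, h1, polyVal_stdTuple]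
  simp [stdTuple, Pi.single_apply]

/-- The coefficient has degree at most `r-1` and is divisible by the `d-k-1` coordinates outside
`ρ`, so its moments up to degree `r+k-d` have to be shown to vanish. Integration by parts moves the
derivative to `g`, which lowers the degree by one, into the range of the hypothesis `hM`; the
boundary term vanishes with the traces. -/
theorem polyExtDeriv_eq_zero_of_moments (hr : 1 ≤ r)
    {P : (Fin k ↪o Fin d) → MvPolynomial (Fin d) ℝ} (hP : ∀ σ, (P σ).totalDegree ≤ r)
    (hF : ∀ (j : Fin (d + 1)) (t : Fin d → ℝ), bary t j = 0 → ∀ v : Fin k → Fin d → ℝ,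
      (∀ i, bary0 (v i) j = 0) → eval t (polyVal P v) = 0)
    (hM : ∀ (σ : Fin k ↪o Fin d) (g : MvPolynomial (Fin d) ℝ), g.totalDegree + d + 1 ≤ r + k →
      ∫ t in unitSimplex d, eval t (P σ) * eval t g = 0) (ρ : Fin (k + 1) ↪o Fin d) :
    polyExtDeriv P ρ = 0 := by
  have hkd : k + 1 ≤ d := by simpa using Fintype.card_le_of_embedding ρ.toEmbedding
  obtain ⟨d, rfl⟩ : ∃ d', d = d' + 1 := ⟨d - 1, by omega⟩
  set I : Finset (Fin (d + 1)) := (Finset.univ.map ρ.toEmbedding)ᶜ with hI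
  have hcard : I.card = d + 1 - (k + 1) := by
    rw [hI, Finset.card_compl, Finset.card_map]; simp
  refine eq_zero_of_moments (I := I) (s := r - 1) ?_ ?_ ?_
  · refine (totalDegree_finsetSum _ _).trans (Finset.sup_le fun l _ => ?_)
    refine (totalDegree_mul _ _).trans ?_
    rw [totalDegree_C, zero_add]
    exact (totalDegree_pderiv _ _).trans (Nat.sub_le_sub_right (hP _) 1)
  · intro i hi
    have hne : ∀ l, ρ l ≠ i := by
      intro l h
      simp [hI] at hi
      exact hi l h
    refine Finset.dvd_sum fun l _ => Dvd.dvd.mul_left ?_ _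
    -- On `t i = 0` the basis vectors indexed by `ρ` without `ρ l` are tangent to the face, so `hF`
    -- applies. A derivative in the direction `ρ l ≠ i` keeps the factor `X i`.
    have hdvd : X i ∣ P ((Fin.succAboveOrderEmb l).trans ρ) := by
      refine X_dvd_of_eval fun t ht => ?_
      rw [← polyVal_stdTuple P]
      refine hF i.succ t (by simpa using ht) _ fun m => ?_
      simp only [bary0_succ, stdTuple]
      exact Pi.single_eq_of_ne (Ne.symm (hne _)) _
    obtain ⟨Q, hQ⟩ := hdvd
    rw [hQ, Derivation.leibniz, pderiv_X_of_ne (Ne.symm (hne l)), smul_zero, add_zero]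
    exact ⟨_, rfl⟩
  · intro g hg
    rw [hcard] at hg
    set σ : Fin (k + 1) → (Fin k ↪o Fin (d + 1)) := fun l => (Fin.succAboveOrderEmb l).trans ρ
    have hint : ∀ Q : MvPolynomial (Fin (d + 1)) ℝ, IntegrableOn (fun t => eval t Q)
        (unitSimplex (d + 1)) := fun Q => integrableOn_unitSimplex (continuous_eval Q)
    have hsplit : ∀ t, eval t (polyExtDeriv P ρ) * eval t g =
        (∑ l : Fin (k + 1), (-1 : ℝ) ^ (l : ℕ) * eval t (pderiv (ρ l) (P (σ l) * g))) -
        ∑ l : Fin (k + 1), (-1 : ℝ) ^ (l : ℕ) * eval t (P (σ l) * pderiv (ρ l) g) := by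
      intro t
      rw [← Finset.sum_sub_distrib, polyExtDeriv, map_sum, Finset.sum_mul]
      refine Finset.sum_congr rfl fun l _ => ?_
      rw [Derivation.leibniz]
      simp only [map_mul, map_add, eval_C, smul_eq_mul]
      ring
    simp only [hsplit]
    have hI1 : ∀ (F : Fin (k + 1) → MvPolynomial (Fin (d + 1)) ℝ) (l : Fin (k + 1)),
        IntegrableOn (fun t => (-1 : ℝ) ^ (l : ℕ) * eval t (F l)) (unitSimplex (d + 1)) :=
      fun F l => (hint _).const_mul _
    have hA := hI1 fun l => pderiv (ρ l) (P (σ l) * g)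
    have hB := hI1 fun l => P (σ l) * pderiv (ρ l) g
    rw [integral_sub (integrable_finsetSum _ fun l _ => hA l)
      (integrable_finsetSum _ fun l _ => hB l), integral_finsetSum _ fun l _ => hA l,
      integral_finsetSum _ fun l _ => hB l]
    simp only [integral_const_mul]
    have hzero : ∀ l, ∫ t in unitSimplex (d + 1), eval t (P (σ l) * pderiv (ρ l) g) = 0 := by
      intro l
      simp only [map_mul]
      -- For constant `g` the truncated degree bound on the derivative gains nothing, but the
      -- derivative is zero.
      by_cases h0 : g.totalDegree = 0
      · rw [totalDegree_eq_zero_iff_eq_C.1 h0]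
        simp
      · refine hM _ _ ?_
        have := totalDegree_pderiv (ρ l) g
        omega
    simp only [hzero, mul_zero, Finset.sum_const_zero, sub_zero]
    have hdt : ∀ l, ∫ t in unitSimplex (d + 1), eval t (pderiv (ρ l) (P (σ l) * g)) =
        -∑ j, bary0 (stdTuple ρ l) j *
          ∫ s in unitSimplex d, eval (faceEmb j s) (P (σ l) * g) := by
      intro l
      have hcd : ContDiff ℝ 1 fun t => eval t (P (σ l) * g) :=
        ((polyFun_eval le_rfl).contDiff (f := fun t => eval t (P (σ l) * g))).of_le
          (by exact_mod_cast le_top)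
      rw [← integral_fderiv_unitSimplex hcd (stdTuple ρ l)]
      simp only [stdTuple, fderiv_eval_single]
    simp only [hdt, mul_neg, Finset.sum_neg_distrib, Finset.mul_sum]
    rw [Finset.sum_comm, neg_eq_zero]
    refine Finset.sum_eq_zero fun j _ => ?_
    have hI2 : ∀ l : Fin (k + 1), IntegrableOn
        (fun s => (-1 : ℝ) ^ (l : ℕ) * (bary0 (stdTuple ρ l) j * eval (faceEmb j s) (P (σ l) * g)))
        (unitSimplex d) := fun l => integrableOn_unitSimplex
      (continuous_const.mul (continuous_const.mul
        ((continuous_eval _).comp (continuous_faceEmb j))))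
    simp only [← integral_const_mul]
    rw [← integral_finsetSum _ fun l _ => hI2 l]
    refine (integral_congr_ae (ae_of_all _ fun s => ?_)).trans (integral_zero _ _)
    -- At each point of the face `j`, the boundary integrand is `g` times the wedge product of the
    -- conormal `ξ` with the form `w`, and `w` vanishes on the kernel of `ξ`.
    let ξ : (Fin (d + 1) → ℝ) →ₗ[ℝ] ℝ :=
      { toFun := fun u => bary0 u j
        map_add' := fun u v => by rw [bary0_add]; rfl
        map_smul' := fun c u => by rw [bary0_smul]; rfl }
    let w : (Fin (d + 1) → ℝ) [⋀^Fin k]→ₗ[ℝ] ℝ :=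
      ∑ τ, eval (faceEmb j s) (P τ) • minor (τ : Fin k → Fin (d + 1))
    have hw : ∀ v, w v = eval (faceEmb j s) (polyVal P v) := by
      intro v
      simp only [w, alternatingMap_sum_apply, AlternatingMap.smul_apply, smul_eq_mul, polyVal,
        map_sum, map_mul, eval_C]
      exact Finset.sum_congr rfl fun τ _ => mul_comm _ _
    have := covector_wedge_eq_zero ξ w (fun v hv => by
      rw [hw]
      refine hF j _ ?_ v hv
      rw [bary_faceEmb]
      simp) (stdTuple ρ)
    have h2 : ∀ l, w (l.removeNth (stdTuple ρ)) = eval (faceEmb j s) (P (σ l)) := by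
      intro l
      rw [hw, ← polyVal_stdTuple P (σ l)]
      rfl
    simp only [h2] at this
    rw [← zero_mul (eval (faceEmb j s) g), ← this, Finset.sum_mul]
    refine Finset.sum_congr rfl fun l _ => ?_
    rw [map_mul]
    change _ = (-1 : ℝ) ^ (l : ℕ) * (bary0 (stdTuple ρ l) j * _) * _
    ring

end Trimmed

/-! ### Degree reduction by Cartan's formula and unisolvence in the interior of a simplex. -/

section TrimmedUnisolvence

open MvPolynomial

variable {d k r : ℕ}

theorem removeNth_succ_cons {α : Type*} (t : α) (v : Fin (k + 1) → α) (l : Fin (k + 1)) :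
    (l.succ.removeNth (Fin.cons t v : Fin (k + 2) → α) : Fin (k + 1) → α) =
      Fin.cons t (l.removeNth v) := by
  ext i
  refine Fin.cases ?_ (fun i => ?_) i <;> simp [Fin.removeNth_apply, Fin.succ_succAbove_succ]

theorem alternating_cons_expand (f : (Fin d → ℝ) [⋀^Fin (k + 1)]→ₗ[ℝ] ℝ) (t : Fin d → ℝ)
    (u : Fin k → Fin d → ℝ) :
    f (Fin.cons t u) = ∑ i, t i * f (Fin.cons (Pi.single i 1) u) := by
  have h := congrArg (fun y => f.curryLeft y u) (pi_eq_sum_univ' t)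
  simp only [map_sum, alternatingMap_sum_apply, map_smul, AlternatingMap.smul_apply] at h
  exact h

theorem alternating_cons_removeNth {V : Type*} [AddCommGroup V] [Module ℝ V]
    (f : V [⋀^Fin (k + 1)]→ₗ[ℝ] ℝ) (v : Fin (k + 1) → V) (l : Fin (k + 1)) :
    f (Fin.cons (v l) (l.removeNth v)) = (-1 : ℝ) ^ (l : ℕ) * f v := by
  rw [Fin.cons_removeNth_eq_comp_cycleRange_symm]
  change f (fun i => v (l.cycleRange.symm i)) = _
  have := f.map_perm v l.cycleRange.symm
  simp only [Function.comp_def] at this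
  rw [this, Equiv.Perm.sign_symm, Fin.sign_cycleRange]
  rw [Units.smul_def, zsmul_eq_mul]
  push_cast
  rfl

/-- Cartan's formula for the position field: with `dW = 0`, the Euler operator plus `k` sends `W` to
`dκW`. The hypothesis `hK` bounds the degree of `κW` by `r`, so the image has degree at most `r-1`,
and so has `W`. -/
theorem totalDegree_le_of_extDeriv_eq_zero (hr : 1 ≤ r)
    {P : (Fin k ↪o Fin d) → MvPolynomial (Fin d) ℝ}
    (hK : ∀ v : Fin k → Fin d → ℝ, ∀ l : Fin k, ∃ Q : MvPolynomial (Fin d) ℝ, Q.totalDegree ≤ r ∧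
      ∀ t, eval t Q = eval t (polyVal P (Function.update v l t)))
    (hD : ∀ ρ : Fin (k + 1) ↪o Fin d, polyExtDeriv P ρ = 0) (σ : Fin k ↪o Fin d) :
    (P σ).totalDegree ≤ r - 1 := by
  have hD0 : ∀ t, AlternatingMap.alternatizeUncurryFin (polyDiff P t) = 0 := by
    intro t
    refine alternating_ext (Pi.basisFun ℝ (Fin d)) fun ρ => ?_
    have := eval_polyExtDeriv P ρ t
    rw [hD, map_zero] at this
    simp only [Pi.basisFun_apply]
    exact this
  have heuler : ∀ t, eval t (∑ i, X i * pderiv i (P σ)) =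
      polyDiff P t t (stdTuple σ) := by
    intro t
    rw [polyDiff_apply, polyVal_stdTuple]
    simp
  set v : Fin k → Fin d → ℝ := stdTuple σ with hv
  rcases k with _ | k
  -- A function has no contraction, and `dW = 0` makes its Euler derivative vanish.
  · refine totalDegree_le_of_euler hr 0 (S := 0) (by simp) (MvPolynomial.funext fun t => ?_)
    have h1 := congrArg (fun F => F (Fin.cons t v)) (hD0 t)
    simp only [AlternatingMap.alternatizeUncurryFin_apply] at h1
    have h2 : polyDiff P t t v = 0 := by simpa using h1
    simp only [Nat.cast_zero, zero_smul, add_zero, map_zero]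
    rw [heuler, h2]
  · let w : (Fin d → ℝ) → (Fin d → ℝ) [⋀^Fin (k + 1)]→ₗ[ℝ] ℝ := fun t =>
      ∑ τ, eval t (P τ) • minor (τ : Fin (k + 1) → Fin d)
    have hw : ∀ t v, w t v = eval t (polyVal P v) := by
      intro t v
      simp only [w, alternatingMap_sum_apply, AlternatingMap.smul_apply, smul_eq_mul, polyVal,
        map_sum, map_mul, eval_C]
      exact Finset.sum_congr rfl fun τ _ => mul_comm _ _
    have hcons : ∀ (u : Fin k → Fin d → ℝ), ∃ Q : MvPolynomial (Fin d) ℝ, Q.totalDegree ≤ r ∧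
        ∀ t, eval t Q = w t (Fin.cons t u) := by
      intro u
      obtain ⟨Q, hQ, h⟩ := hK (Fin.cons 0 u) 0
      refine ⟨Q, hQ, fun t => ?_⟩
      rw [h, hw, Fin.update_cons_zero]
    choose Q hQdeg hQ using hcons
    have hQeq : ∀ u, Q u = ∑ i, X i * polyVal P (Fin.cons (Pi.single i 1) u) := by
      intro u
      refine MvPolynomial.funext fun t => ?_
      rw [hQ, map_sum]
      rw [alternating_cons_expand]
      simp only [map_mul, eval_X, ← hw]
    -- Product rule for `t ↦ W_t(t, u)`: one term differentiates the position vector in the first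
    -- slot, the other the coefficients. Antisymmetrizing, the first terms add up to `k + 1` copies
    -- of the coefficient.
    have hQder : ∀ (u : Fin k → Fin d → ℝ) (j : Fin d) (t : Fin d → ℝ),
        eval t (pderiv j (Q u)) =
          w t (Fin.cons (Pi.single j 1) u) + polyDiff P t (Pi.single j 1) (Fin.cons t u) := by
      intro u j t
      have h2 : ∀ i, polyDiff P t (Pi.single j 1) (Fin.cons (Pi.single i 1) u) =
          eval t (pderiv j (polyVal P (Fin.cons (Pi.single i 1) u))) := by
        intro i
        rw [polyDiff_apply]
        simp [Pi.single_apply]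
      rw [alternating_cons_expand (polyDiff P t (Pi.single j 1)), hw, hQeq]
      simp only [h2]
      simp only [map_sum, Derivation.leibniz, map_add, Finset.sum_add_distrib, smul_eq_mul, map_mul,
        eval_X]
      rw [add_comm]
      congr 1
      rw [Finset.sum_eq_single j] <;> simp +contextual [pderiv_X, eq_comm]
    refine totalDegree_le_of_euler hr (k + 1)
      (S := ∑ l : Fin (k + 1), C ((-1 : ℝ) ^ (l : ℕ)) * pderiv (σ l) (Q (l.removeNth v))) ?_
      (MvPolynomial.funext fun t => ?_)
    · refine (totalDegree_finsetSum _ _).trans (Finset.sup_le fun l _ => ?_)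
      refine (totalDegree_mul _ _).trans ?_
      rw [totalDegree_C, zero_add]
      exact (totalDegree_pderiv _ _).trans (Nat.sub_le_sub_right (hQdeg _) 1)
    · have h1 := congrArg (fun F => F (Fin.cons t v)) (hD0 t)
      simp only [AlternatingMap.alternatizeUncurryFin_apply] at h1
      rw [Fin.sum_univ_succ] at h1
      simp only [Fin.cons_zero, Fin.cons_succ, removeNth_succ_cons, Fin.val_zero, pow_zero,
        one_smul, Fin.val_succ, pow_succ, mul_neg, mul_one, neg_smul, Finset.sum_neg_distrib,
        zsmul_eq_mul, AlternatingMap.zero_apply] at h1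
      push_cast at h1
      have h0 : (Fin.removeNth 0 (Fin.cons t v : Fin (k + 2) → Fin d → ℝ)) = v := by
        ext i; simp [Fin.removeNth_apply]
      rw [h0] at h1
      rw [map_add, heuler, map_sum]
      have h3 : ∀ l : Fin (k + 1), eval t (C ((-1 : ℝ) ^ (l : ℕ)) *
          pderiv (σ l) (Q (l.removeNth v))) = eval t (P σ) +
          (-1 : ℝ) ^ (l : ℕ) * polyDiff P t (v l) (Fin.cons t (l.removeNth v)) := by
        intro l
        rw [map_mul, eval_C, hQder, mul_add]
        congr 1
        have := alternating_cons_removeNth (w t) v l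
        rw [hw t v, hv, polyVal_stdTuple, ← hv] at this
        change (-1 : ℝ) ^ (l : ℕ) * w t (Fin.cons (v l) (l.removeNth v)) = _
        rw [this, ← mul_assoc, ← pow_add, Even.neg_one_pow ⟨_, rfl⟩, one_mul]
      simp only [h3, Finset.sum_add_distrib]
      simp
      linarith

/-- Once `dW = 0` has brought the degree down to `r-1`, the coefficient of `dx^σ` is divisible by
the `d-k` coordinates outside `σ`. The moments still needed have degree at most `r-1-(d-k)`, which
is precisely what `hM` provides. -/
theorem trimmed_eq_zero_of_trace_of_moments (hr : 1 ≤ r)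
    (W A : (Fin d → ℝ) → (Fin d → ℝ) [⋀^Fin k]→ₗ[ℝ] ℝ)
    (B : (Fin d → ℝ) → (Fin d → ℝ) [⋀^Fin (k + 1)]→ₗ[ℝ] ℝ)
    (hA : ∀ v, PolyFun (r - 1) fun t => A t v) (hB : ∀ v, PolyFun (r - 1) fun t => B t v)
    (hW : ∀ t v, W t v = A t v + B t (Fin.cons t v))
    (hF : ∀ (j : Fin (d + 1)) (t : Fin d → ℝ), bary t j = 0 → ∀ v : Fin k → Fin d → ℝ,
      (∀ i, bary0 (v i) j = 0) → W t v = 0)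
    (hM : ∀ (σ : Fin k ↪o Fin d) (s : ℕ) (g : (Fin d → ℝ) → ℝ), s + d + 1 ≤ r + k →
      PolyFun s g → ∫ t in unitSimplex d, W t (stdTuple σ) * g t = 0) (t : Fin d → ℝ) :
    W t = 0 := by
  have hcons : ∀ t v, B t (Fin.cons t v) = ∑ i, t i * B t (Fin.cons (Pi.single i 1) v) := by
    exact fun t v => alternating_cons_expand _ _ _
  have hWpoly : ∀ v, PolyFun r fun t => W t v := by
    intro v
    simp only [hW, hcons]
    refine ((hA v).mono (by omega)).add (PolyFun.sum fun i _ => ?_)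
    exact ((polyFun_coord i le_rfl).mul (hB _)).mono (by omega)
  choose P hPdeg hP using fun σ : Fin k ↪o Fin d => hWpoly (stdTuple σ)
  have hval : ∀ t v, eval t (polyVal P v) = W t v := by
    intro t v
    rw [alternating_expand_pi (W t) v]
    simp only [polyVal, map_sum, map_mul, eval_C, hP]
    exact Finset.sum_congr rfl fun τ _ => mul_comm _ _
  have hF' : ∀ (j : Fin (d + 1)) (t : Fin d → ℝ), bary t j = 0 → ∀ v : Fin k → Fin d → ℝ,
      (∀ i, bary0 (v i) j = 0) → eval t (polyVal P v) = 0 := by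
    intro j t ht v hv
    rw [hval]
    exact hF j t ht v hv
  have hM' : ∀ (σ : Fin k ↪o Fin d) (g : MvPolynomial (Fin d) ℝ), g.totalDegree + d + 1 ≤ r + k →
      ∫ t in unitSimplex d, eval t (P σ) * eval t g = 0 := by
    intro σ g hg
    simp only [← hP]
    exact hM σ _ _ hg (polyFun_eval le_rfl)
  have hD := polyExtDeriv_eq_zero_of_moments hr hPdeg hF' hM'
  have hdeg := totalDegree_le_of_extDeriv_eq_zero hr (P := P) (fun v l => by
    have h1 : PolyFun r fun t => A t (Function.update v l t) := by
      have : (fun t => A t (Function.update v l t)) =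
          fun t => ∑ i, t i * A t (Function.update v l (Pi.single i 1)) := by
        ext t
        have h2 := congrArg ((A t).toMultilinearMap.toLinearMap v l) (pi_eq_sum_univ' t)
        simp only [map_sum, map_smul, smul_eq_mul] at h2
        exact h2
      rw [this]
      refine PolyFun.sum fun i _ => ?_
      exact ((polyFun_coord i le_rfl).mul (hA _)).mono (by omega)
    obtain ⟨Q, hQ, h⟩ := h1
    refine ⟨Q, hQ, fun t => ?_⟩
    rw [hval, ← h, hW]
    -- This is `κκ = 0`: the position vector occupies two slots, so only the part `A` of degree
    -- `r-1` contributes to `κW`.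
    have : B t (Fin.cons t (Function.update v l t)) = 0 :=
      (B t).map_eq_zero_of_eq _ (i := 0) (j := l.succ) (by simp) (Fin.succ_ne_zero l).symm
    rw [this, add_zero]) hD
  have hP0 : ∀ σ, P σ = 0 := by
    intro σ
    have hkd : k ≤ d := by simpa using Fintype.card_le_of_embedding σ.toEmbedding
    refine eq_zero_of_moments (I := (Finset.univ.map σ.toEmbedding)ᶜ) (hdeg σ) ?_ ?_
    · intro i hi
      refine X_dvd_of_eval fun t ht => ?_
      rw [← polyVal_stdTuple P]
      refine hF' i.succ t (by simpa using ht) _ fun m => ?_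
      simp only [bary0_succ, stdTuple]
      refine Pi.single_eq_of_ne (fun h => ?_) _
      simp at hi
      exact hi m h.symm
    · intro g hg
      rw [Finset.card_compl, Finset.card_map] at hg
      simp only [Finset.card_univ, Fintype.card_fin] at hg
      exact hM' σ g (by omega)
  ext v
  rw [← hval]
  simp [polyVal, hP0]

end TrimmedUnisolvence

/-! ### Faces of simplices -/

section Faces

variable {n k r d : ℕ}

/-- The combination `∑ⱼ cⱼ aⱼ` of the points `aⱼ`. -/
def pt {m : ℕ} (a : Fin m → E n) : (Fin m → ℝ) →ₗ[ℝ] E n := Fintype.linearCombination ℝ a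

theorem pt_apply {m : ℕ} (a : Fin m → E n) (c : Fin m → ℝ) : pt a c = ∑ j, c j • a j := rfl

theorem pt_single {m : ℕ} (a : Fin m → E n) (j : Fin m) : pt a (Pi.single j 1) = a j := by
  simp [pt_apply, Pi.single_apply]

theorem pt_comp_perm {m : ℕ} (a : Fin m → E n) (π : Equiv.Perm (Fin m)) (c : Fin m → ℝ) :
    pt (a ∘ π) (c ∘ π) = pt a c := by
  simp only [pt_apply, Function.comp_apply]
  exact Equiv.sum_comp π fun j => c j • a j

theorem pt_succAbove {m : ℕ} (a : Fin (m + 1) → E n) (j : Fin (m + 1)) {c : Fin (m + 1) → ℝ}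
    (hc : c j = 0) : pt a c = pt (a ∘ j.succAbove) (c ∘ j.succAbove) := by
  rw [pt_apply, Fin.sum_univ_succAbove _ j, hc, zero_smul, zero_add]
  rfl

theorem sum_succAbove {m : ℕ} (j : Fin (m + 1)) {c : Fin (m + 1) → ℝ}
    (hc : c j = 0) : ∑ i, (c ∘ j.succAbove) i = ∑ i, c i := by
  rw [Fin.sum_univ_succAbove _ j, hc, zero_add]
  rfl

/-- The linear part of the parametrization of the simplex with vertices `a`. -/
def edgeMap (a : Fin (d + 1) → E n) : (Fin d → ℝ) →ₗ[ℝ] E n where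
  toFun u := pt a (bary0 u)
  map_add' u v := by rw [bary0_add, map_add]
  map_smul' c u := by rw [bary0_smul, map_smul]; rfl

theorem edgeMap_apply (a : Fin (d + 1) → E n) (u : Fin d → ℝ) : edgeMap a u = pt a (bary0 u) := rfl

theorem edgeMap_single (a : Fin (d + 1) → E n) (i : Fin d) :
    edgeMap a (Pi.single i 1) = a i.succ - a 0 := by
  rw [edgeMap_apply, pt_apply, Fin.sum_univ_succ]
  simp [Pi.single_apply, sub_eq_neg_add]

theorem pt_bary (a : Fin (d + 1) → E n) (t : Fin d → ℝ) : pt a (bary t) = a 0 + edgeMap a t := by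
  rw [edgeMap_apply, pt_apply, pt_apply, Fin.sum_univ_succ, Fin.sum_univ_succ]
  simp only [bary_zero, bary_succ, bary0_zero, bary0_succ, sub_smul, one_smul, neg_smul]
  abel

theorem edgeMap_eq_sum (a : Fin (d + 1) → E n) (t : Fin d → ℝ) :
    edgeMap a t = ∑ i, t i • (a i.succ - a 0) := by
  have h := congrArg (edgeMap a) (pi_eq_sum_univ' t)
  simpa only [map_sum, map_smul, edgeMap_single] using h

theorem affineIndependent_pt_eq_zero {m : ℕ} {a : Fin m → E n} (ha : AffineIndependent ℝ a)
    {c : Fin m → ℝ} (hc : ∑ j, c j = 0) (h : pt a c = 0) : c = 0 := by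
  ext j
  exact affineIndependent_iff.1 ha Finset.univ c hc h j (Finset.mem_univ j)

theorem edgeMap_injective {a : Fin (d + 1) → E n} (ha : AffineIndependent ℝ a) :
    Function.Injective (edgeMap a) := by
  rw [injective_iff_map_eq_zero]
  intro u hu
  have := affineIndependent_pt_eq_zero ha (sum_bary0 u) hu
  ext i
  simpa using congrFun this i.succ

theorem continuous_pt_bary (a : Fin (d + 1) → E n) : Continuous fun t => pt a (bary t) :=
  (LinearMap.continuous_of_finiteDimensional (pt a)).comp continuous_bary

/-- The moments of degree `s` of the trace of `w` on the face with vertices `a` vanish. -/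
def ZeroMoments (s : ℕ) (a : Fin (d + 1) → E n) (w : E n → Form n k) : Prop :=
  ∀ e : Fin k → Fin (d + 1) → ℝ, (∀ i, ∑ j, e i j = 0) → ∀ g, PolyFun s g →
    ∫ t in unitSimplex d, w (pt a (bary t)) (fun i => pt a (e i)) * g t = 0

/-- The trace of `w` on the affine span of `a` vanishes. -/
def ZeroTrace {m : ℕ} (a : Fin m → E n) (w : E n → Form n k) : Prop :=
  ∀ c : Fin m → ℝ, ∑ j, c j = 1 → ∀ e : Fin k → Fin m → ℝ, (∀ i, ∑ j, e i j = 0) →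
    w (pt a c) (fun i => pt a (e i)) = 0

/-- All the degrees of freedom of `w` for `P_r⁻ Λᵏ` on faces with vertices in `K` vanish. -/
def FaceMoments (r : ℕ) (K : Set (E n)) (w : E n → Form n k) : Prop :=
  ∀ m s : ℕ, s + m + 1 = r → ∀ b : Fin (k + m + 1) → E n, Function.Injective b → (∀ i, b i ∈ K) →
    ZeroMoments s b w

theorem FaceMoments.mono {K L : Set (E n)} {w : E n → Form n k} (h : FaceMoments r L w)
    (hKL : K ⊆ L) : FaceMoments r K w :=
  fun m s hms b hb hbK => h m s hms b hb fun i => hKL (hbK i)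

/-- The trace of `w` on the face with vertices `a`, in coordinates. -/
def faceForm (a : Fin (d + 1) → E n) (w : E n → Form n k) (t : Fin d → ℝ) :
    (Fin d → ℝ) [⋀^Fin k]→ₗ[ℝ] ℝ := (w (pt a (bary t))).toAlternatingMap.compLinearMap (edgeMap a)

theorem faceForm_apply (a : Fin (d + 1) → E n) (w : E n → Form n k) (t : Fin d → ℝ)
    (v : Fin k → Fin d → ℝ) :
    faceForm a w t v = w (pt a (bary t)) fun i => edgeMap a (v i) := rfl

theorem IsPolyForm.polyFun_face {s : ℕ} {w : E n → Form n k} (hw : IsPolyForm s w)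
    (a : Fin (d + 1) → E n) (v : Fin k → E n) : PolyFun s fun t => w (pt a (bary t)) v := by
  simp only [pt_bary]
  exact (isPolyForm_iff.1 hw v).comp_affine _ _

/-- In face coordinates the trace is again trimmed: with `x = a 0 + edgeMap a t`, contraction with
the fixed vector `a 0` keeps the degree `r-1`, and contraction with `edgeMap a t` is the Koszul
part. -/
theorem zeroTrace_of_facets (hr : 1 ≤ r) {w : E n → Form n k} (hw : IsTrimmedForm r w)
    {a : Fin (d + 1) → E n} (ha : Function.Injective a) (hM : FaceMoments r (Set.range a) w)
    (hF : ∀ (j : Fin (d + 1)) (t : Fin d → ℝ), bary t j = 0 → ∀ v : Fin k → Fin d → ℝ,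
      (∀ i, bary0 (v i) j = 0) → faceForm a w t v = 0) : ZeroTrace a w := by
  obtain ⟨α, β, hα, hβ, hwαβ⟩ := hw
  have hα' := isPolyForm_iff.1 hα
  have hβ' := isPolyForm_iff.1 hβ
  have hmain : ∀ t, faceForm a w t = 0 := by
    refine trimmed_eq_zero_of_trace_of_moments hr (faceForm a w)
      (fun t => faceForm a α t +
        ((β (pt a (bary t))).toAlternatingMap.curryLeft (a 0)).compLinearMap (edgeMap a))
      (faceForm a β) (fun v => ?_) (fun v => ?_) (fun t v => ?_) hF (fun σ s g hs hg => ?_)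
    · exact (hα.polyFun_face a _).add (hβ.polyFun_face a (Fin.cons (a 0) fun i => edgeMap a (v i)))
    · exact hβ.polyFun_face a _
    · have h1 : (fun i => edgeMap a ((Fin.cons t v : Fin (k + 1) → Fin d → ℝ) i)) =
          Fin.cons (edgeMap a t) fun i => edgeMap a (v i) := by
        ext1 i
        refine Fin.cases ?_ (fun i => ?_) i <;> simp
      have h2 : β (pt a (bary t)) (Fin.cons (a 0 + edgeMap a t) fun i => edgeMap a (v i)) =
          (β (pt a (bary t))).curryLeft (a 0) (fun i => edgeMap a (v i)) +
            (β (pt a (bary t))).curryLeft (edgeMap a t) (fun i => edgeMap a (v i)) := by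
        rw [← ContinuousAlternatingMap.add_apply, ← map_add]
        rfl
      rw [AlternatingMap.add_apply, faceForm_apply, faceForm_apply, faceForm_apply, h1, hwαβ,
        ContinuousAlternatingMap.add_apply, koszul_apply, add_assoc]
      congr 1
      rw [← pt_bary] at h2
      exact h2
    -- An increasing multi-index exists only if `k ≤ d`. With `d = k + m`, the moment condition
    -- becomes `s ≤ r-1-m`, the degree in the definition of `FaceMoments`.
    · have hkd : k ≤ d := by simpa using Fintype.card_le_of_embedding σ.toEmbedding
      obtain ⟨m, rfl⟩ := Nat.exists_eq_add_of_le hkd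
      exact hM m (r - 1 - m) (by omega) a ha (fun i => ⟨i, rfl⟩) (fun i => bary0 (stdTuple σ i))
        (fun i => sum_bary0 _) g (hg.mono (by omega))
  intro c hc e he
  have h := congrArg (fun F => F fun i => Fin.tail (e i)) (hmain (Fin.tail c))
  simp only [faceForm_apply, bary_tail hc, edgeMap_apply, bary0_tail (he _)] at h
  exact h

/-- Unisolvence of the degrees of freedom of `P_r⁻ Λᵏ` on a face. -/
theorem zeroTrace_of_faceMoments (hr : 1 ≤ r) {w : E n → Form n k} (hw : IsTrimmedForm r w) :
    ∀ {d : ℕ} (a : Fin (d + 1) → E n), Function.Injective a → FaceMoments r (Set.range a) w →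
      ZeroTrace a w := by
  intro d
  induction d with
  | zero =>
    intro a ha hM
    refine zeroTrace_of_facets hr hw ha hM fun j t hj => ?_
    -- A single vertex has no facets: its only barycentric coordinate is `1`.
    rw [Fin.fin_one_eq_zero j] at hj
    simp at hj
  | succ d ih =>
    intro a ha hM
    refine zeroTrace_of_facets hr hw ha hM fun j t hj v hv => ?_
    have h := ih (a ∘ j.succAbove) (ha.comp Fin.succAbove_right_injective)
      (hM.mono (Set.range_comp_subset_range _ _)) (bary t ∘ j.succAbove)
      (by rw [sum_succAbove j hj, sum_bary]) (fun i => bary0 (v i) ∘ j.succAbove)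
      (fun i => by rw [sum_succAbove j (hv i), sum_bary0])
    simp only [← pt_succAbove a j hj, ← pt_succAbove a j (hv _)] at h
    exact h

theorem zeroMoments_of_stdTuple {s : ℕ} {a : Fin (d + 1) → E n} {w : E n → Form n k}
    (hw : Continuous w) (h : ∀ (σ : Fin k ↪o Fin d) (g), PolyFun s g →
      ∫ t in unitSimplex d, faceForm a w t (stdTuple σ) * g t = 0) : ZeroMoments s a w := by
  intro e he g hg
  have hexp : ∀ t, w (pt a (bary t)) (fun i => pt a (e i)) * g t =
      ∑ σ : Fin k ↪o Fin d, minor σ (fun i => Fin.tail (e i)) *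
        (faceForm a w t (stdTuple σ) * g t) := by
    intro t
    have h1 := alternating_expand_pi (faceForm a w t) fun i => Fin.tail (e i)
    simp only [faceForm_apply _ _ _ fun i => Fin.tail (e i), edgeMap_apply,
      bary0_tail (he _)] at h1
    rw [h1, Finset.sum_mul]
    exact Finset.sum_congr rfl fun σ _ => by ring
  simp only [hexp]
  rw [integral_finsetSum]
  · simp [integral_const_mul, h _ g hg]
  · intro σ _
    refine (integrableOn_unitSimplex (Continuous.mul ?_ hg.continuous)).const_mul _
    simp only [faceForm_apply]
    have hcw : Continuous fun t : Fin d → ℝ => w (pt a (bary t)) := hw.comp (continuous_pt_bary a)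
    exact (ContinuousAlternatingMap.apply ℝ (E n) ℝ _).continuous.comp hcw

end Faces

/-! ### Degrees of freedom as moments -/

section Wedge

variable {n k m r : ℕ}

/-- Every shuffle class other than that of the identity feeds some left argument to `b`, and `h`
makes such a term vanish. -/
theorem domCoprod_apply_eq {V : Type*} [AddCommGroup V] [Module ℝ V] {ιa ιb : Type*} [Fintype ιa]
    [Fintype ιb] [DecidableEq ιa] [DecidableEq ιb] (a : V [⋀^ιa]→ₗ[ℝ] ℝ) (b : V [⋀^ιb]→ₗ[ℝ] ℝ)
    (v : ιa ⊕ ιb → V) (h : ∀ u : ιb → V, (∃ j i, u j = v (Sum.inl i)) → b u = 0) :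
    LinearMap.mul' ℝ ℝ (a.domCoprod b v) =
      a (fun i => v (Sum.inl i)) * b fun j => v (Sum.inr j) := by
  have h1 : a.domCoprod b v =
      ∑ c : Equiv.Perm.ModSumCongr ιa ιb, AlternatingMap.domCoprod.summand a b c v := by
    rw [AlternatingMap.domCoprod_apply, sum_apply]
  rw [h1, map_sum]
  refine (Finset.sum_eq_single (Quotient.mk'' 1) ?_ ?_).trans ?_
  rotate_left 2
  · rw [AlternatingMap.domCoprod.summand_mk'']
    simp [MultilinearMap.domCoprod_apply]
  · intro c _ hc
    induction c using Quotient.inductionOn' with | _ θ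
    have hθ : ∃ j i, θ (Sum.inr j) = Sum.inl i := by
      by_contra hcon
      push Not at hcon
      refine hc (Quotient.sound' (QuotientGroup.leftRel_apply.2 ?_))
      rw [mul_one]
      refine inv_mem (Equiv.Perm.mem_sumCongrHom_range_of_perm_mapsTo_inl ?_)
      rw [Equiv.Perm.perm_mapsTo_inl_iff_mapsTo_inr]
      rintro _ ⟨j, rfl⟩
      rcases hx : θ (Sum.inr j) with i | i
      · exact absurd hx (hcon j i)
      · exact ⟨i, rfl⟩
    obtain ⟨j, i, hji⟩ := hθ
    rw [AlternatingMap.domCoprod.summand_mk'']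
    have : b (fun j => v (θ (Sum.inr j))) = 0 := h _ ⟨j, i, by simp [hji]⟩
    simp [MultilinearMap.domCoprod_apply, this]
  · simp

theorem domCoprod_apply_sum {V : Type*} [AddCommGroup V] [Module ℝ V] {ιa ιb : Type*} [Fintype ιa]
    [Fintype ιb] [DecidableEq ιa] [DecidableEq ιb] (a : V [⋀^ιa]→ₗ[ℝ] ℝ) (b : V [⋀^ιb]→ₗ[ℝ] ℝ)
    (v : ιa ⊕ ιb → V) :
    LinearMap.mul' ℝ ℝ (a.domCoprod b v) = ∑ c : Equiv.Perm.ModSumCongr ιa ιb,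
      (Equiv.Perm.sign (Quotient.out c) : ℝ) * (a (fun i => v (Quotient.out c (Sum.inl i))) *
        b fun j => v (Quotient.out c (Sum.inr j))) := by
  have h1 : a.domCoprod b v =
      ∑ c : Equiv.Perm.ModSumCongr ιa ιb, AlternatingMap.domCoprod.summand a b c v := by
    rw [AlternatingMap.domCoprod_apply, sum_apply]
  rw [h1, map_sum]
  refine Finset.sum_congr rfl fun c _ => ?_
  have h2 : c = Quotient.mk'' (Quotient.out c) := (Quotient.out_eq c).symm
  conv_lhs => rw [h2]
  rw [AlternatingMap.domCoprod.summand_mk'']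
  rcases Int.units_eq_one_or (Equiv.Perm.sign (Quotient.out c)) with h | h <;>
    simp [h, MultilinearMap.domCoprod_apply]

theorem wedge_apply (w : Form n k) (q : Form n m) (v : Fin (k + m) → E n) :
    wedge w q v = LinearMap.mul' ℝ ℝ (w.toAlternatingMap.domCoprod q.toAlternatingMap
      (v ∘ finSumFinEquiv)) := rfl

theorem wedge_sub (w w' : Form n k) (q : Form n m) : wedge (w - w') q = wedge w q - wedge w' q := by
  ext v
  rw [AlternatingMap.sub_apply, wedge_apply, wedge_apply, wedge_apply, domCoprod_apply_sum,
    domCoprod_apply_sum, domCoprod_apply_sum, ← Finset.sum_sub_distrib]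
  refine Finset.sum_congr rfl fun c _ => ?_
  rw [← mul_sub, ← sub_mul]
  rfl

theorem wedge_comp_equiv (w : Form n k) (q : Form n m) (v : Fin (k + m) → E n)
    (π : Fin k ⊕ Fin m ≃ Fin (k + m)) (h : ∀ u : Fin m → E n,
      (∃ j i, u j = v (π (Sum.inl i))) → q u = 0) :
    w (fun i => v (π (Sum.inl i))) * q (fun j => v (π (Sum.inr j))) =
      (Equiv.Perm.sign (finSumFinEquiv.symm.trans π) : ℝ) * wedge w q v := by
  have h1 := (wedge w q).map_perm v (finSumFinEquiv.symm.trans π)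
  rw [wedge_apply] at h1
  have h2 : (v ∘ ⇑(finSumFinEquiv.symm.trans π)) ∘ finSumFinEquiv = v ∘ π := by
    ext1 x; simp
  rw [h2, domCoprod_apply_eq _ _ _ h] at h1
  rw [Units.smul_def, zsmul_eq_mul] at h1
  exact h1

theorem faceIntegral_eq {d : ℕ} (a : Fin (d + 1) → E n) (w : E n → E n [⋀^Fin d]→ₗ[ℝ] ℝ) :
    faceIntegral a w = ∫ t in unitSimplex d, w (pt a (bary t)) (fun i => edgeMap a (Pi.single i 1)) := by
  simp only [edgeMap_single]
  simp only [faceIntegral, pt_bary, edgeMap_eq_sum a]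
  rfl

theorem continuous_apply_pt {d : ℕ} {w : E n → Form n k} (hw : Continuous w) (a : Fin (d + 1) → E n)
    (v : Fin k → E n) : Continuous fun t => w (pt a (bary t)) v :=
  (ContinuousAlternatingMap.apply ℝ (E n) ℝ v).continuous.comp (hw.comp (continuous_pt_bary a))

theorem continuous_wedge {d : ℕ} {w : E n → Form n k} {q : E n → Form n m} (hw : Continuous w)
    (hq : Continuous q) (a : Fin (d + 1) → E n) (v : Fin (k + m) → E n) :
    Continuous fun t => wedge (w (pt a (bary t))) (q (pt a (bary t))) v := by
  simp only [wedge_apply, domCoprod_apply_sum]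
  exact continuous_finsetSum _ fun c _ => continuous_const.mul
    ((continuous_apply_pt hw a _).mul (continuous_apply_pt hq a _))

theorem faceIntegral_sub {w w' : E n → Form n k} {q : E n → Form n m} (hw : Continuous w)
    (hw' : Continuous w') (hq : Continuous q) (a : Fin (k + m + 1) → E n) :
    faceIntegral a (fun x => wedge (w x - w' x) (q x)) =
      faceIntegral a (fun x => wedge (w x) (q x)) - faceIntegral a fun x => wedge (w' x) (q x) := by
  simp only [faceIntegral_eq, wedge_sub, AlternatingMap.sub_apply]
  exact integral_sub (integrableOn_unitSimplex (continuous_wedge hw hq _ _))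
    (integrableOn_unitSimplex (continuous_wedge hw' hq _ _))

theorem FaceMoments.sameDofs {K : Finset (E n)} {p p' : E n → Form n k} (hp : Continuous p)
    (hp' : Continuous p') (h : FaceMoments r (K : Set (E n)) fun x => p x - p' x) :
    SameDofs r K p p' := by
  intro m s hms a ha haK q hq
  rw [← sub_eq_zero, ← faceIntegral_sub hp hp' hq.continuous, faceIntegral_eq]
  simp only [wedge_apply, domCoprod_apply_sum]
  rw [integral_finsetSum]
  · refine Finset.sum_eq_zero fun c _ => ?_
    rw [integral_const_mul]
    refine mul_eq_zero_of_right _ ?_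
    exact h m s hms a ha haK _ (fun i => sum_bary0 _) _ (hq.polyFun_face a _)
  · intro c _
    exact integrableOn_unitSimplex (continuous_const.mul
      ((continuous_apply_pt (hp.sub hp') a _).mul (continuous_apply_pt hq.continuous a _)))

theorem exists_equiv_extending (σ : Fin k ↪o Fin (k + m)) :
    ∃ π : Fin k ⊕ Fin m ≃ Fin (k + m), ∀ i, π (Sum.inl i) = σ i := by
  classical
  have hs : (Finset.univ.map σ.toEmbedding).card = k := by simp
  have hs' : (Finset.univ.map σ.toEmbedding)ᶜ.card = m := by
    rw [Finset.card_compl, hs]; simp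
  refine ⟨finSumEquivOfFinset hs hs', fun i => ?_⟩
  rw [finSumEquivOfFinset_inl]
  have := Finset.orderEmbOfFin_unique' hs (f := σ) (fun x => by simp)
  rw [← this]

theorem exists_form_dual_edges {a : Fin (k + m + 1) → E n} {R : E n →ₗ[ℝ] Fin (k + m) → ℝ}
    (hR : ∀ u, R (edgeMap a u) = u) (π : Fin k ⊕ Fin m ≃ Fin (k + m)) :
    ∃ q : Form n m, q (fun j => edgeMap a (Pi.single (π (Sum.inr j)) 1)) = 1 ∧
      ∀ u : Fin m → E n, (∃ j i, u j = edgeMap a (Pi.single (π (Sum.inl i)) 1)) → q u = 0 := by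
  refine ⟨toForm ((minor fun j => π (Sum.inr j)).compLinearMap R), ?_, ?_⟩
  · rw [toForm_apply, AlternatingMap.compLinearMap_apply, minor_apply]
    have : (Matrix.of fun i j => (fun l => R (edgeMap a (Pi.single (π (Sum.inr l)) 1))) i
        (π (Sum.inr j))) = (1 : Matrix (Fin m) (Fin m) ℝ) := by
      ext i j
      simp [hR, Matrix.one_apply, Pi.single_apply, eq_comm]
    exact (congrArg Matrix.det this).trans Matrix.det_one
  · rintro u ⟨j, i, hu⟩
    rw [toForm_apply, AlternatingMap.compLinearMap_apply]
    refine minor_eq_zero_of_row _ _ j fun l => ?_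
    rw [hu, hR]
    exact Pi.single_eq_of_ne (fun hh => by simpa using π.injective hh) _

/-- Test with `q = g q₀`, where `q₀` is dual to the edges complementary to the chosen ones: a single
shuffle survives, so the wedge product isolates one coefficient of the trace. The polynomial `g` in
face coordinates extends to `ℝⁿ` through the left inverse `R`. -/
theorem SameDofs.integral_eq_zero {K : Finset (E n)} {p p' : E n → Form n k} (hp : Continuous p)
    (hp' : Continuous p') (h : SameDofs r K p p') {s : ℕ} (hms : s + m + 1 = r)
    {a : Fin (k + m + 1) → E n} (ha : Function.Injective a) (haK : ∀ i, a i ∈ K)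
    {R : E n →ₗ[ℝ] Fin (k + m) → ℝ} (hR : ∀ u, R (edgeMap a u) = u)
    (π : Fin k ⊕ Fin m ≃ Fin (k + m)) {g : (Fin (k + m) → ℝ) → ℝ} (hg : PolyFun s g) :
    ∫ t in unitSimplex (k + m), (p (pt a (bary t)) - p' (pt a (bary t)))
      (fun i => edgeMap a (Pi.single (π (Sum.inl i)) 1)) * g t = 0 := by
  obtain ⟨q₀, h1, h2⟩ := exists_form_dual_edges hR π
  let q : E n → Form n m := fun x => g (-R (a 0) + R x) • q₀
  have hq : IsPolyForm s q := by
    have := IsPolyForm.smul (hg.comp_isPoly (-R (a 0)) R) (isPolyForm_const (s := 0) q₀)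
    rwa [add_zero] at this
  have hqv : ∀ t, q (pt a (bary t)) = g t • q₀ := by
    intro t
    simp only [q, pt_bary, map_add, hR, neg_add_cancel_left]
  have h0 := h m s hms a ha haK q hq
  rw [← sub_eq_zero, ← faceIntegral_sub hp hp' hq.continuous, faceIntegral_eq] at h0
  have hw : ∀ t, (p (pt a (bary t)) - p' (pt a (bary t)))
      (fun i => edgeMap a (Pi.single (π (Sum.inl i)) 1)) * g t =
      (Equiv.Perm.sign (finSumFinEquiv.symm.trans π) : ℝ) *
        wedge (p (pt a (bary t)) - p' (pt a (bary t))) (q (pt a (bary t)))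
          fun i => edgeMap a (Pi.single i 1) := by
    intro t
    rw [← wedge_comp_equiv _ _ (fun i => edgeMap a (Pi.single i 1)) π]
    · rw [hqv, ContinuousAlternatingMap.smul_apply, h1, smul_eq_mul, mul_one]
    · intro u hu
      rw [hqv, ContinuousAlternatingMap.smul_apply, h2 u hu, smul_zero]
  simp only [hw, integral_const_mul, h0, mul_zero]

theorem exists_leftInverse_edgeMap {d : ℕ} {a : Fin (d + 1) → E n} (ha : AffineIndependent ℝ a) :
    ∃ R : E n →ₗ[ℝ] Fin d → ℝ, ∀ u, R (edgeMap a u) = u := by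
  obtain ⟨R, hR⟩ := (edgeMap a).exists_leftInverse_of_injective
    (LinearMap.ker_eq_bot.2 (edgeMap_injective ha))
  exact ⟨R, fun u => LinearMap.congr_fun hR u⟩

theorem affineIndependent_of_mem {ι : Type*} {K : Finset (E n)}
    (hK : AffineIndependent ℝ (fun a : K => (a : E n))) {a : ι → E n}
    (ha : Function.Injective a) (haK : ∀ i, a i ∈ K) : AffineIndependent ℝ a := by
  let f : ι ↪ K := ⟨fun i => ⟨a i, haK i⟩, fun i j hij => ha (congrArg Subtype.val hij)⟩
  exact hK.comp_embedding f

theorem SameDofs.faceMoments {K : Finset (E n)} (hK : AffineIndependent ℝ (fun a : K => (a : E n)))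
    {p p' : E n → Form n k} (hp : Continuous p)
    (hp' : Continuous p') (h : SameDofs r K p p') :
    FaceMoments r (K : Set (E n)) fun x => p x - p' x := by
  intro m s hms a ha haK
  have haff : AffineIndependent ℝ a := affineIndependent_of_mem hK ha haK
  obtain ⟨R, hR⟩ := exists_leftInverse_edgeMap haff
  refine zeroMoments_of_stdTuple (hp.sub hp') fun σ g hg => ?_
  obtain ⟨π, hπ⟩ := exists_equiv_extending σ
  have h1 := h.integral_eq_zero hp hp' hms ha haK hR π hg
  simp only [hπ] at h1
  exact h1

end Wedge

/-! ### Bubble forms on the unit simplex -/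

section Bubble

variable {n k m r s d : ℕ}

/-- `bary0` as a linear map. -/
def baryLin (d : ℕ) : (Fin d → ℝ) →ₗ[ℝ] Fin (d + 1) → ℝ where
  toFun := bary0
  map_add' := bary0_add
  map_smul' := bary0_smul

theorem baryLin_apply (u : Fin d → ℝ) : baryLin d u = bary0 u := rfl

/-- The vertices `0` and `σ i + 1`. -/
def vertexRows (σ : Fin k ↪o Fin d) : Fin (k + 1) → Fin (d + 1) := Fin.cons 0 fun i => (σ i).succ

/-- The product of the barycentric coordinates with indices outside of `vertexRows σ`. -/
def bubbleWeight (σ : Fin k ↪o Fin d) (t : Fin d → ℝ) : ℝ :=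
  ∏ i ∈ (Finset.univ.map σ.toEmbedding)ᶜ, t i

theorem polyFun_bubbleWeight (σ : Fin k ↪o Fin (k + m)) : PolyFun m (bubbleWeight σ) := by
  have h := PolyFun.prod (S := (Finset.univ.map σ.toEmbedding)ᶜ)
    (F := fun i (t : Fin (k + m) → ℝ) => t i) fun i _ => polyFun_coord i le_rfl
  rw [Finset.card_compl, Finset.card_map, Finset.card_univ, Fintype.card_fin, Fintype.card_fin,
    Nat.add_sub_cancel_left] at h
  exact h

/-- The bubble form of degree `k` associated with `σ`, in terms of barycentric coordinates `c` and
their differentials `e`. -/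
def bubble (σ : Fin k ↪o Fin d) (c : Fin (d + 1) → ℝ) (e : Fin k → Fin (d + 1) → ℝ) : ℝ :=
  bubbleWeight σ (Fin.tail c) * minor (vertexRows σ) (Fin.cons c e)

/-- If `j` is a vertex of the Whitney form, the minor has a zero column; otherwise the weight
contains the vanishing factor `c j`. -/
theorem bubble_eq_zero (σ : Fin k ↪o Fin d) {c : Fin (d + 1) → ℝ} {e : Fin k → Fin (d + 1) → ℝ}
    (j : Fin (d + 1)) (hc : c j = 0) (he : ∀ i, e i j = 0) : bubble σ c e = 0 := by
  by_cases hj : ∃ l, vertexRows σ l = j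
  · obtain ⟨l, rfl⟩ := hj
    rw [bubble, minor_eq_zero_of_col _ _ l, mul_zero]
    intro i
    refine Fin.cases ?_ (fun i => ?_) i
    · simpa using hc
    · simpa using he i
  · push Not at hj
    refine mul_eq_zero_of_left ?_ _
    obtain ⟨i, rfl⟩ := Fin.exists_succ_eq.2 fun h0 : j = 0 => hj 0 (by simp [vertexRows, h0])
    refine Finset.prod_eq_zero (i := i) ?_ hc
    simp only [Finset.mem_compl, Finset.mem_map, Finset.mem_univ, true_and, not_exists]
    intro l hl
    refine hj l.succ ?_
    simp only [vertexRows, Fin.cons_succ]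
    exact congrArg Fin.succ hl

theorem cons_bary0 (c : Fin d → ℝ) (v : Fin k → Fin d → ℝ) :
    (fun i => baryLin d ((Fin.cons c v : Fin (k + 1) → Fin d → ℝ) i)) =
      Fin.cons (bary0 c) fun i => bary0 (v i) := by
  ext1 i
  refine Fin.cases ?_ (fun i => ?_) i <;> simp [baryLin_apply]

theorem minor_cons_add (ρ : Fin (k + 1) → Fin d) (x y : Fin d → ℝ) (v : Fin k → Fin d → ℝ) :
    minor ρ (Fin.cons (x + y) v) = minor ρ (Fin.cons x v) + minor ρ (Fin.cons y v) := by
  have h : (minor ρ).curryLeft (x + y) v = (minor ρ).curryLeft x v + (minor ρ).curryLeft y v := by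
    rw [← AlternatingMap.add_apply, ← map_add]
  exact h

theorem continuous_minor_cons (σ τ : Fin k ↪o Fin d) : Continuous fun t : Fin d → ℝ =>
    minor (vertexRows σ) (Fin.cons (bary t) fun i => bary0 (stdTuple τ i)) := by
  simp only [minor_apply]
  refine Continuous.matrix_det (continuous_matrix fun i j => ?_)
  refine Fin.cases ?_ (fun i => ?_) i
  · exact (polyFun_bary _).continuous
  · exact continuous_const

theorem minor_vertexRows_zero (σ τ : Fin k ↪o Fin d) :
    minor (vertexRows σ) (Fin.cons (bary 0) fun i => bary0 (stdTuple τ i)) =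
      if σ = τ then 1 else 0 := by
  rw [← minor_single, minor_apply, minor_apply, Matrix.det_succ_row_zero, Fin.sum_univ_succ]
  rw [Finset.sum_eq_zero]
  · simp [vertexRows, Matrix.submatrix, Matrix.of_apply, stdTuple]
  · intro i _
    simp [vertexRows]

/-- The combination of bubbles is a trimmed form of degree `s + m + 1` with zero facet traces and
zero moments, hence zero. To return to the coefficients it is enough to look near the vertex `0`,
where the Whitney forms are linearly independent. -/
theorem bubble_unisolvent (q : (Fin k ↪o Fin (k + m)) → (Fin (k + m) → ℝ) → ℝ)
    (hq : ∀ σ, PolyFun s (q σ))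
    (h : ∀ (τ : Fin k ↪o Fin (k + m)) (g), PolyFun s g → ∫ t in unitSimplex (k + m),
      (∑ σ, q σ t * bubble σ (bary t) fun i => bary0 (stdTuple τ i)) * g t = 0)
    (σ : Fin k ↪o Fin (k + m)) : ∀ᶠ t in nhds 0, (∀ i, 0 < t i) → q σ t = 0 := by
  have hqw : ∀ σ, PolyFun (s + m) fun t => q σ t * bubbleWeight σ t :=
    fun σ => (hq σ).mul (polyFun_bubbleWeight σ)
  let W : (Fin (k + m) → ℝ) → (Fin (k + m) → ℝ) [⋀^Fin k]→ₗ[ℝ] ℝ := fun t =>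
    ∑ σ, (q σ t * bubbleWeight σ t) •
      ((minor (vertexRows σ)).curryLeft (bary t)).compLinearMap (baryLin (k + m))
  have hWv : ∀ t v, W t v = ∑ σ, q σ t * bubble σ (bary t) fun i => bary0 (v i) := by
    intro t v
    simp only [W, alternatingMap_sum_apply, AlternatingMap.smul_apply, smul_eq_mul, mul_assoc]
    rfl
  have hW0 : ∀ t, W t = 0 := by
    refine trimmed_eq_zero_of_trace_of_moments (r := s + m + 1) (by omega) W
      (fun t => ∑ σ, (q σ t * bubbleWeight σ t) •
        ((minor (vertexRows σ)).curryLeft (bary 0)).compLinearMap (baryLin (k + m)))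
      (fun t => ∑ σ, (q σ t * bubbleWeight σ t) •
        (minor (vertexRows σ)).compLinearMap (baryLin (k + m)))
      (fun v => ?_) (fun v => ?_) (fun t v => ?_) (fun j t hj v hv => ?_) (fun τ s' g hs hg => ?_)
    · simp only [alternatingMap_sum_apply, AlternatingMap.smul_apply, smul_eq_mul]
      exact PolyFun.sum fun σ _ => (hqw σ).mul_const _
    · simp only [alternatingMap_sum_apply, AlternatingMap.smul_apply, smul_eq_mul]
      exact PolyFun.sum fun σ _ => (hqw σ).mul_const _
    · simp only [W, alternatingMap_sum_apply, AlternatingMap.smul_apply, smul_eq_mul,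
        AlternatingMap.compLinearMap_apply, ← Finset.sum_add_distrib, ← mul_add]
      refine Finset.sum_congr rfl fun σ _ => ?_
      congr 1
      rw [cons_bary0]
      have := minor_cons_add (vertexRows σ) (bary 0) (bary0 t) fun i => bary0 (v i)
      rw [← bary_add, zero_add] at this
      exact this
    · rw [hWv]
      exact Finset.sum_eq_zero fun σ _ => by rw [bubble_eq_zero σ j hj hv, mul_zero]
    · simp only [hWv]
      exact h τ g (hg.mono (by omega))
  -- The matrix of the Whitney forms in the standard basis is the identity at the vertex `0`, so it
  -- stays invertible nearby. The weights are positive where all coordinates are, so they can be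
  -- divided out.
  let M : (Fin (k + m) → ℝ) → Matrix (Fin k ↪o Fin (k + m)) (Fin k ↪o Fin (k + m)) ℝ := fun t =>
    Matrix.of fun σ τ => minor (vertexRows σ) (Fin.cons (bary t) fun i => bary0 (stdTuple τ i))
  have hMc : Continuous fun t => (M t).det :=
    Continuous.matrix_det (continuous_matrix fun σ τ => continuous_minor_cons σ τ)
  have hM0 : (M 0).det ≠ 0 := by
    have : M 0 = 1 := by
      ext σ τ
      rw [Matrix.one_apply]
      exact minor_vertexRows_zero σ τ
    rw [this, Matrix.det_one]
    exact one_ne_zero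
  filter_upwards [hMc.continuousAt.eventually_ne hM0] with t ht htp
  have hv : Matrix.vecMul (fun σ => q σ t * bubbleWeight σ t) (M t) = 0 := by
    ext τ
    have := hWv t (stdTuple τ)
    rw [hW0] at this
    simp only [Matrix.vecMul, dotProduct, M, Matrix.of_apply, Pi.zero_apply]
    simp only [bubble, AlternatingMap.zero_apply, ← mul_assoc] at this
    exact this.symm
  have hz := congrFun (Matrix.eq_zero_of_vecMul_eq_zero ht hv) σ
  exact (mul_eq_zero.1 hz).resolve_right (Finset.prod_pos fun i _ => htp i).ne'

theorem continuous_bubble (σ τ : Fin k ↪o Fin (k + m)) :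
    Continuous fun t => bubble σ (bary t) fun i => bary0 (stdTuple τ i) :=
  (polyFun_bubbleWeight σ).continuous.mul (continuous_minor_cons σ τ)

/-- Bubble forms with prescribed moments. -/
theorem exists_bubble_moments (F : (Fin k ↪o Fin (k + m)) → (Fin (k + m) → ℝ) → ℝ)
    (hF : ∀ τ, Continuous (F τ)) :
    ∃ q : (Fin k ↪o Fin (k + m)) → (Fin (k + m) → ℝ) → ℝ, (∀ σ, PolyFun s (q σ)) ∧
      ∀ (τ : Fin k ↪o Fin (k + m)) (g), PolyFun s g → ∫ t in unitSimplex (k + m),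
        (∑ σ, q σ t * bubble σ (bary t) fun i => bary0 (stdTuple τ i)) * g t =
          ∫ t in unitSimplex (k + m), F τ t * g t := by
  let Q := (Fin k ↪o Fin (k + m)) → MvPolynomial.restrictTotalDegree (Fin (k + m)) ℝ s
  let G : Q → (Fin k ↪o Fin (k + m)) → (Fin (k + m) → ℝ) → ℝ := fun q τ t =>
    ∑ σ, MvPolynomial.eval t (q σ).1 * bubble σ (bary t) fun i => bary0 (stdTuple τ i)
  have hpoly : ∀ (q : Q) σ, PolyFun s fun t => MvPolynomial.eval t (q σ).1 := fun q σ =>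
    polyFun_eval ((MvPolynomial.mem_restrictTotalDegree _ _ _).1 (q σ).2)
  have hG : ∀ q τ, Continuous (G q τ) := fun q τ =>
    continuous_finsetSum _ fun σ _ => (hpoly q σ).continuous.mul (continuous_bubble σ τ)
  have hadd : ∀ (q q' : Q) σ t, MvPolynomial.eval t ((q + q') σ).1 =
      MvPolynomial.eval t (q σ).1 + MvPolynomial.eval t (q' σ).1 := fun q q' σ t => map_add _ _ _
  have hsmul : ∀ (c : ℝ) (q : Q) σ t, MvPolynomial.eval t ((c • q) σ).1 =
      c * MvPolynomial.eval t (q σ).1 := fun c q σ t => MvPolynomial.smul_eval _ _ _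
  have hGadd : ∀ q q' τ t, G (q + q') τ t = G q τ t + G q' τ t := by
    intro q q' τ t
    simp only [G, hadd, add_mul, Finset.sum_add_distrib]
  have hGsmul : ∀ (c : ℝ) q τ t, G (c • q) τ t = c * G q τ t := by
    intro c q τ t
    simp only [G, hsmul, mul_assoc,
      Finset.mul_sum]
  -- Coefficients of bubbles and test polynomials range over the same space `Q`, so injectivity of
  -- this pairing gives surjectivity onto the dual.
  let β : Q →ₗ[ℝ] Module.Dual ℝ Q := LinearMap.mk₂ ℝ
    (fun q g => ∑ τ, ∫ t in unitSimplex (k + m), G q τ t * MvPolynomial.eval t (g τ).1)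
    (fun q q' g => by
      rw [← Finset.sum_add_distrib]
      refine Finset.sum_congr rfl fun τ _ => ?_
      rw [← integral_add]
      · simp only [hGadd, add_mul]
      · exact integrableOn_unitSimplex ((hG q τ).mul (hpoly g τ).continuous)
      · exact integrableOn_unitSimplex ((hG q' τ).mul (hpoly g τ).continuous))
    (fun c q g => by
      simp only [hGsmul, mul_assoc, integral_const_mul, smul_eq_mul, Finset.mul_sum])
    (fun q g g' => by
      rw [← Finset.sum_add_distrib]
      refine Finset.sum_congr rfl fun τ _ => ?_
      rw [← integral_add]
      · simp only [hadd, mul_add]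
      · exact integrableOn_unitSimplex ((hG q τ).mul (hpoly g τ).continuous)
      · exact integrableOn_unitSimplex ((hG q τ).mul (hpoly g' τ).continuous))
    (fun c q g => by
      simp only [hsmul, mul_left_comm _ c,
        integral_const_mul, smul_eq_mul, Finset.mul_sum])
  let φ : Module.Dual ℝ Q :=
    { toFun := fun g => ∑ τ, ∫ t in unitSimplex (k + m), F τ t * MvPolynomial.eval t (g τ).1
      map_add' := fun g g' => by
        rw [← Finset.sum_add_distrib]
        refine Finset.sum_congr rfl fun τ _ => ?_
        rw [← integral_add]
        · simp only [hadd, mul_add]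
        · exact integrableOn_unitSimplex ((hF τ).mul (hpoly g τ).continuous)
        · exact integrableOn_unitSimplex ((hF τ).mul (hpoly g' τ).continuous)
      map_smul' := fun c g => by
        simp only [hsmul, mul_left_comm _ c,
          integral_const_mul, smul_eq_mul, Finset.mul_sum, RingHom.id_apply] }
  have hsingle : ∀ (H : (Fin k ↪o Fin (k + m)) → (Fin (k + m) → ℝ) → ℝ) τ
      (P : MvPolynomial.restrictTotalDegree (Fin (k + m)) ℝ s),
      ∑ τ', ∫ t in unitSimplex (k + m), H τ' t *
        MvPolynomial.eval t ((Pi.single τ P : Q) τ').1 =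
      ∫ t in unitSimplex (k + m), H τ t * MvPolynomial.eval t P.1 := by
    intro H τ P
    rw [Finset.sum_eq_single τ]
    · simp
    · intro τ' _ hne
      simp [hne]
    · simp
  have hinj : Function.Injective β := by
    rw [injective_iff_map_eq_zero]
    intro q hq
    have h0 := bubble_unisolvent (fun σ t => MvPolynomial.eval t (q σ).1) (hpoly q)
      (fun τ g hg => by
        obtain ⟨P, hP, hg⟩ := hg
        have h1 := LinearMap.congr_fun hq
          (Pi.single τ ⟨P, (MvPolynomial.mem_restrictTotalDegree _ _ _).2 hP⟩)
        change ∑ τ', _ = _ at h1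
        rw [hsingle (G q)] at h1
        simp only [hg]
        exact h1)
    ext1 σ
    refine Subtype.ext ?_
    obtain ⟨U, hU, hUo, h0U⟩ := eventually_nhds_iff.1 (h0 σ)
    refine PolyFun.eq_zero_of_isOpen (U := U ∩ {t | ∀ i, 0 < t i}) (hUo.inter ?_) ?_
      fun t ht => hU t ht.1 ht.2
    · simp only [Set.ofPred_forall]
      exact isOpen_iInter_of_finite fun i => isOpen_lt continuous_const (continuous_apply i)
    · have hlim : Filter.Tendsto (fun ε : ℝ => (fun _ : Fin (k + m) => ε))
          (nhdsWithin 0 (Set.Ioi 0)) (nhds 0) := by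
        have : Continuous fun ε : ℝ => (fun _ : Fin (k + m) => ε) := by fun_prop
        exact (this.tendsto' 0 0 rfl).mono_left nhdsWithin_le_nhds
      obtain ⟨ε, h1, h2⟩ := ((hlim.eventually (hUo.mem_nhds h0U)).and
        self_mem_nhdsWithin).exists
      exact ⟨_, h1, fun _ => h2⟩
  have hsurj : Function.Surjective β :=
    (LinearMap.injective_iff_surjective_of_finrank_eq_finrank Subspace.dual_finrank_eq.symm).1 hinj
  obtain ⟨q, hq⟩ := hsurj φ
  refine ⟨fun σ t => MvPolynomial.eval t (q σ).1, hpoly q, fun τ g hg => ?_⟩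
  obtain ⟨P, hP, hg⟩ := hg
  have h1 := LinearMap.congr_fun hq
    (Pi.single τ ⟨P, (MvPolynomial.mem_restrictTotalDegree _ _ _).2 hP⟩)
  change ∑ τ', _ = ∑ τ', _ at h1
  rw [hsingle (G q), hsingle F] at h1
  simp only [hg]
  exact h1

end Bubble

/-! ### Existence of trimmed forms with prescribed degrees of freedom -/

section Existence

variable {n k m r s d N : ℕ}

theorem ZeroMoments.comp_perm {a : Fin (d + 1) → E n} {w : E n → Form n k} (h : ZeroMoments s a w)
    (π : Equiv.Perm (Fin (d + 1))) : ZeroMoments s (a ∘ π) w := by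
  intro e he g hg
  rw [← integral_permMap π]
  simp only [bary_permMap, pt_comp_perm]
  have h1 : ∀ i, pt (a ∘ π) (e i) = pt a (e i ∘ π.symm) := by
    intro i
    rw [← pt_comp_perm a π (e i ∘ π.symm)]
    congr 1
    ext j
    simp
  simp only [h1]
  refine h _ (fun i => ?_) _ (hg.comp fun i => polyFun_bary _)
  rw [← he i]
  exact Equiv.sum_comp π.symm (e i)

theorem ZeroMoments.congr {a : Fin (d + 1) → E n} {w w' : E n → Form n k} (h : ZeroMoments s a w)
    (hw : ZeroTrace a fun x => w' x - w x) : ZeroMoments s a w' := by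
  intro e he g hg
  rw [← h e he g hg]
  refine integral_congr_ae (.of_forall fun t => ?_)
  exact congrArg (· * g t) (sub_eq_zero.1 (hw _ (sum_bary t) e he))

theorem sum_extend {M : Type*} [AddCommMonoid M] {β : Fin d → Fin N} (hβ : Function.Injective β)
    (c : Fin d → ℝ) (F : Fin N → ℝ → M) (hF : ∀ j, F j 0 = 0) :
    ∑ j, F j (Function.extend β c 0 j) = ∑ i, F (β i) (c i) := by
  refine (Fintype.sum_of_injective β hβ _ _ (fun j hj => ?_) fun i => ?_).symm
  · rw [Function.extend_apply' _ _ _ (fun ⟨i, hi⟩ => hj ⟨i, hi⟩)]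
    exact hF j
  · rw [hβ.extend_apply]

theorem pt_extend (a : Fin N → E n) {β : Fin d → Fin N} (hβ : Function.Injective β)
    (c : Fin d → ℝ) : pt a (Function.extend β c 0) = pt (a ∘ β) c :=
  sum_extend hβ c (fun j x => x • a j) fun _ => zero_smul _ _

theorem sum_extend_id {β : Fin d → Fin N} (hβ : Function.Injective β)
    (c : Fin d → ℝ) : ∑ j, Function.extend β c 0 j = ∑ i, c i :=
  sum_extend hβ c (fun _ x => x) fun _ => rfl

theorem isTrimmedForm_smul_contract {g : E n → ℝ} (hg : IsPoly (r - 1) g) (α : Form n k)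
    (β : Form n (k + 1)) : IsTrimmedForm r fun x => g x • (α + β.curryLeft x) := by
  refine ⟨fun x => g x • α, fun x => g x • β, ?_, ?_, fun x => ?_⟩
  · have := IsPolyForm.smul hg (isPolyForm_const (s := 0) α)
    rwa [add_zero] at this
  · have := IsPolyForm.smul hg (isPolyForm_const (s := 0) β)
    rwa [add_zero] at this
  · exact smul_add _ _ _

/-- The bubble form on `ℝⁿ` with polynomial coefficients `q` for the face with vertices `A ∘ ι`;
`bary (R (x - A 0))` are the barycentric coordinates of `x`. -/
def bubbleForm (A : Fin (N + 1) → E n) (R : E n →ₗ[ℝ] Fin N → ℝ) (ι : Fin (d + 1) → Fin (N + 1))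
    (q : (Fin k ↪o Fin d) → (Fin d → ℝ) → ℝ) (x : E n) : Form n k :=
  ∑ σ, (q σ (Fin.tail (bary (R (x - A 0)) ∘ ι)) *
    bubbleWeight σ (Fin.tail (bary (R (x - A 0)) ∘ ι))) •
      (toForm (((minor (ι ∘ vertexRows σ)).curryLeft (bary (-R (A 0)))).compLinearMap
          (baryLin N ∘ₗ R)) +
        (toForm ((minor (ι ∘ vertexRows σ)).compLinearMap (baryLin N ∘ₗ R))).curryLeft x)

theorem isTrimmedForm_bubbleForm (A : Fin (N + 1) → E n) (R : E n →ₗ[ℝ] Fin N → ℝ)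
    (ι : Fin (k + m + 1) → Fin (N + 1)) {q : (Fin k ↪o Fin (k + m)) → (Fin (k + m) → ℝ) → ℝ}
    (hq : ∀ σ, PolyFun s (q σ)) (hs : s + m + 1 = r) : IsTrimmedForm r (bubbleForm A R ι q) := by
  refine IsTrimmedForm.sum fun σ _ => isTrimmedForm_smul_contract ?_ _ _
  have h1 : PolyFun (r - 1) fun t => q σ (Fin.tail (bary t ∘ ι)) *
      bubbleWeight σ (Fin.tail (bary t ∘ ι)) :=
    (((hq σ).comp fun i => polyFun_bary _).mul
      ((polyFun_bubbleWeight σ).comp fun i => polyFun_bary _)).mono (by omega)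
  have h2 := h1.comp_isPoly (-R (A 0)) R
  have h3 : ∀ x, -R (A 0) + R x = R (x - A 0) := fun x => by rw [map_sub, sub_eq_neg_add]
  simpa only [h3] using h2

theorem bubbleForm_apply {A : Fin (N + 1) → E n} {R : E n →ₗ[ℝ] Fin N → ℝ}
    (hR : ∀ u, R (edgeMap A u) = u) (ι : Fin (d + 1) → Fin (N + 1))
    (q : (Fin k ↪o Fin d) → (Fin d → ℝ) → ℝ) {c : Fin (N + 1) → ℝ} (hc : ∑ j, c j = 1)
    {e : Fin k → Fin (N + 1) → ℝ} (he : ∀ i, ∑ j, e i j = 0) :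
    bubbleForm A R ι q (pt A c) (fun i => pt A (e i)) =
      ∑ σ, q σ (Fin.tail (c ∘ ι)) * bubble σ (c ∘ ι) fun i => e i ∘ ι := by
  have h1 : R (pt A c) - R (A 0) = Fin.tail c := by
    rw [← map_sub]
    have := pt_bary A (Fin.tail c)
    rw [bary_tail hc] at this
    rw [this, add_sub_cancel_left, hR]
  have h2 : ∀ i, R (pt A (e i)) = Fin.tail (e i) := by
    intro i
    have := edgeMap_apply A (Fin.tail (e i))
    rw [bary0_tail (he i)] at this
    rw [← this, hR]
  have h3 : bary (-R (A 0)) + bary0 (R (pt A c)) = c := by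
    rw [← bary_add, neg_add_eq_sub, h1, bary_tail hc]
  simp only [bubbleForm, map_sub, h1, bary_tail hc]
  rw [ContinuousAlternatingMap.sum_apply]
  refine Finset.sum_congr rfl fun σ _ => ?_
  rw [ContinuousAlternatingMap.smul_apply, ContinuousAlternatingMap.add_apply, toForm_apply,
    ContinuousAlternatingMap.curryLeft_apply_apply, toForm_apply, smul_eq_mul, mul_assoc, bubble]
  congr 2
  have h4 : (fun i => (baryLin N ∘ₗ R) (pt A (e i))) = e := by
    ext1 i
    rw [LinearMap.comp_apply, h2, baryLin_apply, bary0_tail (he i)]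
  have h5 : (fun i => (baryLin N ∘ₗ R) ((Matrix.vecCons (pt A c) fun i => pt A (e i)) i)) =
      Fin.cons (bary0 (R (pt A c))) e := by
    ext1 i
    refine Fin.cases rfl (fun i => ?_) i
    exact congrFun h4 i
  have h6 := minor_cons_add (ι ∘ vertexRows σ) (bary (-R (A 0))) (bary0 (R (pt A c))) e
  rw [h3, ← h5] at h6
  nth_rewrite 2 [← h4] at h6
  have h7 : (Fin.cons (c ∘ ι) fun i => e i ∘ ι : Fin (k + 1) → Fin (d + 1) → ℝ) =
      fun i => (Fin.cons c e : Fin (k + 1) → Fin (N + 1) → ℝ) i ∘ ι := by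
    ext1 i
    refine Fin.cases rfl (fun i => rfl) i
  rw [h7]
  exact h6.symm

/-- On a face that omits the vertex `ι j`, the barycentric coordinate of that vertex and its
differential both vanish. -/
theorem bubbleForm_zeroTrace {A : Fin (N + 1) → E n} {R : E n →ₗ[ℝ] Fin N → ℝ}
    (hR : ∀ u, R (edgeMap A u) = u) (ι : Fin (d + 1) → Fin (N + 1))
    (q : (Fin k ↪o Fin d) → (Fin d → ℝ) → ℝ) {M : ℕ} {β : Fin M → Fin (N + 1)}
    (hβ : Function.Injective β) (j : Fin (d + 1)) (hj : ∀ i, β i ≠ ι j) :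
    ZeroTrace (A ∘ β) (bubbleForm A R ι q) := by
  intro c hc e he
  simp only [← pt_extend A hβ]
  rw [bubbleForm_apply hR ι q (by rw [sum_extend_id hβ, hc]) fun i => by rw [sum_extend_id hβ, he]]
  refine Finset.sum_eq_zero fun σ _ => ?_
  have h0 : ∀ f : Fin M → ℝ, Function.extend β f 0 (ι j) = 0 := fun f =>
    Function.extend_apply' _ _ _ fun ⟨i, hi⟩ => hj i hi
  rw [bubble_eq_zero σ j (h0 _) fun i => h0 _, mul_zero]

theorem faceForm_bubbleForm {A : Fin (N + 1) → E n} {R : E n →ₗ[ℝ] Fin N → ℝ}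
    (hR : ∀ u, R (edgeMap A u) = u) {ι : Fin (d + 1) → Fin (N + 1)} (hι : Function.Injective ι)
    (q : (Fin k ↪o Fin d) → (Fin d → ℝ) → ℝ) (t : Fin d → ℝ) (v : Fin k → Fin d → ℝ) :
    faceForm (A ∘ ι) (bubbleForm A R ι q) t v =
      ∑ σ, q σ t * bubble σ (bary t) fun i => bary0 (v i) := by
  simp only [faceForm_apply, edgeMap_apply, ← pt_extend A hι]
  rw [bubbleForm_apply hR ι q (by rw [sum_extend_id hι, sum_bary])
    fun i => by rw [sum_extend_id hι, sum_bary0]]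
  simp only [Function.extend_comp hι]
  rfl

theorem ZeroTrace.sum {ι : Type*} {S : Finset ι} {M : ℕ} {a : Fin M → E n}
    {F : ι → E n → Form n k} (h : ∀ i ∈ S, ZeroTrace a (F i)) :
    ZeroTrace a fun x => ∑ i ∈ S, F i x := by
  intro c hc e he
  rw [ContinuousAlternatingMap.sum_apply]
  exact Finset.sum_eq_zero fun i hi => h i hi c hc e he

theorem ZeroTrace.neg {M : ℕ} {a : Fin M → E n} {w : E n → Form n k} (h : ZeroTrace a w) :
    ZeroTrace a fun x => -w x := by
  intro c hc e he
  rw [ContinuousAlternatingMap.neg_apply, h c hc e he, neg_zero]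

/-- Induction on the dimension of the faces: when the moments on faces of dimension less than `k +
M` are matched, each face of dimension `k + M` receives a bubble form carrying its missing moments.
The trace of that bubble vanishes on every other face of dimension at most `k + M`, so no moment
already matched is disturbed. -/
theorem exists_trimmed_zeroMoments (hr : 1 ≤ r) {A : Fin (N + 1) → E n}
    (hA : AffineIndependent ℝ A) {p : E n → Form n k} (hp : IsPolyForm r p) (M : ℕ) :
    ∃ w, IsTrimmedForm r w ∧ ∀ m s : ℕ, m < M → s + m + 1 = r →
      ∀ ι : Fin (k + m + 1) ↪o Fin (N + 1), ZeroMoments s (A ∘ ι) fun x => p x - w x := by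
  obtain ⟨R, hR⟩ := exists_leftInverse_edgeMap hA
  induction M with
  | zero =>
    exact ⟨fun _ => 0, (isPolyForm_const 0).isTrimmedForm, fun m s hm => absurd hm (by omega)⟩
  | succ M ih =>
    obtain ⟨w, hw, h⟩ := ih
    -- Faces of dimension `k + M` with `M ≥ r` carry no degrees of freedom.
    by_cases hM : M + 1 ≤ r
    swap
    · exact ⟨w, hw, fun m s hm hs => h m s (by omega) hs⟩
    obtain ⟨s₀, hs₀⟩ : ∃ s₀, s₀ + M + 1 = r := ⟨r - (M + 1), by omega⟩
    have hpw : Continuous fun x => p x - w x := hp.continuous.sub (hw.isPolyForm hr).continuous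
    have hq := fun ι : Fin (k + M + 1) ↪o Fin (N + 1) =>
      exists_bubble_moments (s := s₀) (fun τ t => faceForm (A ∘ ι) (fun x => p x - w x) t
        (stdTuple τ)) fun τ => continuous_apply_pt hpw _ _
    choose q hqp hqm using hq
    have hBt : ∀ ι : Fin (k + M + 1) ↪o Fin (N + 1), IsTrimmedForm r (bubbleForm A R ι (q ι)) := fun ι =>
      isTrimmedForm_bubbleForm A R ι (hqp ι) hs₀
    refine ⟨fun x => w x + ∑ ι : Fin (k + M + 1) ↪o Fin (N + 1), bubbleForm A R ι (q ι) x, hw.add (IsTrimmedForm.sum fun ι _ =>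
      hBt ι), fun m s hm hs ι => ?_⟩
    rcases Nat.lt_succ_iff_lt_or_eq.1 hm with hm | rfl
    · refine (h m s hm hs ι).congr ?_
      have : ZeroTrace (A ∘ ι) fun x => -∑ ι' : Fin (k + M + 1) ↪o Fin (N + 1), bubbleForm A R ι' (q ι') x := by
        refine (ZeroTrace.sum fun ι' _ => ?_).neg
        obtain ⟨j, hj⟩ : ∃ j, ∀ i, ι i ≠ ι' j := by
          by_contra hcon
          push Not at hcon
          choose f hf using hcon
          have hfi : Function.Injective f := fun j j' hjj => ι'.injective (by rw [← hf, ← hf, hjj])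
          have := Fintype.card_le_of_injective f hfi
          simp at this
          omega
        exact bubbleForm_zeroTrace hR _ _ ι.injective j hj
      convert this using 1
      ext1 x
      beta_reduce
      abel
    · obtain rfl : s = s₀ := by omega
      have h1 : ZeroMoments s (A ∘ ι) fun x => p x - w x - bubbleForm A R ι (q ι) x := by
        refine zeroMoments_of_stdTuple (hpw.sub ((hBt ι).isPolyForm hr).continuous)
          fun τ g hg => ?_
        have h2 := hqm ι τ g hg
        simp only [← faceForm_bubbleForm hR ι.injective] at h2
        rw [eq_comm, ← sub_eq_zero, ← integral_sub] at h2
        · rw [← h2]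
          refine integral_congr_ae (.of_forall fun t => ?_)
          simp only [← sub_mul]
          rfl
        · exact integrableOn_unitSimplex ((continuous_apply_pt hpw _ _).mul hg.continuous)
        · exact integrableOn_unitSimplex ((continuous_apply_pt
            ((hBt ι).isPolyForm hr).continuous _ _).mul hg.continuous)
      refine h1.congr ?_
      have : ZeroTrace (A ∘ ι) fun x =>
          -∑ ι' ∈ Finset.univ.erase ι, bubbleForm A R ι' (q ι') x := by
        refine (ZeroTrace.sum fun ι' hι' => ?_).neg
        obtain ⟨j, hj⟩ : ∃ j, ∀ i, ι i ≠ ι' j := by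
          by_contra hcon
          push Not at hcon
          exact Finset.ne_of_mem_erase hι' (orderEmb_eq_of_range hcon)
        exact bubbleForm_zeroTrace hR _ _ ι.injective j hj
      convert this using 1
      ext1 x
      beta_reduce
      rw [← Finset.add_sum_erase _ _ (Finset.mem_univ ι)]
      abel

/-- The canonical interpolant of a polynomial form on a simplex exists. -/
theorem exists_trimmed_faceMoments (hr : 1 ≤ r) {A : Fin (N + 1) → E n}
    (hA : AffineIndependent ℝ A) {p : E n → Form n k} (hp : IsPolyForm r p) :
    ∃ w, IsTrimmedForm r w ∧ FaceMoments r (Set.range A) fun x => p x - w x := by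
  obtain ⟨w, hw, h⟩ := exists_trimmed_zeroMoments hr hA hp r
  refine ⟨w, hw, fun m s hms b hb hbA => ?_⟩
  choose J hJ using hbA
  obtain ⟨ι, π, hιπ⟩ := exists_orderEmb_comp_perm J fun i j hij => hb (by rw [← hJ, ← hJ, hij])
  have : b = (A ∘ ι) ∘ π := by
    ext1 i
    rw [← hJ, hιπ]
    rfl
  rw [this]
  exact (h m s (by omega) hms ι).comp_perm π

end Existence

/-! ### Norm bounds on the reference simplex -/

section FiniteDimensional

/-- `F` factors through the range of `G`, and a linear map on this finite-dimensional space is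
bounded. -/
theorem exists_bound_of_ker_le {X Y Z : Type*} [AddCommGroup X] [Module ℝ X]
    [FiniteDimensional ℝ X] [NormedAddCommGroup Y] [NormedSpace ℝ Y] [NormedAddCommGroup Z]
    [NormedSpace ℝ Z] (F : X →ₗ[ℝ] Y) (G : X →ₗ[ℝ] Z) (h : ∀ x, G x = 0 → F x = 0) :
    ∃ C : ℝ, 0 < C ∧ ∀ x, ‖F x‖ ≤ C * ‖G x‖ := by
  let H : LinearMap.range G →ₗ[ℝ] Y :=
    (LinearMap.ker G).liftQ F (fun x hx => h x hx) ∘ₗ G.quotKerEquivRange.symm.toLinearMap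
  have hH : ∀ x, H ⟨G x, x, rfl⟩ = F x := by
    intro x
    have : G.quotKerEquivRange.symm ⟨G x, x, rfl⟩ = (LinearMap.ker G).mkQ x :=
      G.quotKerEquivRange_symm_apply_image x _
    change (LinearMap.ker G).liftQ F (fun x hx => h x hx) (G.quotKerEquivRange.symm ⟨G x, x, rfl⟩) = _
    rw [this]
    rfl
  refine ⟨‖H.toContinuousLinearMap‖ + 1, by positivity, fun x => ?_⟩
  rw [← hH x]
  refine (H.toContinuousLinearMap.le_opNorm _).trans ?_
  exact mul_le_mul_of_nonneg_right (by linarith) (norm_nonneg _)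

theorem norm_toLp_sq {T Y : Type*} [MeasurableSpace T] {μ : Measure T} [NormedAddCommGroup Y]
    {f : T → Y} (hf : MemLp f 2 μ) : ‖hf.toLp f‖ ^ 2 = ∫ t, ‖f t‖ ^ 2 ∂μ := by
  rw [Lp.norm_toLp, hf.eLpNorm_eq_integral_rpow_norm two_ne_zero ENNReal.ofNat_ne_top]
  have h0 : 0 ≤ ∫ t, ‖f t‖ ^ 2 ∂μ := integral_nonneg fun t => by positivity
  simp only [ENNReal.toReal_ofNat, Real.rpow_ofNat]
  rw [ENNReal.toReal_ofReal (by positivity), ← Real.rpow_natCast, ← Real.rpow_mul h0]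
  norm_num

theorem exists_integral_sq_le {T X Y Z : Type*} [MeasurableSpace T] (μ : Measure T)
    [AddCommGroup X] [Module ℝ X] [FiniteDimensional ℝ X] [NormedAddCommGroup Y] [NormedSpace ℝ Y]
    [NormedAddCommGroup Z] [NormedSpace ℝ Z] (F : X →ₗ[ℝ] T → Y) (G : X →ₗ[ℝ] T → Z)
    (hF : ∀ x, MemLp (F x) 2 μ) (hG : ∀ x, MemLp (G x) 2 μ)
    (h : ∀ x, ∫ t, ‖G x t‖ ^ 2 ∂μ = 0 → ∀ᵐ t ∂μ, F x t = 0) :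
    ∃ C : ℝ, 0 < C ∧ ∀ x, ∫ t, ‖F x t‖ ^ 2 ∂μ ≤ C * ∫ t, ‖G x t‖ ^ 2 ∂μ := by
  let F' : X →ₗ[ℝ] Lp Y 2 μ :=
    { toFun := fun x => (hF x).toLp
      map_add' := fun x y => by
        rw [← MemLp.toLp_add]
        congr 1
        exact map_add F x y
      map_smul' := fun c x => by
        rw [RingHom.id_apply, ← MemLp.toLp_const_smul]
        congr 1
        exact map_smul F c x }
  let G' : X →ₗ[ℝ] Lp Z 2 μ :=
    { toFun := fun x => (hG x).toLp
      map_add' := fun x y => by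
        rw [← MemLp.toLp_add]
        congr 1
        exact map_add G x y
      map_smul' := fun c x => by
        rw [RingHom.id_apply, ← MemLp.toLp_const_smul]
        congr 1
        exact map_smul G c x }
  obtain ⟨C, hC, hle⟩ := exists_bound_of_ker_le F' G' fun x hx => by
    have h1 := norm_toLp_sq (hG x)
    change (hG x).toLp = 0 at hx
    rw [hx, norm_zero, zero_pow two_ne_zero] at h1
    change (hF x).toLp = 0
    rw [Lp.ext_iff]
    filter_upwards [(hF x).coeFn_toLp, Lp.coeFn_zero Y 2 μ, h x h1.symm] with t h1 h2 h3
    rw [h1, h2, h3]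
    rfl
  refine ⟨C ^ 2, by positivity, fun x => ?_⟩
  rw [← norm_toLp_sq (hF x), ← norm_toLp_sq (hG x), ← mul_pow]
  exact pow_le_pow_left₀ (norm_nonneg _) (hle x) 2

end FiniteDimensional

/-! ### Interpolation pairs and their bounds on the reference simplex. -/

section Reference

variable {n k r : ℕ}

theorem IsPolyForm.differentiable {s : ℕ} {w : E n → Form n k} (h : IsPolyForm s w) :
    Differentiable ℝ w := h.contDiff.differentiable (by simp)

/-- The polynomial forms of degree at most `s`. -/
def polyForms (n k s : ℕ) : Submodule ℝ (E n → Form n k) where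
  carrier := {w | IsPolyForm s w}
  add_mem' := IsPolyForm.add
  zero_mem' := isPolyForm_const 0
  smul_mem' c _ h := h.const_smul c

instance (n k s : ℕ) : FiniteDimensional ℝ (polyForms n k s) := by
  let Φ : ((Fin k ↪o Fin n) → MvPolynomial.restrictTotalDegree (Fin n) ℝ s) →ₗ[ℝ]
      (E n → Form n k) :=
    { toFun := fun P x => ∑ σ, MvPolynomial.eval x.ofLp (P σ).1 • dx σ
      map_add' := fun P Q => by
        ext1 x
        simp [add_smul, Finset.sum_add_distrib]
      map_smul' := fun c P => by
        ext1 x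
        simp [Finset.smul_sum, mul_smul] }
  have hle : polyForms n k s ≤ LinearMap.range Φ := by
    intro w hw
    choose P hP hPw using hw
    refine ⟨fun σ => ⟨P σ, (MvPolynomial.mem_restrictTotalDegree _ _ _).2 (hP σ)⟩, ?_⟩
    rw [form_expand_fun w]
    ext1 x
    exact Finset.sum_congr rfl fun σ _ => by rw [hPw]
  exact Submodule.finiteDimensional_of_le hle

theorem FaceMoments.add {K : Set (E n)} {w w' : E n → Form n k} (hw : Continuous w)
    (hw' : Continuous w') (h : FaceMoments r K w) (h' : FaceMoments r K w') :
    FaceMoments r K fun x => w x + w' x := by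
  intro m s hms b hb hbK e he g hg
  have h1 := h m s hms b hb hbK e he g hg
  have h2 := h' m s hms b hb hbK e he g hg
  simp only [ContinuousAlternatingMap.add_apply, add_mul]
  rw [integral_add, h1, h2, add_zero]
  · exact integrableOn_unitSimplex ((continuous_apply_pt hw b _).mul hg.continuous)
  · exact integrableOn_unitSimplex ((continuous_apply_pt hw' b _).mul hg.continuous)

theorem FaceMoments.const_smul {K : Set (E n)} {w : E n → Form n k} (h : FaceMoments r K w)
    (c : ℝ) : FaceMoments r K fun x => c • w x := by
  intro m s hms b hb hbK e he g hg
  simp only [ContinuousAlternatingMap.smul_apply, smul_eq_mul, mul_assoc, integral_const_mul]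
  rw [h m s hms b hb hbK e he g hg, mul_zero]

/-- The vertices `0, e₁, …, eₙ` of the reference simplex. -/
def refVertex (n : ℕ) : Fin (n + 1) → E n := Fin.cons 0 basisVec

theorem pt_refVertex (t : Fin n → ℝ) : pt (refVertex n) (bary t) = WithLp.toLp 2 t := by
  rw [pt_bary, edgeMap_eq_sum]
  simp only [refVertex, Fin.cons_zero, Fin.cons_succ, zero_add, sub_zero]
  exact sum_coord_smul_basisVec (WithLp.toLp 2 t)

theorem edgeMap_refVertex (t : Fin n → ℝ) : edgeMap (refVertex n) t = WithLp.toLp 2 t := by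
  rw [← pt_refVertex, pt_bary]
  simp [refVertex]

theorem refVertex_injective : Function.Injective (refVertex n) := by
  refine Fin.cons_injective_iff.2 ⟨?_, ?_⟩
  · rintro ⟨i, hi⟩
    have := congrArg norm hi
    simp [norm_basisVec] at this
  · intro i j hij
    by_contra hne
    have := congrArg (fun x : E n => x i) hij
    simp [basisVec_apply, hne] at this

/-- The pairs of polynomial forms of degree at most `s`. -/
def PolyPair (n k s : ℕ) : Type := polyForms n k s × polyForms n k s

instance (n k s : ℕ) : AddCommGroup (PolyPair n k s) :=
  inferInstanceAs (AddCommGroup (polyForms n k s × polyForms n k s))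

instance (n k s : ℕ) : Module ℝ (PolyPair n k s) :=
  inferInstanceAs (Module ℝ (polyForms n k s × polyForms n k s))

instance (n k s : ℕ) : FiniteDimensional ℝ (PolyPair n k s) :=
  inferInstanceAs (FiniteDimensional ℝ (polyForms n k s × polyForms n k s))

/-- The pairs of a polynomial form and of its canonical interpolant on the reference simplex. -/
def interpPairs (n k r : ℕ) : Submodule ℝ (PolyPair n k r) where
  carrier := {z | IsTrimmedForm r z.2.1 ∧
    FaceMoments r (Set.range (refVertex n)) fun x => z.1.1 x - z.2.1 x}
  add_mem' {y z} hy hz := by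
    refine ⟨hy.1.add hz.1, ?_⟩
    have := hy.2.add (IsPolyForm.continuous (y.1 - y.2).2) (IsPolyForm.continuous (z.1 - z.2).2) hz.2
    convert this using 2
    exact add_sub_add_comm _ _ _ _
  zero_mem' := by
    refine ⟨(isPolyForm_const 0).isTrimmedForm, ?_⟩
    intro m s hms b hb hbK e he g hg
    have h0 : ∀ x, (0 : PolyPair n k r).1.1 x - (0 : PolyPair n k r).2.1 x = 0 :=
      fun x => sub_self _
    simp [h0]
  smul_mem' c z hz := by
    refine ⟨hz.1.const_smul c, ?_⟩
    convert hz.2.const_smul c using 2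
    exact (smul_sub c _ _).symm

theorem IsPolyForm.eq_zero_of_isOpen {s : ℕ} {w : E n → Form n k} (hw : IsPolyForm s w)
    (h : ∀ t ∈ unitSimplexInt n, w (WithLp.toLp 2 t) = 0) : w = 0 := by
  ext1 x
  refine form_ext fun σ => ?_
  obtain ⟨P, -, hP⟩ := hw σ
  have : P = 0 := by
    refine PolyFun.eq_zero_of_isOpen isOpen_unitSimplexInt unitSimplexInt_nonempty fun t ht => ?_
    have h1 := hP (WithLp.toLp 2 t)
    rw [comp, h t ht] at h1
    exact h1.symm
  have h2 := hP x
  rw [this, map_zero] at h2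
  exact h2

theorem IsPolyForm.eq_const_of_fderiv {s : ℕ} {w : E n → Form n k} (hw : IsPolyForm s w)
    (h : ∀ t ∈ unitSimplexInt n, fderiv ℝ w (WithLp.toLp 2 t) = 0) : ∃ w₀, w = fun _ => w₀ := by
  let U : Set (E n) := WithLp.ofLp ⁻¹' unitSimplexInt n
  have hUo : IsOpen U := isOpen_unitSimplexInt.preimage (PiLp.continuous_ofLp 2 _)
  have hUc : Convex ℝ U := by
    intro x hx y hy a b ha hb hab
    refine ⟨fun i => ?_, ?_⟩
    · have h1 := hx.1 i
      have h2 := hy.1 i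
      simp only [PiLp.add_apply, PiLp.smul_apply, smul_eq_mul]
      rcases ha.eq_or_lt with rfl | ha
      · simp_all
      · have := mul_nonneg hb h2.le
        have := mul_pos ha h1
        linarith
    · have h1 := hx.2
      have h2 := hy.2
      simp only [PiLp.add_apply, PiLp.smul_apply, smul_eq_mul, Finset.sum_add_distrib,
        ← Finset.mul_sum]
      rcases ha.eq_or_lt with rfl | ha
      · simp_all
      · have := mul_le_mul_of_nonneg_left h2.le hb
        have := mul_lt_mul_of_pos_left h1 ha
        linarith
  obtain ⟨w₀, hw₀⟩ := hUo.exists_is_const_of_fderiv_eq_zero (𝕜 := ℝ) (f := w) hUc.isPreconnected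
    hw.differentiable.differentiableOn fun x hx => h _ hx
  refine ⟨w₀, ?_⟩
  have := (hw.sub (isPolyForm_const w₀)).eq_zero_of_isOpen fun t ht =>
    sub_eq_zero.2 (hw₀ (x := WithLp.toLp 2 t) ht)
  ext1 x
  exact sub_eq_zero.1 (congrFun this x)

theorem IsTrimmedForm.eq_zero_of_faceMoments (hr : 1 ≤ r) {w : E n → Form n k}
    (hw : IsTrimmedForm r w) (h : FaceMoments r (Set.range (refVertex n)) w) : w = 0 := by
  have h1 := zeroTrace_of_faceMoments hr hw (refVertex n) refVertex_injective h
  ext x v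
  have h2 := h1 (bary x.ofLp) (sum_bary _) (fun i => bary0 (v i).ofLp) fun i => sum_bary0 _
  simp only [pt_refVertex, ← edgeMap_apply, edgeMap_refVertex] at h2
  exact h2

theorem eq_zero_of_integral_norm_sq {Y : Type*} [NormedAddCommGroup Y] {f : (Fin n → ℝ) → Y}
    (hf : Continuous f) (h : ∫ t in unitSimplex n, ‖f t‖ ^ 2 = 0) :
    ∀ t ∈ unitSimplex n, f t = 0 := by
  intro t ht
  have := eq_zero_of_integral_unitSimplex (hf.norm.pow 2) (fun t _ => sq_nonneg _) h t ht
  simpa using this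

theorem memLp_unitSimplex {Y : Type*} [NormedAddCommGroup Y] {f : (Fin n → ℝ) → Y}
    (hf : Continuous f) : MemLp f 2 (volume.restrict (unitSimplex n)) := by
  have : IsFiniteMeasure (volume.restrict (unitSimplex n)) :=
    ⟨by simpa using volume_unitSimplex_lt_top⟩
  obtain ⟨C, hC⟩ := (isCompact_unitSimplex (d := n)).exists_bound_of_continuousOn hf.continuousOn
  refine MemLp.of_bound hf.aestronglyMeasurable C ?_
  exact (ae_restrict_iff' measurableSet_unitSimplex).2 (.of_forall hC)

/-- The two sides of the norm bounds below, for `f = p', p' - p, ∇p'` and `g = p, ∇p, ∇p`. -/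
theorem interpPairs_bounds (hr : 1 ≤ r) : ∃ C : ℝ, 0 < C ∧ ∀ p p' : E n → Form n k,
    IsPolyForm r p → IsTrimmedForm r p' →
    FaceMoments r (Set.range (refVertex n)) (fun x => p x - p' x) →
    ∫ t in unitSimplex n, ‖p' (WithLp.toLp 2 t)‖ ^ 2 ≤
      C * ∫ t in unitSimplex n, ‖p (WithLp.toLp 2 t)‖ ^ 2 ∧
    ∫ t in unitSimplex n, ‖p' (WithLp.toLp 2 t) - p (WithLp.toLp 2 t)‖ ^ 2 ≤
      C * ∫ t in unitSimplex n, ‖fderiv ℝ p (WithLp.toLp 2 t)‖ ^ 2 ∧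
    ∫ t in unitSimplex n, ‖fderiv ℝ p' (WithLp.toLp 2 t)‖ ^ 2 ≤
      C * ∫ t in unitSimplex n, ‖fderiv ℝ p (WithLp.toLp 2 t)‖ ^ 2 := by
  have htoLp : Continuous (WithLp.toLp 2 : (Fin n → ℝ) → E n) := PiLp.continuous_toLp 2 _
  let V : polyForms n k r →ₗ[ℝ] (Fin n → ℝ) → Form n k :=
    { toFun := fun p t => p.1 (WithLp.toLp 2 t)
      map_add' := fun p q => rfl
      map_smul' := fun c p => rfl }
  let D : polyForms n k r →ₗ[ℝ] (Fin n → ℝ) → E n →L[ℝ] Form n k :=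
    { toFun := fun p t => fderiv ℝ p.1 (WithLp.toLp 2 t)
      map_add' := fun p q => by
        ext1 t
        exact fderiv_add (IsPolyForm.differentiable p.2).differentiableAt
          (IsPolyForm.differentiable q.2).differentiableAt
      map_smul' := fun c p => by
        ext1 t
        exact fderiv_const_smul (IsPolyForm.differentiable p.2).differentiableAt c }
  have hVc : ∀ p, Continuous (V p) := fun p => (IsPolyForm.continuous p.2).comp htoLp
  have hDc : ∀ p, Continuous (D p) := fun p =>
    ((IsPolyForm.contDiff p.2).continuous_fderiv (by simp)).comp htoLp
  let P : interpPairs n k r →ₗ[ℝ] polyForms n k r :=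
    { toFun := fun z => z.1.1
      map_add' := fun _ _ => rfl
      map_smul' := fun _ _ => rfl }
  let P' : interpPairs n k r →ₗ[ℝ] polyForms n k r :=
    { toFun := fun z => z.1.2
      map_add' := fun _ _ => rfl
      map_smul' := fun _ _ => rfl }
  -- Constant forms are trimmed, so unisolvence shows that they are reproduced by the interpolation.
  -- This supplies all three kernel conditions below.
  have hconst : ∀ z : interpPairs n k r, (∃ w₀, (P z).1 = fun _ => w₀) → (P' z).1 = (P z).1 := by
    rintro z ⟨w₀, hw₀⟩
    have h1 : IsTrimmedForm r (P z).1 := by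
      rw [hw₀]
      exact (isPolyForm_const w₀).isTrimmedForm
    have h2 := (h1.sub z.2.1).eq_zero_of_faceMoments hr z.2.2
    ext1 x
    exact (sub_eq_zero.1 (congrFun h2 x)).symm
  have hD0 : ∀ z : interpPairs n k r, ∫ t in unitSimplex n, ‖D (P z) t‖ ^ 2 = 0 →
      ∃ w₀, (P z).1 = fun _ => w₀ := fun z hz =>
    IsPolyForm.eq_const_of_fderiv (P z).2 fun t ht =>
      eq_zero_of_integral_norm_sq (f := D (P z)) (hDc _) hz t (unitSimplexInt_subset ht)
  obtain ⟨C₁, hC₁, h₁⟩ := exists_integral_sq_le (volume.restrict (unitSimplex n)) (V ∘ₗ P')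
    (V ∘ₗ P) (fun z => memLp_unitSimplex (hVc _)) (fun z => memLp_unitSimplex (hVc _))
    fun z hz => by
      have h1 : (P z).1 = 0 := IsPolyForm.eq_zero_of_isOpen (P z).2 fun t ht =>
        eq_zero_of_integral_norm_sq (f := V (P z)) (hVc _) hz t (unitSimplexInt_subset ht)
      refine .of_forall fun t => ?_
      change (P' z).1 _ = 0
      rw [hconst z ⟨0, h1⟩, h1]
      rfl
  let DP : interpPairs n k r →ₗ[ℝ] (Fin n → ℝ) → E n →L[ℝ] Form n k := D ∘ₗ P
  let W : interpPairs n k r →ₗ[ℝ] (Fin n → ℝ) → Form n k := V ∘ₗ P' - V ∘ₗ P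
  obtain ⟨C₂, hC₂, h₂⟩ := exists_integral_sq_le (Z := E n →L[ℝ] Form n k)
    (volume.restrict (unitSimplex n)) W DP (fun z => memLp_unitSimplex ((hVc (P' z)).sub (hVc (P z))))
    (fun z => memLp_unitSimplex (hDc (P z))) fun z hz => by
      refine .of_forall fun t => ?_
      change (P' z).1 _ - (P z).1 _ = 0
      rw [hconst z (hD0 z hz), sub_self]
  obtain ⟨C₃, hC₃, h₃⟩ := exists_integral_sq_le (Y := E n →L[ℝ] Form n k)
    (Z := E n →L[ℝ] Form n k) (volume.restrict (unitSimplex n)) (D ∘ₗ P') DP (fun z => memLp_unitSimplex (hDc (P' z)))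
    (fun z => memLp_unitSimplex (hDc (P z))) fun z hz => by
      refine .of_forall fun t => ?_
      change fderiv ℝ (P' z).1 _ = 0
      obtain ⟨w₀, hw₀⟩ := hD0 z hz
      rw [hconst z ⟨w₀, hw₀⟩, hw₀, fderiv_fun_const]
      rfl
  refine ⟨C₁ + C₂ + C₃, by positivity, fun p p' hp hp' hpp => ?_⟩
  let z : interpPairs n k r := ⟨(⟨p, hp⟩, ⟨p', hp'.isPolyForm hr⟩), hp', hpp⟩
  refine ⟨(h₁ z).trans ?_, (h₂ z).trans ?_, (h₃ z).trans ?_⟩ <;>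
  · refine mul_le_mul_of_nonneg_right (by linarith) (integral_nonneg fun t => sq_nonneg _)

end Reference

/-! ### Norm bounds on an element -/

section Scaling

variable {n k r : ℕ}

theorem mem_convexHull_range_iff {m : ℕ} {a : Fin m → E n} {x : E n} :
    x ∈ convexHull ℝ (Set.range a) ↔ ∃ c : Fin m → ℝ, (∀ j, 0 ≤ c j) ∧ ∑ j, c j = 1 ∧ pt a c = x := by
  constructor
  · intro hx
    have : convexHull ℝ (Set.range a) ⊆
        {x | ∃ c : Fin m → ℝ, (∀ j, 0 ≤ c j) ∧ ∑ j, c j = 1 ∧ pt a c = x} := by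
      refine convexHull_min ?_ ?_
      · rintro _ ⟨j, rfl⟩
        exact ⟨Pi.single j 1, fun i => by rw [Pi.single_apply]; split_ifs <;> simp,
          by simp, pt_single a j⟩
      · rintro _ ⟨c, hc, hc1, rfl⟩ _ ⟨c', hc', hc1', rfl⟩ s t hs ht hst
        refine ⟨s • c + t • c', fun j => ?_, ?_, by simp⟩
        · have := mul_nonneg hs (hc j)
          have := mul_nonneg ht (hc' j)
          simp only [Pi.add_apply, Pi.smul_apply, smul_eq_mul]
          linarith
        · simp [Finset.sum_add_distrib, ← Finset.mul_sum, hc1, hc1', hst]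
    exact this hx
  · rintro ⟨c, hc, hc1, rfl⟩
    exact (convex_convexHull ℝ _).sum_mem (fun j _ => hc j) hc1
      fun j _ => subset_convexHull ℝ _ ⟨j, rfl⟩

theorem pt_bary_mem_iff {d : ℕ} {a : Fin (d + 1) → E n} (ha : AffineIndependent ℝ a)
    (t : Fin d → ℝ) : pt a (bary t) ∈ convexHull ℝ (Set.range a) ↔ t ∈ unitSimplex d := by
  rw [mem_convexHull_range_iff, mem_unitSimplex_iff]
  constructor
  · rintro ⟨c, hc, hc1, hct⟩
    have : c = bary t := by
      rw [← sub_eq_zero]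
      refine affineIndependent_pt_eq_zero ha ?_ ?_
      · simp [hc1, sum_bary]
      · rw [map_sub, hct, sub_self]
    rwa [← this]
  · exact fun h => ⟨_, h, sum_bary t, rfl⟩

theorem norm_pullback_le (x : E n) (B : E n →L[ℝ] E n) (w : E n → Form n k) (y : E n) :
    ‖pullback x B w y‖ ≤ ‖B‖ ^ k * ‖w (x + B y)‖ := by
  have := (w (x + B y)).norm_compContinuousLinearMap_le B
  rw [Fintype.card_fin, mul_comm] at this
  exact this

theorem norm_fderiv_pullback_le (x : E n) (B : E n →L[ℝ] E n) {w : E n → Form n k}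
    (hw : Differentiable ℝ w) (y : E n) :
    ‖fderiv ℝ (pullback x B w) y‖ ≤ ‖B‖ ^ (k + 1) * ‖fderiv ℝ w (x + B y)‖ := by
  let Φ : Form n k →L[ℝ] Form n k := ContinuousAlternatingMap.compContinuousLinearMapCLM B
  have h1 : HasFDerivAt (fun y => x + B y) B y := B.hasFDerivAt.const_add x
  have h2 : HasFDerivAt (pullback x B w) (Φ ∘L (fderiv ℝ w (x + B y) ∘L B)) y :=
    Φ.hasFDerivAt.comp y ((hw (x + B y)).hasFDerivAt.comp y h1)
  rw [h2.fderiv]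
  refine ContinuousLinearMap.opNorm_le_bound _ (by positivity) fun u => ?_
  calc ‖(fderiv ℝ w (x + B y) (B u)).compContinuousLinearMap B‖
      ≤ ‖fderiv ℝ w (x + B y) (B u)‖ * ‖B‖ ^ k := by
        have := (fderiv ℝ w (x + B y) (B u)).norm_compContinuousLinearMap_le B
        rwa [Fintype.card_fin] at this
    _ ≤ (‖fderiv ℝ w (x + B y)‖ * (‖B‖ * ‖u‖)) * ‖B‖ ^ k := by
        gcongr
        exact (ContinuousLinearMap.le_opNorm _ _).trans (by gcongr; exact B.le_opNorm u)
    _ = _ := by ring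

theorem exists_affineEquiv {A : Fin (n + 1) → E n} (hA : AffineIndependent ℝ A) :
    ∃ B : E n ≃L[ℝ] E n, ∀ t, B (WithLp.toLp 2 t) = edgeMap A t := by
  have hinj : Function.Injective (edgeMap A ∘ₗ ofLpL n) := by
    intro x y hxy
    have := edgeMap_injective hA hxy
    rw [ofLpL_apply, ofLpL_apply] at this
    exact WithLp.ofLp_injective 2 this
  refine ⟨(LinearEquiv.ofInjectiveEndo _ hinj).toContinuousLinearEquiv, fun t => ?_⟩
  change edgeMap A (ofLpL n _) = _
  rw [ofLpL_apply]

theorem map_refVertex {A : Fin (n + 1) → E n} {B : E n ≃L[ℝ] E n}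
    (hB : ∀ t, B (WithLp.toLp 2 t) = edgeMap A t) (j : Fin (n + 1)) :
    B (refVertex n j) = A j - A 0 := by
  refine Fin.cases ?_ (fun i => ?_) j
  · simp [refVertex]
  · rw [← edgeMap_single, ← hB]
    simp [refVertex, basisVec]

/-- The affine map carries faces to faces with the same barycentric coordinates, so each moment of
the pullback is a moment of `w` on the image face. -/
theorem FaceMoments.pullback {A : Fin (n + 1) → E n} (hA : Function.Injective A) {B : E n ≃L[ℝ] E n}
    (hB : ∀ t, B (WithLp.toLp 2 t) = edgeMap A t) {w : E n → Form n k}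
    (h : FaceMoments r (Set.range A) w) :
    FaceMoments r (Set.range (refVertex n)) (pullback (A 0) B w) := by
  intro m s hms b hb hbK
  choose J hJ using hbK
  have hJi : Function.Injective J := fun i j hij => hb (by rw [← hJ, ← hJ, hij])
  have hpt : ∀ c, B (pt b c) = pt (A ∘ J) c - (∑ j, c j) • A 0 := by
    intro c
    simp only [pt_apply, map_sum, map_smul, ← hJ, map_refVertex hB, smul_sub,
      Finset.sum_sub_distrib, Finset.sum_smul]
    rfl
  have h1 := h m s hms (A ∘ J) (hA.comp hJi) fun i => ⟨J i, rfl⟩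
  intro e he g hg
  rw [← h1 e he g hg]
  simp only [pullback_apply]
  refine integral_congr_ae (.of_forall fun t => ?_)
  simp [hpt, sum_bary, he]

theorem isClosed_convexHull_range {m : ℕ} (A : Fin m → E n) :
    IsClosed (convexHull ℝ (Set.range A)) := (Set.finite_range A).isClosed_convexHull (𝕜 := ℝ)

theorem exists_integral_simplex {A : Fin (n + 1) → E n} (hA : AffineIndependent ℝ A) :
    ∃ c : ℝ, 0 < c ∧ ∀ f : E n → ℝ, ∫ x in convexHull ℝ (Set.range A), f x =
      c * ∫ t in unitSimplex n, f (pt A (bary t)) := by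
  obtain ⟨B, hB⟩ := exists_affineEquiv hA
  obtain ⟨c, hc, h, -⟩ := exists_integral_affine (volume : Measure (Fin n → ℝ))
    (volume : Measure (E n)) ((EuclideanSpace.equiv (Fin n) ℝ).symm.trans B) (A 0)
  refine ⟨c, hc, fun f => ?_⟩
  have h1 : ∀ t, A 0 + ((EuclideanSpace.equiv (Fin n) ℝ).symm.trans B) t = pt A (bary t) := by
    intro t
    rw [pt_bary, ← hB]
    rfl
  have h2 := h f (convexHull ℝ (Set.range A))
    (isClosed_convexHull_range A).measurableSet
  simp only [h1] at h2
  have h3 : (fun t => pt A (bary t)) ⁻¹' convexHull ℝ (Set.range A) = unitSimplex n := by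
    ext t
    exact pt_bary_mem_iff hA t
  rwa [h3] at h2

theorem norm_affineEquiv_le {A : Fin (n + 1) → E n} {B : E n ≃L[ℝ] E n}
    (hB : ∀ t, B (WithLp.toLp 2 t) = edgeMap A t) {h : ℝ} (h0 : 0 ≤ h)
    (hA : ∀ i j, dist (A i) (A j) ≤ h) : ‖(B : E n →L[ℝ] E n)‖ ≤ n * h := by
  refine ContinuousLinearMap.opNorm_le_bound _ (by positivity) fun u => ?_
  have h1 : B u = ∑ i, u i • (A i.succ - A 0) := by
    rw [← edgeMap_eq_sum, ← hB]
  calc ‖B u‖ ≤ ∑ i, ‖u i • (A i.succ - A 0)‖ := h1 ▸ norm_sum_le _ _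
    _ ≤ ∑ _i : Fin n, ‖u‖ * h := by
        refine Finset.sum_le_sum fun i _ => ?_
        rw [norm_smul, ← dist_eq_norm]
        exact mul_le_mul (PiLp.norm_apply_le u i) (hA _ _) dist_nonneg (norm_nonneg _)
    _ = n * h * ‖u‖ := by simp; ring

theorem norm_toLp_le_one {t : Fin n → ℝ} (ht : t ∈ unitSimplex n) :
    ‖(WithLp.toLp 2 t : E n)‖ ≤ 1 := by
  rw [← sum_coord_smul_basisVec (WithLp.toLp 2 t)]
  refine (norm_sum_le _ _).trans (le_trans (le_of_eq ?_) ht.2)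
  refine Finset.sum_congr rfl fun i _ => ?_
  rw [norm_smul, norm_basisVec, mul_one, Real.norm_of_nonneg (ht.1 i)]

/-- The inverse map sends the element, translated by `A 0`, into the unit ball. For a unit vector
`u`, the centre `x₀` and the point `x₀ + (ρ/2) u` of the open ball have images at distance at most
`2`. -/
theorem norm_affineEquiv_symm_le {A : Fin (n + 1) → E n} {B : E n ≃L[ℝ] E n}
    (hB : ∀ t, B (WithLp.toLp 2 t) = edgeMap A t) {x₀ : E n} {ρ : ℝ} (hρ : 0 < ρ)
    (hball : Metric.ball x₀ ρ ⊆ convexHull ℝ (Set.range A)) :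
    ‖(B.symm : E n →L[ℝ] E n)‖ ≤ 4 / ρ := by
  have key : ∀ x ∈ convexHull ℝ (Set.range A), ‖B.symm (x - A 0)‖ ≤ 1 := by
    intro x hx
    obtain ⟨c, hc, hc1, rfl⟩ := mem_convexHull_range_iff.1 hx
    have h1 : B (WithLp.toLp 2 (Fin.tail c)) = pt A c - A 0 := by
      rw [hB, eq_sub_iff_add_eq', ← pt_bary, bary_tail hc1]
    rw [← h1, ContinuousLinearEquiv.symm_apply_apply]
    refine norm_toLp_le_one (mem_unitSimplex_iff.2 ?_)
    rwa [bary_tail hc1]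
  refine ContinuousLinearMap.opNorm_le_of_unit_norm (by positivity) fun u hu => ?_
  have h1 := key x₀ (hball (Metric.mem_ball_self hρ))
  have h2 := key (x₀ + (ρ / 2) • u) (hball (by
    rw [Metric.mem_ball, dist_eq_norm, add_sub_cancel_left, norm_smul, hu, mul_one,
      Real.norm_of_nonneg (by positivity)]
    linarith))
  have h3 : (ρ / 2) • B.symm u = B.symm (x₀ + (ρ / 2) • u - A 0) - B.symm (x₀ - A 0) := by
    rw [← map_sub, ← map_smul]
    congr 1
    abel
  have h4 : ρ / 2 * ‖B.symm u‖ ≤ 2 := by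
    have := norm_sub_le (B.symm (x₀ + (ρ / 2) • u - A 0)) (B.symm (x₀ - A 0))
    rw [← h3, norm_smul, Real.norm_of_nonneg (by positivity)] at this
    linarith
  rw [le_div_iff₀ hρ]
  change ‖B.symm u‖ * ρ ≤ 4
  linarith

/-- Transfer of an estimate from the reference simplex: `g'` is the pulled-back datum, `f'` the
quantity bounded there, and `b` and `β` are the costs of the pullback and of the return. -/
theorem integral_sq_chain {Y Z Y' Z' : Type*} [NormedAddCommGroup Y] [NormedAddCommGroup Z]
    [NormedAddCommGroup Y'] [NormedAddCommGroup Z'] {f : (Fin n → ℝ) → Y} {f' : (Fin n → ℝ) → Y'}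
    {g : (Fin n → ℝ) → Z} {g' : (Fin n → ℝ) → Z'} (hf : Continuous f) (hf' : Continuous f')
    (hg : Continuous g) (hg' : Continuous g') {b β C D : ℝ} (hb : 0 ≤ b) (hβ : 0 ≤ β) (hC : 0 ≤ C)
    (hff : ∀ t, ‖f t‖ ≤ β * ‖f' t‖) (hgg : ∀ t, ‖g' t‖ ≤ b * ‖g t‖)
    (h : ∫ t in unitSimplex n, ‖f' t‖ ^ 2 ≤ C * ∫ t in unitSimplex n, ‖g' t‖ ^ 2)
    (hD : β * b ≤ D) :
    ∫ t in unitSimplex n, ‖f t‖ ^ 2 ≤ C * D ^ 2 * ∫ t in unitSimplex n, ‖g t‖ ^ 2 := by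
  have h1 : ∫ t in unitSimplex n, ‖f t‖ ^ 2 ≤ β ^ 2 * ∫ t in unitSimplex n, ‖f' t‖ ^ 2 := by
    rw [← integral_const_mul]
    refine integral_mono (integrableOn_unitSimplex (hf.norm.pow 2))
      (integrableOn_unitSimplex ((hf'.norm.pow 2).const_mul _)) fun t => ?_
    rw [← mul_pow]
    exact pow_le_pow_left₀ (norm_nonneg _) (hff t) 2
  have h2 : ∫ t in unitSimplex n, ‖g' t‖ ^ 2 ≤ b ^ 2 * ∫ t in unitSimplex n, ‖g t‖ ^ 2 := by
    rw [← integral_const_mul]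
    refine integral_mono (integrableOn_unitSimplex (hg'.norm.pow 2))
      (integrableOn_unitSimplex ((hg.norm.pow 2).const_mul _)) fun t => ?_
    rw [← mul_pow]
    exact pow_le_pow_left₀ (norm_nonneg _) (hgg t) 2
  have h3 : 0 ≤ ∫ t in unitSimplex n, ‖g t‖ ^ 2 := integral_nonneg fun t => sq_nonneg _
  calc ∫ t in unitSimplex n, ‖f t‖ ^ 2
      ≤ β ^ 2 * (C * (b ^ 2 * ∫ t in unitSimplex n, ‖g t‖ ^ 2)) := by
        refine h1.trans (mul_le_mul_of_nonneg_left (h.trans ?_) (sq_nonneg _))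
        exact mul_le_mul_of_nonneg_left h2 hC
    _ = C * (β * b) ^ 2 * ∫ t in unitSimplex n, ‖g t‖ ^ 2 := by ring
    _ ≤ _ := by gcongr

/-- The bounds for the canonical interpolant on a shape-regular simplex. -/
theorem exists_element_bounds (n k : ℕ) (hr : 1 ≤ r) (σ : ℝ) : ∃ C : ℝ, 0 < C ∧
    ∀ (A : Fin (n + 1) → E n) (x₀ : E n) (ρ h : ℝ), AffineIndependent ℝ A → 0 < ρ →
      Metric.ball x₀ ρ ⊆ convexHull ℝ (Set.range A) → (∀ i j, dist (A i) (A j) ≤ h) → h ≤ σ * ρ →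
      ∀ p p' : E n → Form n k, IsPolyForm r p → IsTrimmedForm r p' →
        FaceMoments r (Set.range A) (fun x => p x - p' x) →
        ∫ x in convexHull ℝ (Set.range A), ‖p' x‖ ^ 2 ≤
          C * ∫ x in convexHull ℝ (Set.range A), ‖p x‖ ^ 2 ∧
        ∫ x in convexHull ℝ (Set.range A), ‖p' x - p x‖ ^ 2 ≤
          C * h ^ 2 * ∫ x in convexHull ℝ (Set.range A), ‖fderiv ℝ p x‖ ^ 2 ∧
        ∫ x in convexHull ℝ (Set.range A), ‖fderiv ℝ p' x‖ ^ 2 ≤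
          C * ∫ x in convexHull ℝ (Set.range A), ‖fderiv ℝ p x‖ ^ 2 := by
  obtain ⟨C, hC, hbounds⟩ := interpPairs_bounds (n := n) (k := k) hr
  -- Bounds `‖B⁻¹‖ ‖B‖` through `‖B‖ ≤ n h`, `‖B⁻¹‖ ≤ 4 / ρ` and `h ≤ σ ρ`. The absolute value is
  -- there because the constant is chosen before any element shows that `σ ≥ 0`.
  let D : ℝ := 4 * n * |σ|
  have hD : 0 ≤ D := by positivity
  refine ⟨C * (D ^ k) ^ 2 + C * (D ^ k * n) ^ 2 + C * (D ^ (k + 1)) ^ 2 + 1, by positivity,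
    fun A x₀ ρ h hA hρ hball hdist hσ p p' hp hp' hpp => ?_⟩
  obtain ⟨B, hB⟩ := exists_affineEquiv hA
  have h0 : 0 ≤ h := dist_nonneg.trans (hdist 0 0)
  have hb := norm_affineEquiv_le hB h0 hdist
  have hβ := norm_affineEquiv_symm_le hB hρ hball
  set B₁ : E n →L[ℝ] E n := (B : E n →L[ℝ] E n) with hB₁
  set B₂ : E n →L[ℝ] E n := (B.symm : E n →L[ℝ] E n) with hB₂
  have hβb : ‖B₂‖ * ‖B₁‖ ≤ D := by
    calc ‖B₂‖ * ‖B₁‖ ≤ 4 / ρ * (n * h) := by gcongr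
      _ ≤ 4 / ρ * (n * (|σ| * ρ)) := by
          gcongr
          exact hσ.trans (mul_le_mul_of_nonneg_right (le_abs_self σ) hρ.le)
      _ = D := by simp only [D]; field_simp
  let P := pullback (A 0) B₁ p
  let P' := pullback (A 0) B₁ p'
  have hP : IsPolyForm r P := hp.pullback _ _
  have hP't : IsTrimmedForm r P' := hp'.pullback _ _
  have hP' : IsPolyForm r P' := hP't.isPolyForm hr
  have hp'' : IsPolyForm r p' := hp'.isPolyForm hr
  have hinv : ∀ w : E n → Form n k,
      w = pullback (-B.symm (A 0)) B₂ (pullback (A 0) B₁ w) := by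
    intro w
    ext x v
    simp only [pullback_apply, hB₁, hB₂, ContinuousLinearEquiv.coe_coe, map_add, map_neg,
      ContinuousLinearEquiv.apply_symm_apply, add_neg_cancel_left]
  have hx : ∀ t, A 0 + B₁ (WithLp.toLp 2 t) = pt A (bary t) := by
    intro t
    rw [pt_bary, ← hB]
    rfl
  have hy : ∀ t, -B.symm (A 0) + B₂ (pt A (bary t)) = WithLp.toLp 2 t := by
    intro t
    rw [← hx, map_add]
    simp [hB₁, hB₂]
  have hFM : FaceMoments r (Set.range (refVertex n)) fun x => P x - P' x :=
    hpp.pullback hA.injective hB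
  obtain ⟨h₁, h₂, h₃⟩ := hbounds P P' hP hP't hFM
  have htoLp : Continuous (WithLp.toLp 2 : (Fin n → ℝ) → E n) := PiLp.continuous_toLp 2 _
  have hval : ∀ (w : E n → Form n k) t, ‖w (pt A (bary t))‖ ≤
      ‖B₂‖ ^ k * ‖pullback (A 0) B₁ w (WithLp.toLp 2 t)‖ := by
    intro w t
    have := norm_pullback_le (-B.symm (A 0)) B₂ (pullback (A 0) B₁ w) (pt A (bary t))
    rwa [← hinv, hy] at this
  have hval' : ∀ (w : E n → Form n k) t, ‖pullback (A 0) B₁ w (WithLp.toLp 2 t)‖ ≤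
      ‖B₁‖ ^ k * ‖w (pt A (bary t))‖ := by
    intro w t
    have := norm_pullback_le (A 0) B₁ w (WithLp.toLp 2 t)
    rwa [hx] at this
  have hder : ∀ t, ‖fderiv ℝ p' (pt A (bary t))‖ ≤
      ‖B₂‖ ^ (k + 1) * ‖fderiv ℝ P' (WithLp.toLp 2 t)‖ := by
    intro t
    have := norm_fderiv_pullback_le (-B.symm (A 0)) B₂ hP'.differentiable (pt A (bary t))
    rwa [← hinv, hy] at this
  have hder' : ∀ t, ‖fderiv ℝ P (WithLp.toLp 2 t)‖ ≤
      ‖B₁‖ ^ (k + 1) * ‖fderiv ℝ p (pt A (bary t))‖ := by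
    intro t
    have := norm_fderiv_pullback_le (A 0) B₁ hp.differentiable (WithLp.toLp 2 t)
    rwa [hx] at this
  have hcA := continuous_pt_bary A
  have hcf : ∀ {w : E n → Form n k}, IsPolyForm r w → Continuous (fderiv ℝ w) :=
    fun hw => hw.contDiff.continuous_fderiv (by simp)
  have e₁ := integral_sq_chain (hp''.continuous.comp hcA) (hP'.continuous.comp htoLp)
    (hp.continuous.comp hcA) (hP.continuous.comp htoLp) (by positivity) (by positivity) hC.le
    (hval p') (hval' p) h₁ (D := D ^ k)
    (by rw [← mul_pow]; exact pow_le_pow_left₀ (by positivity) hβb k)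
  -- The derivative of `p` pulls back with `k + 1` factors `‖B‖`, while the value of `p' - p`
  -- returns with only `k` factors `‖B⁻¹‖`; the unmatched factor is the power of `h`.
  have e₂ := integral_sq_chain (Y := Form n k) (Y' := Form n k) (Z := E n →L[ℝ] Form n k)
    (Z' := E n →L[ℝ] Form n k) (g := fun t => fderiv ℝ p (pt A (bary t)))
    (g' := fun t => fderiv ℝ P (WithLp.toLp 2 t)) ((hp''.sub hp).continuous.comp hcA)
    ((hP'.sub hP).continuous.comp htoLp) (by exact (hcf hp).comp hcA) (by exact (hcf hP).comp htoLp)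
    (by positivity) (by positivity) hC.le (hval fun x => p' x - p x) hder' h₂
    (D := D ^ k * (n * h)) (by
      rw [pow_succ, ← mul_assoc, ← mul_pow]
      exact mul_le_mul (pow_le_pow_left₀ (by positivity) hβb k) hb (by positivity) (by positivity))
  have e₃ := integral_sq_chain (Y := E n →L[ℝ] Form n k) (Y' := E n →L[ℝ] Form n k)
    (Z := E n →L[ℝ] Form n k) (Z' := E n →L[ℝ] Form n k)
    (f := fun t => fderiv ℝ p' (pt A (bary t))) (f' := fun t => fderiv ℝ P' (WithLp.toLp 2 t))
    (g := fun t => fderiv ℝ p (pt A (bary t)))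
    (g' := fun t => fderiv ℝ P (WithLp.toLp 2 t)) (by exact (hcf hp'').comp hcA) (by exact (hcf hP').comp htoLp)
    (by exact (hcf hp).comp hcA) (by exact (hcf hP).comp htoLp) (by positivity) (by positivity) hC.le
    hder hder' h₃ (D := D ^ (k + 1))
    (by rw [← mul_pow]; exact pow_le_pow_left₀ (by positivity) hβb (k + 1))
  -- The Jacobian `c` multiplies both sides of each estimate.
  obtain ⟨c, hc, hcint⟩ := exists_integral_simplex hA
  simp only [hcint]
  have hnn : ∀ {Y : Type} [NormedAddCommGroup Y] (f : (Fin n → ℝ) → Y),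
      0 ≤ ∫ t in unitSimplex n, ‖f t‖ ^ 2 := fun f => integral_nonneg fun t => sq_nonneg _
  have a₁ : 0 ≤ C * (D ^ k) ^ 2 := by positivity
  have a₂ : 0 ≤ C * (D ^ k * n) ^ 2 := by positivity
  have a₃ : 0 ≤ C * (D ^ (k + 1)) ^ 2 := by positivity
  refine ⟨?_, ?_, ?_⟩
  · rw [mul_left_comm]
    refine mul_le_mul_of_nonneg_left (e₁.trans ?_) hc.le
    exact mul_le_mul_of_nonneg_right (by linarith) (hnn _)
  · rw [mul_left_comm]
    refine mul_le_mul_of_nonneg_left (e₂.trans ?_) hc.le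
    refine mul_le_mul_of_nonneg_right ?_ (hnn _)
    rw [← mul_assoc (D ^ k), mul_pow (D ^ k * n) h, ← mul_assoc]
    exact mul_le_mul_of_nonneg_right (by linarith) (sq_nonneg h)
  · rw [mul_left_comm]
    refine mul_le_mul_of_nonneg_left (e₃.trans ?_) hc.le
    exact mul_le_mul_of_nonneg_right (by linarith) (hnn _)

end Scaling

/-! ### Meshes -/

section Mesh

variable {n k r d : ℕ} {Ω : Set (E n)} {T : Finset (Finset (E n))}

theorem IsMesh.exists_vertices (hT : IsMesh Ω T) {K : Finset (E n)} (hK : K ∈ T) :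
    ∃ A : Fin (n + 1) → E n, AffineIndependent ℝ A ∧ Set.range A = K := by
  have e : Fin (n + 1) ≃ K := (Fintype.equivFinOfCardEq (by simpa using hT.card_eq K hK)).symm
  refine ⟨fun i => e i, (hT.affineIndependent K hK).comp_embedding e.toEmbedding, ?_⟩
  ext x
  constructor
  · rintro ⟨i, rfl⟩
    exact (e i).2
  · intro hx
    exact ⟨e.symm ⟨x, hx⟩, by simp⟩

theorem isClosed_simplex (K : Finset (E n)) : IsClosed (simplex K) :=
  K.finite_toSet.isClosed_convexHull (𝕜 := ℝ)

theorem isCompact_simplex (K : Finset (E n)) : IsCompact (simplex K) :=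
  K.finite_toSet.isCompact_convexHull (𝕜 := ℝ)

theorem measurableSet_simplex (K : Finset (E n)) : MeasurableSet (simplex K) :=
  (isClosed_simplex K).measurableSet

theorem volume_simplex_lt_top (K : Finset (E n)) : volume (simplex K) < ⊤ :=
  (isCompact_simplex K).measure_lt_top

theorem integrableOn_simplex {F : Type*} [NormedAddCommGroup F] {f : E n → F}
    (hf : Continuous f) (K : Finset (E n)) : IntegrableOn f (simplex K) :=
  hf.continuousOn.integrableOn_compact (isCompact_simplex K)

theorem IsMesh.affineSpan_eq_top (hT : IsMesh Ω T) {K : Finset (E n)} (hK : K ∈ T) :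
    affineSpan ℝ (K : Set (E n)) = ⊤ := by
  have h := (hT.affineIndependent K hK).affineSpan_eq_top_iff_card_eq_finrank_add_one.2
    (by simp [hT.card_eq K hK])
  have h' : Set.range (fun a : K => (a : E n)) = K := Subtype.range_coe
  rwa [h'] at h

theorem IsMesh.interior_simplex_nonempty (hT : IsMesh Ω T) {K : Finset (E n)} (hK : K ∈ T) :
    (interior (simplex K)).Nonempty :=
  interior_convexHull_nonempty_iff_affineSpan_eq_top.2 (hT.affineSpan_eq_top hK)

theorem IsMesh.closure_interior_simplex (hT : IsMesh Ω T) {K : Finset (E n)} (hK : K ∈ T) :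
    closure (interior (simplex K)) = simplex K := by
  have h : Convex ℝ (simplex K) := convex_convexHull ℝ _
  rw [h.closure_interior_eq_closure_of_nonempty_interior (hT.interior_simplex_nonempty hK)]
  exact (isClosed_simplex K).closure_eq

/-- The intersection is the hull of the common vertices. Some vertex of `K` is not among them, and
by affine independence it lies outside their affine span, which is therefore a proper subspace and
null. -/
theorem IsMesh.aedisjoint (hT : IsMesh Ω T) {K L : Finset (E n)} (hK : K ∈ T) (hL : L ∈ T)
    (hKL : K ≠ L) : volume (simplex K ∩ simplex L) = 0 := by
  rw [hT.conforming K hK L hL]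
  obtain ⟨a, haK, haL⟩ : ∃ a ∈ K, a ∉ L := by
    by_contra hcon
    push Not at hcon
    exact hKL (Finset.eq_of_subset_of_card_le hcon (by rw [hT.card_eq K hK, hT.card_eq L hL]))
  have h1 : a ∉ affineSpan ℝ ((K : Set (E n)) ∩ L) := by
    intro ha
    have h2 := (hT.affineIndependent K hK).notMem_affineSpan_sdiff ⟨a, haK⟩ Set.univ
    refine h2 (affineSpan_mono ℝ ?_ ha)
    rintro x ⟨hxK, hxL⟩
    refine ⟨⟨x, hxK⟩, ⟨trivial, ?_⟩, rfl⟩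
    rintro h
    have : x = a := congrArg Subtype.val h
    exact haL (this ▸ hxL)
  refine measure_mono_null (convexHull_subset_affineSpan _)
    (Measure.addHaar_affineSubspace volume _ fun h => h1 ?_)
  rw [h]
  exact AffineSubspace.mem_top ℝ (E n) a

theorem IsMesh.isOpen (hΩ : interior (closure Ω) = Ω) : IsOpen Ω := hΩ ▸ isOpen_interior

theorem IsMesh.interior_simplex_subset (hT : IsMesh Ω T) (hΩ : interior (closure Ω) = Ω)
    {K : Finset (E n)} (hK : K ∈ T) : interior (simplex K) ⊆ Ω := by
  rw [← hΩ, ← hT.cover]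
  exact interior_mono (Set.subset_biUnion_of_mem (u := fun K : Finset (E n) => simplex K) hK)

/-- Since `Ω = int (closure Ω)`, the interiors of the elements lie in `Ω`. So `closure Ω \ Ω` is
contained in the boundaries of finitely many convex sets and is null, as are the overlaps of
elements. -/
theorem IsMesh.restrict_eq (hT : IsMesh Ω T) (hΩ : interior (closure Ω) = Ω) :
    volume.restrict Ω = ∑ K ∈ T, volume.restrict (simplex K) := by
  have h1 : volume.restrict Ω = volume.restrict (⋃ K : T, simplex K.1) := by
    refine Measure.restrict_congr_set ?_
    have h2 : ⋃ K : T, simplex K.1 = closure Ω := by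
      rw [← hT.cover, Set.iUnion_subtype]
    rw [h2]
    refine subset_closure.eventuallyLE.antisymm (ae_le_set.2 ?_)
    have h3 : closure Ω \ Ω ⊆ ⋃ K ∈ T, frontier (simplex K) := by
      rintro x ⟨hx, hxΩ⟩
      rw [← hT.cover] at hx
      obtain ⟨K, hK, hxK⟩ := Set.mem_iUnion₂.1 hx
      refine Set.mem_iUnion₂.2 ⟨K, hK, ?_⟩
      rw [(isClosed_simplex K).frontier_eq]
      exact ⟨hxK, fun hi => hxΩ (hT.interior_simplex_subset hΩ hK hi)⟩
    refine measure_mono_null h3 ((measure_biUnion_null_iff T.countable_toSet).2 fun K _ => ?_)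
    exact (convex_convexHull ℝ _).addHaar_frontier _
  rw [h1, Measure.restrict_iUnion_ae, Measure.sum_fintype,
    Finset.sum_coe_sort T fun K => volume.restrict (simplex K)]
  · intro K L hKL
    exact hT.aedisjoint K.2 L.2 fun h => hKL (Subtype.ext h)
  · exact fun K => (measurableSet_simplex K.1).nullMeasurableSet

theorem IsMesh.integral_eq (hT : IsMesh Ω T) (hΩ : interior (closure Ω) = Ω) {F : Type*}
    [NormedAddCommGroup F] [NormedSpace ℝ F] {f : E n → F}
    (hf : ∀ K ∈ T, IntegrableOn f (simplex K)) :
    ∫ x in Ω, f x = ∑ K ∈ T, ∫ x in simplex K, f x := by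
  rw [hT.restrict_eq hΩ, integral_finsetSum_measure hf]

theorem IsMesh.ae_restrict_iff (hT : IsMesh Ω T) (hΩ : interior (closure Ω) = Ω) {P : E n → Prop} :
    (∀ᵐ x ∂volume.restrict Ω, P x) ↔ ∀ K ∈ T, ∀ᵐ x ∂volume.restrict (simplex K), P x := by
  rw [hT.restrict_eq hΩ]
  simp only [ae_iff, Measure.finsetSum_apply, Finset.sum_eq_zero_iff]

/-- Almost everywhere equality of continuous forms becomes equality on the interior of the element,
and passes to the rest of `K ∩ Ω` because the element is the closure of its interior. -/
theorem eqOn_simplex_inter (hT : IsMesh Ω T) (hΩ : interior (closure Ω) = Ω) {K : Finset (E n)}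
    (hK : K ∈ T) {v p : E n → Form n k} (hv : ContinuousOn v Ω) (hp : Continuous p)
    (h : EqOnElement K v p) : ∀ x ∈ simplex K ∩ Ω, v x = p x := by
  have h1 : Set.EqOn v p (interior (simplex K)) :=
    Measure.eqOn_open_of_ae_eq (ae_restrict_of_ae_restrict_of_subset interior_subset h)
      isOpen_interior (hv.mono (hT.interior_simplex_subset hΩ hK)) hp.continuousOn
  rintro x ⟨hxK, hxΩ⟩
  have hcl : x ∈ closure (interior (simplex K)) := by rwa [hT.closure_interior_simplex hK]
  have hne : (nhdsWithin x (interior (simplex K))).NeBot := mem_closure_iff_nhdsWithin_neBot.1 hcl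
  have h2 : Filter.Tendsto v (nhdsWithin x (interior (simplex K))) (nhds (v x)) :=
    (hv x hxΩ).mono_left (nhdsWithin_mono x (hT.interior_simplex_subset hΩ hK))
  have h3 : Filter.Tendsto p (nhdsWithin x (interior (simplex K))) (nhds (p x)) :=
    hp.continuousAt.mono_left nhdsWithin_le_nhds
  exact tendsto_nhds_unique (h2.congr' (eventually_nhdsWithin_of_forall h1)) h3

end Mesh

/-! ### Integration over facets -/

section Facets

variable {n k r d : ℕ}

/-- The integral over the face with vertices `b` of a function, in the affine parametrization. -/
def faceInt (b : Fin (d + 1) → E n) (f : E n → ℝ) : ℝ := ∫ s in unitSimplex d, f (pt b (bary s))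

theorem exists_perm_of_range_eq {m : ℕ} {b b' : Fin m → E n} (hb' : Function.Injective b')
    (h : Set.range b = Set.range b') : ∃ π : Equiv.Perm (Fin m), b' = b ∘ π := by
  have h1 : ∀ i, ∃ j, b j = b' i := fun i => by
    have : b' i ∈ Set.range b := h ▸ ⟨i, rfl⟩
    exact this
  choose J hJ using h1
  have hJi : Function.Injective J := fun i j hij => hb' (by rw [← hJ, ← hJ, hij])
  exact ⟨Equiv.ofBijective J (Finite.injective_iff_bijective.1 hJi), funext fun i => (hJ i).symm⟩

theorem pt_comp_perm' {m : ℕ} (b : Fin m → E n) (π : Equiv.Perm (Fin m)) (c : Fin m → ℝ) :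
    pt (b ∘ π) c = pt b (c ∘ π.symm) := by
  rw [← pt_comp_perm b π (c ∘ π.symm)]
  congr 1
  ext j
  simp

theorem faceInt_comp_perm (b : Fin (d + 1) → E n) (π : Equiv.Perm (Fin (d + 1))) (f : E n → ℝ) :
    faceInt (b ∘ π) f = faceInt b f := by
  rw [faceInt, ← integral_permMap π]
  simp only [bary_permMap, pt_comp_perm]
  rfl

theorem faceInt_congr_range {b b' : Fin (d + 1) → E n} (hb' : Function.Injective b')
    (h : Set.range b = Set.range b') (f : E n → ℝ) : faceInt b' f = faceInt b f := by
  obtain ⟨π, rfl⟩ := exists_perm_of_range_eq hb' h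
  exact faceInt_comp_perm b π f

/-- The divergence theorem on a simplex: the covectors `ν j` are the scaled conormals. -/
theorem exists_conormal {A : Fin (d + 2) → E (d + 1)} (hA : AffineIndependent ℝ A) :
    ∃ ν : Fin (d + 2) → E (d + 1) →ₗ[ℝ] ℝ,
      (∀ f : E (d + 1) → ℝ, ContDiff ℝ 1 f → ∀ u, ∫ x in convexHull ℝ (Set.range A), fderiv ℝ f x u =
        -∑ j, ν j u * faceInt (A ∘ j.succAbove) f) ∧
      ∀ j u, ν j u = 0 → ∃ e, ∑ i, e i = 0 ∧ pt (A ∘ j.succAbove) e = u := by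
  obtain ⟨B, hB⟩ := exists_affineEquiv hA
  obtain ⟨c, hc, hint⟩ := exists_integral_simplex hA
  let R : E (d + 1) →ₗ[ℝ] Fin (d + 1) → ℝ := ofLpL (d + 1) ∘ₗ (B.symm : E (d + 1) →ₗ[ℝ] E (d + 1))
  have hR : ∀ u, edgeMap A (R u) = u := by
    intro u
    rw [← hB]
    have : WithLp.toLp 2 (R u) = B.symm u := by
      change WithLp.toLp 2 (ofLpL (d + 1) (B.symm u)) = _
      rw [ofLpL_apply]
    rw [this, B.apply_symm_apply]
  -- The conormal is the differential of the `j`-th barycentric coordinate times the volume factor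
  -- of the parametrization, so its kernel consists of the directions tangent to the facet.
  refine ⟨fun j => c • (LinearMap.proj j ∘ₗ baryLin (d + 1) ∘ₗ R), fun f hf u => ?_,
    fun j u hu => ?_⟩
  · have hL : ∀ t, HasFDerivAt (fun t => pt A (bary t))
        (LinearMap.toContinuousLinearMap (edgeMap A)) t := by
      intro t
      simp only [pt_bary]
      exact (LinearMap.toContinuousLinearMap (edgeMap A)).hasFDerivAt.const_add _
    have hcd : ContDiff ℝ 1 fun t => f (pt A (bary t)) := by
      refine hf.comp ?_
      simp only [pt_bary]
      exact contDiff_const.add (LinearMap.toContinuousLinearMap (edgeMap A)).contDiff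
    have h1 : ∀ t, fderiv ℝ f (pt A (bary t)) u =
        fderiv ℝ (fun t => f (pt A (bary t))) t (R u) := by
      intro t
      have := ((hf.differentiable one_ne_zero (pt A (bary t))).hasFDerivAt.comp t (hL t)).fderiv
      have h2 : fderiv ℝ (fun t => f (pt A (bary t))) t = _ := this
      rw [h2, ContinuousLinearMap.comp_apply]
      change _ = fderiv ℝ f _ (edgeMap A (R u))
      rw [hR]
    rw [hint]
    simp only [h1]
    rw [integral_fderiv_unitSimplex hcd, mul_neg, Finset.mul_sum]
    congr 1
    refine Finset.sum_congr rfl fun j _ => ?_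
    have h3 : ∀ s, pt A (bary (faceEmb j s)) = pt (A ∘ j.succAbove) (bary s) := by
      intro s
      rw [pt_succAbove A j (by rw [bary_faceEmb, Fin.insertNth_apply_same]), bary_faceEmb]
      congr 1
      ext i
      simp
    simp only [h3, ← mul_assoc]
    rfl
  · have h1 : bary0 (R u) j = 0 := by
      have : c * bary0 (R u) j = 0 := hu
      exact (mul_eq_zero.1 this).resolve_left hc.ne'
    refine ⟨bary0 (R u) ∘ j.succAbove, ?_, ?_⟩
    · rw [sum_succAbove j h1, sum_bary0]
    · rw [← pt_succAbove A j h1, ← edgeMap_apply, hR]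

theorem mem_of_pt_mem_convexHull {m : ℕ} {a : Fin m → E n} (ha : AffineIndependent ℝ a)
    {c : Fin m → ℝ} (hc : ∑ j, c j = 1) {S : Set (E n)} (hS : S ⊆ Set.range a)
    (h : pt a c ∈ convexHull ℝ S) (i : Fin m) (hi : c i ≠ 0) : a i ∈ S := by
  have h1 : convexHull ℝ S ⊆
      {x | ∃ c : Fin m → ℝ, ∑ j, c j = 1 ∧ (∀ i, a i ∉ S → c i = 0) ∧ pt a c = x} := by
    refine convexHull_min ?_ ?_
    · intro x hx
      obtain ⟨j, rfl⟩ := hS hx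
      refine ⟨Pi.single j 1, by simp, fun i hi => Pi.single_eq_of_ne ?_ _, pt_single a j⟩
      rintro rfl
      exact hi hx
    · rintro _ ⟨c, hc1, hc0, rfl⟩ _ ⟨c', hc1', hc0', rfl⟩ s t hs ht hst
      refine ⟨s • c + t • c', ?_, fun i hi => ?_, by simp⟩
      · simp [Finset.sum_add_distrib, ← Finset.mul_sum, hc1, hc1', hst]
      · simp [hc0 i hi, hc0' i hi]
  obtain ⟨c', hc1, hc0, hcc⟩ := h1 h
  have h2 : c' - c = 0 := affineIndependent_pt_eq_zero ha (by simp [hc1, hc]) (by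
    rw [map_sub, hcc, sub_self])
  by_contra hcon
  exact hi (by rw [← sub_eq_zero.1 h2]; exact hc0 i hcon)

/-- By conformity the point lies in the hull of `K ∩ L`. Its barycentric coordinates on `b` are all
positive, so all vertices of `b` belong to `L`; the same argument inside `L` puts them among those
of `b'`, and the cardinalities agree. -/
theorem facet_eq_of_mem {Ω : Set (E n)} {T : Finset (Finset (E n))} (hT : IsMesh Ω T)
    {K L : Finset (E n)} (hK : K ∈ T) (hL : L ∈ T) {b b' : Fin (d + 1) → E n}
    (hb : Function.Injective b) (hbK : Set.range b ⊆ K) (hb' : Function.Injective b')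
    (hbL : Set.range b' ⊆ L) {s : Fin d → ℝ} (hs : s ∈ unitSimplexInt d)
    (hx : pt b (bary s) ∈ convexHull ℝ (Set.range b')) : Set.range b = Set.range b' := by
  have hpos := mem_unitSimplexInt_iff.1 hs
  have key : ∀ K ∈ T, Set.range b ⊆ K → ∀ S ⊆ (K : Set (E n)), pt b (bary s) ∈ convexHull ℝ S →
      Set.range b ⊆ S := by
    intro K hK hbK S hS hxS
    obtain ⟨A, hA, hAr⟩ := hT.exists_vertices hK
    rw [← hAr] at hbK hS
    have h1 : ∀ i, ∃ j, A j = b i := fun i => hbK ⟨i, rfl⟩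
    choose J hJ using h1
    have hJi : Function.Injective J := fun i j hij => hb (by rw [← hJ, ← hJ, hij])
    have hbJ : b = A ∘ J := funext fun i => (hJ i).symm
    rw [hbJ, ← pt_extend A hJi] at hxS
    rintro _ ⟨i, rfl⟩
    rw [← hJ]
    refine mem_of_pt_mem_convexHull hA (by rw [sum_extend_id hJi, sum_bary]) hS hxS (J i) ?_
    rw [hJi.extend_apply]
    exact (hpos i).ne'
  have hxK : pt b (bary s) ∈ simplex K := convexHull_mono hbK
    (mem_convexHull_range_iff.2 ⟨_, fun j => (hpos j).le, sum_bary s, rfl⟩)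
  have hxKL : pt b (bary s) ∈ convexHull ℝ ((K : Set (E n)) ∩ L) := by
    rw [← hT.conforming K hK L hL]
    exact ⟨hxK, convexHull_mono hbL hx⟩
  have hbL' : Set.range b ⊆ L := (key K hK hbK _ Set.inter_subset_left hxKL).trans
    Set.inter_subset_right
  have hsub := key L hL hbL' _ hbL hx
  refine Set.eq_of_subset_of_ncard_le hsub ?_ (Set.finite_range b')
  rw [← Set.image_univ, ← Set.image_univ, Set.ncard_image_of_injective _ hb,
    Set.ncard_image_of_injective _ hb']

theorem integral_fderiv_eq_zero {f : E n → ℝ} (hf : ContDiff ℝ 1 f) (hc : HasCompactSupport f)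
    (u : E n) : ∫ x, fderiv ℝ f x u = 0 := by
  have h1 : Continuous fun x => fderiv ℝ f x u :=
    (hf.continuous_fderiv one_ne_zero).clm_apply continuous_const
  have h2 : HasCompactSupport fun x => fderiv ℝ f x u := by
    refine (hc.fderiv ℝ).comp_left (g := fun L : E n →L[ℝ] ℝ => L u) rfl
  have := integral_mul_fderiv_eq_neg_fderiv_mul_of_integrable (μ := volume) (f := fun _ : E n => (1 : ℝ))
    (g := f) (v := u) (by simp) (by simpa using h1.integrable_of_hasCompactSupport h2)
    (by simpa using hf.continuous.integrable_of_hasCompactSupport hc)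
    (fun x _ => differentiableAt_const _) fun x _ => hf.differentiable one_ne_zero x
  simpa using this

end Facets

/-! ### Cancellation of the facet terms -/

section Cancellation

variable {k r d : ℕ} {Ω : Set (E (d + 1))} {T : Finset (Finset (E (d + 1)))}

/-- Vertices and scaled conormals of the elements of a mesh. -/
structure MeshFacets (T : Finset (Finset (E (d + 1)))) where
  /-- the vertices -/
  vert : T → Fin (d + 2) → E (d + 1)
  /-- the scaled conormals -/
  conormal : T × Fin (d + 2) → E (d + 1) →ₗ[ℝ] ℝ
  affineIndependent : ∀ K, AffineIndependent ℝ (vert K)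
  range_vert : ∀ K, Set.range (vert K) = (K.1 : Set (E (d + 1)))
  divergence : ∀ (K : T) (f : E (d + 1) → ℝ), ContDiff ℝ 1 f → ∀ u,
    ∫ x in simplex K.1, fderiv ℝ f x u =
      -∑ j, conormal (K, j) u * faceInt (vert K ∘ j.succAbove) f
  tangent : ∀ i u, conormal i u = 0 → ∃ e, ∑ j, e j = 0 ∧ pt (vert i.1 ∘ i.2.succAbove) e = u

theorem IsMesh.nonempty_meshFacets (hT : IsMesh Ω T) : Nonempty (MeshFacets T) := by
  have h1 := fun K : T => hT.exists_vertices K.2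
  choose A hA hAr using h1
  have h2 := fun K : T => exists_conormal (hA K)
  choose ν hν hν' using h2
  refine ⟨⟨A, fun i => ν i.1 i.2, hA, hAr, fun K f hf u => ?_, fun i u => hν' i.1 i.2 u⟩⟩
  rw [← hν K f hf u, hAr]
  rfl

namespace MeshFacets

variable (M : MeshFacets T)

/-- The vertices of a facet. -/
def facet (i : T × Fin (d + 2)) : Fin (d + 1) → E (d + 1) := M.vert i.1 ∘ i.2.succAbove

theorem facet_injective (i : T × Fin (d + 2)) : Function.Injective (M.facet i) :=
  (M.affineIndependent i.1).injective.comp Fin.succAbove_right_injective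

theorem facet_subset (i : T × Fin (d + 2)) : Set.range (M.facet i) ⊆ (i.1.1 : Set (E (d + 1))) := by
  rw [← M.range_vert]
  exact Set.range_comp_subset_range _ _

theorem sum_integral_fderiv (f : E (d + 1) → ℝ) (hf : ContDiff ℝ 1 f) (u : E (d + 1)) :
    ∑ K : T, ∫ x in simplex K.1, fderiv ℝ f x u =
      -∑ i, M.conormal i u * faceInt (M.facet i) f := by
  simp only [M.divergence _ f hf u, Finset.sum_neg_distrib]
  rw [Fintype.sum_prod_type]
  rfl

open Classical in
-- Apply the divergence theorem on every element to a bump function `f` supported in `Ω` near `x`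
-- and away from all other facets. The left sides add up to the integral of a derivative of a
-- compactly supported function, which is zero; the right sides give, up to sign, the sum of the
-- conormals times the positive integral of `f` over the facet.
theorem sum_conormal_eq_zero (hT : IsMesh Ω T) (hΩ : interior (closure Ω) = Ω)
    (i₀ : T × Fin (d + 2)) {s : Fin d → ℝ} (hs : s ∈ unitSimplexInt d)
    (hx : pt (M.facet i₀) (bary s) ∈ Ω) (u : E (d + 1)) :
    ∑ i with Set.range (M.facet i) = Set.range (M.facet i₀), M.conormal i u = 0 := by
  set x := pt (M.facet i₀) (bary s) with hxdef
  let U : Set (E (d + 1)) := Ω ∩ ⋂ i : {i // Set.range (M.facet i) ≠ Set.range (M.facet i₀)},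
    (convexHull ℝ (Set.range (M.facet i.1)))ᶜ
  have hU : U ∈ nhds x := by
    refine IsOpen.mem_nhds ((IsMesh.isOpen hΩ).inter
      (isOpen_iInter_of_finite fun i => (isClosed_convexHull_range _).isOpen_compl)) ⟨hx, ?_⟩
    refine Set.mem_iInter.2 fun i hi => i.2 ?_
    exact (facet_eq_of_mem hT i₀.1.2 i.1.1.2 (M.facet_injective i₀) (M.facet_subset i₀)
      (M.facet_injective i.1) (M.facet_subset i.1) hs hi).symm
  obtain ⟨f, hfU, hfc, hf, hf01, hfx⟩ := exists_contDiff_tsupport_subset (n := 1) hU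
  have hf' : ContDiff ℝ 1 f := by exact_mod_cast hf
  have h1 := M.sum_integral_fderiv f hf' u
  have hcont : Continuous fun x => fderiv ℝ f x u :=
    (hf'.continuous_fderiv one_ne_zero).clm_apply continuous_const
  have h2 : ∑ K : T, ∫ x in simplex K.1, fderiv ℝ f x u = 0 := by
    rw [Finset.sum_coe_sort T fun K => ∫ x in simplex K, fderiv ℝ f x u,
      ← hT.integral_eq hΩ fun K _ => integrableOn_simplex hcont K,
      setIntegral_eq_integral_of_forall_compl_eq_zero]
    · exact integral_fderiv_eq_zero hf' hfc u
    · intro y hy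
      have hy' : y ∉ tsupport (fderiv ℝ f) := fun h =>
        hy (hfU (tsupport_fderiv_subset ℝ h)).1
      rw [image_eq_zero_of_notMem_tsupport hy']
      rfl
  rw [h2, eq_comm, neg_eq_zero] at h1
  have h3 : ∀ i, M.conormal i u * faceInt (M.facet i) f =
      if Set.range (M.facet i) = Set.range (M.facet i₀) then
        M.conormal i u * faceInt (M.facet i₀) f else 0 := by
    intro i
    split_ifs with h
    · rw [faceInt_congr_range (M.facet_injective i) h.symm]
    · refine mul_eq_zero_of_right _ ?_
      refine (setIntegral_congr_fun measurableSet_unitSimplex fun t ht => ?_).trans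
        (integral_zero _ _)
      refine image_eq_zero_of_notMem_tsupport fun hmem => ?_
      have := Set.mem_iInter.1 (hfU hmem).2 ⟨i, h⟩
      exact this (mem_convexHull_range_iff.2
        ⟨_, mem_unitSimplex_iff.1 ht, sum_bary t, rfl⟩)
  simp only [h3] at h1
  rw [← Finset.sum_filter, ← Finset.sum_mul] at h1
  refine (mul_eq_zero.1 h1).resolve_right fun h0 => ?_
  have h4 := eq_zero_of_integral_unitSimplex (f := fun s => f (pt (M.facet i₀) (bary s)))
    (hf'.continuous.comp (continuous_pt_bary _)) (fun t _ => (hf01 ⟨_, rfl⟩).1) h0 s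
    (unitSimplexInt_subset hs)
  rw [← hxdef, hfx] at h4
  exact one_ne_zero h4

theorem continuous_faceInt_integrand {b : Fin (d + 1) → E (d + 1)} {f : E (d + 1) → ℝ}
    (hf : Continuous f) : IntegrableOn (fun s => f (pt b (bary s))) (unitSimplex d) :=
  integrableOn_unitSimplex (hf.comp (continuous_pt_bary b))

open Classical in
/-- The facet contributions to `∫ d(φ P)` cancel if the traces of `P` agree on common facets. -/
theorem sum_integral_extDeriv (hT : IsMesh Ω T) (hΩ : interior (closure Ω) = Ω)
    {P : T → E (d + 1) → Form (d + 1) k} (hP : ∀ K, ContDiff ℝ ∞ (P K))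
    (htr : ∀ i i₀ : T × Fin (d + 2), Set.range (M.facet i) = Set.range (M.facet i₀) →
      (∃ s ∈ unitSimplexInt d, pt (M.facet i₀) (bary s) ∈ Ω) →
        ZeroTrace (M.facet i₀) fun x => P i.1 x - P i₀.1 x)
    {φ : E (d + 1) → ℝ} (hφ : IsTest Ω φ) (v : Fin (k + 1) → E (d + 1)) :
    ∑ K : T, ∫ x in simplex K.1, ∑ l : Fin (k + 1), (-1 : ℝ) ^ (l : ℕ) *
      fderiv ℝ (fun x => φ x * P K x (l.removeNth v)) x (v l) = 0 := by
  have hPv : ∀ K w, ContDiff ℝ ∞ fun x => P K x w := fun K w =>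
    (ContinuousAlternatingMap.apply ℝ (E (d + 1)) ℝ w).contDiff.comp (hP K)
  have hF : ∀ K w, ContDiff ℝ 1 fun x => φ x * P K x w := fun K w =>
    (hφ.1.mul (hPv K w)).of_le (by exact_mod_cast le_top)
  have hFc : ∀ K w u, Continuous fun x => fderiv ℝ (fun x => φ x * P K x w) x u := fun K w u =>
    ((hF K w).continuous_fderiv one_ne_zero).clm_apply continuous_const
  let H : T × Fin (d + 2) → E (d + 1) → ℝ := fun i x =>
    ∑ l : Fin (k + 1), (-1 : ℝ) ^ (l : ℕ) * (M.conormal i (v l) * P i.1 x (l.removeNth v))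
  have hHc : ∀ i, Continuous (H i) := fun i => continuous_finsetSum _ fun l _ =>
    continuous_const.mul (continuous_const.mul (hPv i.1 _).continuous)
  have h1 : ∀ K : T, ∫ x in simplex K.1, ∑ l : Fin (k + 1), (-1 : ℝ) ^ (l : ℕ) *
      fderiv ℝ (fun x => φ x * P K x (l.removeNth v)) x (v l) =
      -∑ j, faceInt (M.facet (K, j)) fun x => φ x * H (K, j) x := by
    intro K
    rw [integral_finsetSum _ fun l _ => (integrableOn_simplex (hFc K _ _) _).const_mul _]
    simp only [integral_const_mul, M.divergence K _ (hF K _), mul_neg, Finset.sum_neg_distrib,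
      Finset.mul_sum]
    rw [Finset.sum_comm]
    congr 1
    refine Finset.sum_congr rfl fun j _ => ?_
    rw [faceInt]
    simp only [H, Finset.mul_sum]
    rw [integral_finsetSum]
    · refine Finset.sum_congr rfl fun l _ => ?_
      rw [faceInt, ← mul_assoc, ← integral_const_mul]
      refine integral_congr_ae (.of_forall fun s => ?_)
      simp only [facet]
      ring
    · intro l _
      exact continuous_faceInt_integrand (f := fun x => φ x * ((-1 : ℝ) ^ (l : ℕ) *
        (M.conormal (K, j) (v l) * P K x (l.removeNth v)))) (hφ.1.continuous.mul
        (continuous_const.mul (continuous_const.mul (hPv K _).continuous)))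
  simp only [h1, Finset.sum_neg_distrib, neg_eq_zero]
  -- Group the facets of all elements by their vertex sets; facets in one group have the same
  -- integrals, whatever the order of their vertices.
  rw [← Fintype.sum_prod_type (f := fun i => faceInt (M.facet i) fun x => φ x * H i x),
    ← Finset.sum_fiberwise_of_maps_to (t := Finset.univ.image fun i => Set.range (M.facet i))
      (g := fun i => Set.range (M.facet i)) fun i hi => Finset.mem_image_of_mem _ hi]
  refine Finset.sum_eq_zero fun S hS => ?_
  obtain ⟨i₀, -, rfl⟩ := Finset.mem_image.1 hS
  have h2 : ∀ i ∈ Finset.univ.filter fun i =>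
      Set.range (M.facet i) = Set.range (M.facet i₀), (faceInt (M.facet i) fun x => φ x * H i x) =
      faceInt (M.facet i₀) fun x => φ x * H i x := fun i hi =>
    faceInt_congr_range (M.facet_injective i) (Finset.mem_filter.1 hi).2.symm _
  rw [Finset.sum_congr rfl h2]
  by_cases hne : ∃ s ∈ unitSimplexInt d, pt (M.facet i₀) (bary s) ∈ Ω
  · obtain ⟨s₀, hs₀, hx₀⟩ := id hne
    simp only [faceInt]
    rw [← integral_finsetSum _ fun i _ => continuous_faceInt_integrand
      (f := fun x => φ x * H i x) (hφ.1.continuous.mul (hHc i))]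
    refine (integral_congr_ae (.of_forall fun s => ?_)).trans (integral_zero _ _)
    beta_reduce
    rw [← Finset.mul_sum]
    refine mul_eq_zero_of_right _ ?_
    set y := pt (M.facet i₀) (bary s) with hy
    have h3 : ∀ i ∈ Finset.univ.filter fun i =>
        Set.range (M.facet i) = Set.range (M.facet i₀), H i y =
        ∑ l : Fin (k + 1), (-1 : ℝ) ^ (l : ℕ) * (M.conormal i (v l) * P i₀.1 y (l.removeNth v)) := by
      intro i hi
      have hi' := (Finset.mem_filter.1 hi).2
      -- The kernel of the conormal consists of tangent vectors, on which the two traces agree. So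
      -- the wedge product of `conormal i` with `P i` may be replaced by that with `P i₀`, and the
      -- sum over the group then contains the vanishing sum of the conormals.
      have h4 := covector_wedge_eq_zero (M.conormal i)
        (P i.1 y - P i₀.1 y).toAlternatingMap (fun w hw => by
          choose e he hew using fun l => M.tangent i (w l) (hw l)
          obtain ⟨π, hπ⟩ := exists_perm_of_range_eq (M.facet_injective i) hi'.symm
          have h5 := htr i i₀ hi' hne (bary s) (sum_bary s) (fun l => e l ∘ π.symm) fun l => by
            rw [← he l]
            exact Equiv.sum_comp π.symm (e l)
          have h6 : (fun l => pt (M.facet i₀) (e l ∘ π.symm)) = w := by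
            ext1 l
            rw [← pt_comp_perm', ← hπ, ← hew]
            rfl
          rw [h6] at h5
          exact h5) v
      rw [← sub_eq_zero, ← h4, ← Finset.sum_sub_distrib]
      refine Finset.sum_congr rfl fun l _ => ?_
      rw [← mul_sub, ← mul_sub]
      rfl
    rw [Finset.sum_congr rfl h3, Finset.sum_comm]
    refine Finset.sum_eq_zero fun l _ => ?_
    rw [← Finset.mul_sum, ← Finset.sum_mul, M.sum_conormal_eq_zero hT hΩ i₀ hs₀ hx₀, zero_mul,
      mul_zero]
  -- The relative interior of the facet misses `Ω`, so the test function vanishes on the whole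
  -- facet.
  · push Not at hne
    refine Finset.sum_eq_zero fun i _ => ?_
    have hφ0 := eq_zero_on_unitSimplex (f := fun s => φ (pt (M.facet i₀) (bary s)))
      (hφ.1.continuous.comp (continuous_pt_bary _)) fun s hs =>
        image_eq_zero_of_notMem_tsupport fun h => hne s hs (hφ.2.2 h)
    refine (setIntegral_congr_fun measurableSet_unitSimplex fun s hs => ?_).trans
      (integral_zero _ _)
    have : φ (pt (M.facet i₀) (bary s)) = 0 := hφ0 s hs
    simp only [this, zero_mul]

end MeshFacets

end Cancellation

/-! ### The weak exterior derivative of the interpolant -/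

section WeakExtDeriv

variable {n k r d : ℕ} {Ω : Set (E n)} {T : Finset (Finset (E n))}

theorem PolyFun.eq_zero_of_eqOn {s : ℕ} {f : (Fin d → ℝ) → ℝ} (hf : PolyFun s f)
    {U : Set (Fin d → ℝ)} (hU : IsOpen U) (hne : U.Nonempty) (h : ∀ t ∈ U, f t = 0) (t : Fin d → ℝ) :
    f t = 0 := by
  obtain ⟨P, -, hP⟩ := hf
  have : P = 0 := PolyFun.eq_zero_of_isOpen hU hne fun t ht => by rw [← hP, h t ht]
  rw [hP, this, map_zero]

theorem faceMoments_of_eq_zero {b : Fin (d + 1) → E n} {w : E n → Form n k}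
    (h : ∀ s, w (pt b (bary s)) = 0) : FaceMoments r (Set.range b) w := by
  intro m s hms c hc hcb e he g hg
  choose J hJ using hcb
  have hJi : Function.Injective J := fun i j hij => hc (by rw [← hJ, ← hJ, hij])
  have hcJ : c = b ∘ J := funext fun i => (hJ i).symm
  have h1 : ∀ t, w (pt c (bary t)) = 0 := by
    intro t
    rw [hcJ, ← pt_extend b hJi, ← bary_tail (c := Function.extend J (bary t) 0), h]
    rw [sum_extend_id hJi, sum_bary]
  simp [h1]

/-- Both polynomials equal the continuous form `v` on the nonempty relatively open part of the face
inside `Ω`, and a polynomial vanishing there vanishes on the whole affine span. -/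
theorem eq_zero_on_facet (hT : IsMesh Ω T) (hΩ : interior (closure Ω) = Ω) {v : E n → Form n k}
    (hv : ContinuousOn v Ω) {K L : Finset (E n)} (hK : K ∈ T) (hL : L ∈ T) {p q : E n → Form n k}
    (hp : IsPolyForm r p) (hq : IsPolyForm r q) (hvp : EqOnElement K v p) (hvq : EqOnElement L v q)
    {b : Fin (d + 1) → E n} (hbK : Set.range b ⊆ K) (hbL : Set.range b ⊆ L)
    (hne : ∃ s ∈ unitSimplexInt d, pt b (bary s) ∈ Ω) (s : Fin d → ℝ) :
    p (pt b (bary s)) - q (pt b (bary s)) = 0 := by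
  ext w
  refine ((hp.sub hq).polyFun_face b w).eq_zero_of_eqOn
    (U := unitSimplexInt d ∩ (fun s => pt b (bary s)) ⁻¹' Ω)
    (isOpen_unitSimplexInt.inter ((IsMesh.isOpen hΩ).preimage (continuous_pt_bary b))) ?_ ?_ s
  · obtain ⟨s, hs, hsΩ⟩ := hne
    exact ⟨s, hs, hsΩ⟩
  · rintro t ⟨ht, htΩ⟩
    have hmem : pt b (bary t) ∈ convexHull ℝ (Set.range b) := mem_convexHull_range_iff.2
      ⟨_, mem_unitSimplex_iff.1 (unitSimplexInt_subset ht), sum_bary t, rfl⟩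
    rw [← eqOn_simplex_inter hT hΩ hK hv hp.continuous hvp _ ⟨convexHull_mono hbK hmem, htΩ⟩,
      ← eqOn_simplex_inter hT hΩ hL hv hq.continuous hvq _ ⟨convexHull_mono hbL hmem, htΩ⟩, sub_self]
    rfl

/-- On the face, `p' - q' = (p - q) - (p - p') + (q - q')` has vanishing degrees of freedom, the
first term because it is zero there; unisolvence does the rest. Besides common facets, this covers
`K = L` with the full vertex set, which yields uniqueness of the interpolant. -/
theorem zeroTrace_facet (hr : 1 ≤ r) (hT : IsMesh Ω T) (hΩ : interior (closure Ω) = Ω)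
    {v : E n → Form n k} (hv : ContinuousOn v Ω) {K L : Finset (E n)} (hK : K ∈ T) (hL : L ∈ T)
    {p q p' q' : E n → Form n k} (hp : IsPolyForm r p) (hq : IsPolyForm r q)
    (hvp : EqOnElement K v p) (hvq : EqOnElement L v q) (hp' : IsTrimmedForm r p')
    (hq' : IsTrimmedForm r q') (hpp' : FaceMoments r (K : Set (E n)) fun x => p x - p' x)
    (hqq' : FaceMoments r (L : Set (E n)) fun x => q x - q' x)
    {b : Fin (d + 1) → E n} (hb : Function.Injective b) (hbK : Set.range b ⊆ K)
    (hbL : Set.range b ⊆ L) (hne : ∃ s ∈ unitSimplexInt d, pt b (bary s) ∈ Ω) :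
    ZeroTrace b fun x => p' x - q' x := by
  refine zeroTrace_of_faceMoments hr (hp'.sub hq') b hb ?_
  have h1 : FaceMoments r (Set.range b) fun x => p x - q x := faceMoments_of_eq_zero
    (eq_zero_on_facet hT hΩ hv hK hL hp hq hvp hvq hbK hbL hne)
  have hc1 : Continuous fun x => p x - p' x := hp.continuous.sub (hp'.isPolyForm hr).continuous
  have hc2 : Continuous fun x => q x - q' x := hq.continuous.sub (hq'.isPolyForm hr).continuous
  have hc3 : Continuous fun x => p x - q x := hp.continuous.sub hq.continuous
  have hc4 : Continuous fun x => (-1 : ℝ) • (p x - p' x) := hc1.const_smul (-1 : ℝ)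
  have h2 := (h1.add hc3 hc4 ((hpp'.mono hbK).const_smul (-1))).add
    (hc3.add hc4) hc2 (hqq'.mono hbL)
  have e : (fun x => p' x - q' x) =
      fun x => (p x - q x) + (-1 : ℝ) • (p x - p' x) + (q x - q' x) := funext fun x => by module
  rw [e]
  exact h2

theorem covectorWedge_apply (ξ : E n →L[ℝ] ℝ) (w : Form n k) (v : Fin (k + 1) → E n) :
    covectorWedge ξ w v =
      ∑ l : Fin (k + 1), (-1 : ℝ) ^ (l : ℕ) * (ξ (v l) * w (l.removeNth v)) := by
  rw [covectorWedge, ContinuousAlternatingMap.alternatizeUncurryFin_apply]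
  refine Finset.sum_congr rfl fun l _ => ?_
  rw [zsmul_eq_mul]
  push_cast
  rfl

theorem extDeriv_apply_eq_sum (w : E n → Form n k) (x : E n) (v : Fin (k + 1) → E n) :
    extDeriv w x v =
      ∑ l : Fin (k + 1), (-1 : ℝ) ^ (l : ℕ) * fderiv ℝ w x (v l) (l.removeNth v) := by
  rw [extDeriv, ContinuousAlternatingMap.alternatizeUncurryFin_apply]
  refine Finset.sum_congr rfl fun l _ => ?_
  rw [zsmul_eq_mul]
  push_cast
  rfl

theorem fderiv_form_apply {w : E n → Form n k} {x : E n} (hw : DifferentiableAt ℝ w x)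
    (v : Fin k → E n) (u : E n) : fderiv ℝ (fun x => w x v) x u = fderiv ℝ w x u v := by
  have := ((ContinuousAlternatingMap.apply ℝ (E n) ℝ v).hasFDerivAt.comp x hw.hasFDerivAt).fderiv
  have h2 : fderiv ℝ (fun x => w x v) x = _ := this
  rw [h2]
  rfl

theorem continuous_extDeriv {w : E n → Form n k} (hw : ContDiff ℝ ∞ w) :
    Continuous (extDeriv w) :=
  (ContinuousAlternatingMap.alternatizeUncurryFinCLM ℝ (E n) ℝ).continuous.comp
    (hw.continuous_fderiv (by simp))

theorem continuous_covectorWedge {φ : E n → ℝ} (hφ : ContDiff ℝ ∞ φ) {w : E n → Form n k}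
    (hw : Continuous w) : Continuous fun x => covectorWedge (fderiv ℝ φ x) (w x) :=
  (ContinuousAlternatingMap.alternatizeUncurryFinCLM ℝ (E n) ℝ).continuous.comp
    ((ContinuousLinearMap.smulRightL ℝ (E n) (Form n k)).continuous₂.comp
      ((hφ.continuous_fderiv (by simp)).prodMk hw))

theorem integral_form_apply {μ : Measure (E n)} {f : E n → Form n k} (hf : Integrable f μ)
    (v : Fin k → E n) : (∫ x, f x ∂μ) v = ∫ x, f x v ∂μ :=
  ((ContinuousAlternatingMap.apply ℝ (E n) ℝ v).integral_comp_comm hf).symm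

/-- On each element `φ dP + dφ ∧ P = d(φP)`, so the weak identity amounts to the vanishing of the
total integral of `d(φP)` over the elements. -/
theorem hasWeakExtDeriv_iff (hT : IsMesh Ω T) (hΩ : interior (closure Ω) = Ω)
    {u : E n → Form n k} {η : E n → Form n (k + 1)} {P : T → E n → Form n k}
    (hP : ∀ K, ContDiff ℝ ∞ (P K)) (hu : ∀ K : T, EqOnElement K.1 u (P K))
    (hη : ∀ K : T, EqOnElement K.1 η (extDeriv (P K)))
    (h : ∀ φ, IsTest Ω φ → ∀ v : Fin (k + 1) → E n,
      ∑ K : T, ∫ x in simplex K.1, ∑ l : Fin (k + 1), (-1 : ℝ) ^ (l : ℕ) *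
        fderiv ℝ (fun x => φ x * P K x (l.removeNth v)) x (v l) = 0) :
    HasWeakExtDeriv Ω u η := by
  intro φ hφ
  have e1 : ∀ K : T, (fun x => φ x • η x) =ᵐ[volume.restrict (simplex K.1)]
      fun x => φ x • extDeriv (P K) x := fun K => by
    filter_upwards [hη K] with x hx
    rw [hx]
  have e2 : ∀ K : T, (fun x => covectorWedge (fderiv ℝ φ x) (u x)) =ᵐ[volume.restrict (simplex K.1)]
      fun x => covectorWedge (fderiv ℝ φ x) (P K x) := fun K => by
    filter_upwards [hu K] with x hx
    rw [hx]
  have i1 : ∀ K : T, IntegrableOn (fun x => φ x • extDeriv (P K) x) (simplex K.1) := fun K =>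
    integrableOn_simplex (hφ.1.continuous.smul (continuous_extDeriv (hP K))) K.1
  have i2 : ∀ K : T, IntegrableOn (fun x => covectorWedge (fderiv ℝ φ x) (P K x)) (simplex K.1) :=
    fun K => integrableOn_simplex (continuous_covectorWedge hφ.1 (hP K).continuous) K.1
  rw [hT.integral_eq hΩ fun K hK => (i1 ⟨K, hK⟩).congr (e1 ⟨K, hK⟩).symm,
    hT.integral_eq hΩ fun K hK => (i2 ⟨K, hK⟩).congr (e2 ⟨K, hK⟩).symm,
    ← Finset.sum_coe_sort T, ← Finset.sum_coe_sort T fun K =>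
      ∫ x in simplex K, covectorWedge (fderiv ℝ φ x) (u x), eq_neg_iff_add_eq_zero,
    ← Finset.sum_add_distrib]
  ext v
  rw [ContinuousAlternatingMap.sum_apply]
  refine Eq.trans ?_ (h φ hφ v)
  refine Finset.sum_congr rfl fun K _ => ?_
  rw [integral_congr_ae (e1 K), integral_congr_ae (e2 K), ← integral_add (i1 K) (i2 K)]
  refine (integral_form_apply (f := fun x => φ x • extDeriv (P K) x +
    covectorWedge (fderiv ℝ φ x) (P K x)) ((i1 K).add (i2 K)) v).trans ?_
  refine integral_congr_ae (.of_forall fun x => ?_)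
  simp only [ContinuousAlternatingMap.add_apply, ContinuousAlternatingMap.smul_apply,
    smul_eq_mul, covectorWedge_apply, extDeriv_apply_eq_sum, Finset.mul_sum,
    ← Finset.sum_add_distrib]
  refine Finset.sum_congr rfl fun l _ => ?_
  have hd : DifferentiableAt ℝ (P K) x := (hP K).differentiable (by simp) x
  have hd' : DifferentiableAt ℝ (fun x => P K x (l.removeNth v)) x :=
    (ContinuousAlternatingMap.apply ℝ (E n) ℝ (l.removeNth v)).differentiableAt.comp x hd
  rw [fderiv_fun_mul (hφ.1.differentiable (by simp) x) hd']
  simp only [add_apply, smul_apply, fderiv_form_apply hd, smul_eq_mul]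
  ring

/-- The piecewise exterior derivative of the interpolant is its weak exterior derivative. -/
theorem hasWeakExtDeriv_of_faceMoments (hr : 1 ≤ r) (hT : IsMesh Ω T)
    (hΩ : interior (closure Ω) = Ω) {v u : E n → Form n k} {η : E n → Form n (k + 1)}
    (hv : ContinuousOn v Ω) {p p' : T → E n → Form n k} (hp : ∀ K, IsPolyForm r (p K))
    (hvp : ∀ K : T, EqOnElement K.1 v (p K)) (hp' : ∀ K, IsTrimmedForm r (p' K))
    (hpp' : ∀ K : T, FaceMoments r (K.1 : Set (E n)) fun x => p K x - p' K x)
    (hu : ∀ K : T, EqOnElement K.1 u (p' K))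
    (hη : ∀ K : T, EqOnElement K.1 η (extDeriv (p' K))) : HasWeakExtDeriv Ω u η := by
  have hsm : ∀ K, ContDiff ℝ ∞ (p' K) := fun K => ((hp' K).isPolyForm hr).contDiff
  refine hasWeakExtDeriv_iff hT hΩ hsm hu hη fun φ hφ w => ?_
  cases n with
  | zero =>
    -- In dimension zero there are no facets, and the integrand vanishes because every vector is
    -- zero.
    refine Finset.sum_eq_zero fun K _ => ?_
    have : ∀ y : E 0, y = 0 := fun y => Subsingleton.elim _ _
    simp [this (w _)]
  | succ d =>
    obtain ⟨M⟩ := hT.nonempty_meshFacets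
    refine M.sum_integral_extDeriv hT hΩ hsm (fun i i₀ hi hne => ?_) hφ w
    exact zeroTrace_facet hr hT hΩ hv i.1.2 i₀.1.2 (hp _) (hp _) (hvp _) (hvp _) (hp' _) (hp' _)
      (hpp' _) (hpp' _) (M.facet_injective i₀) (hi ▸ M.facet_subset i) (M.facet_subset i₀) hne

end WeakExtDeriv

/-! ### Weak derivatives of piecewise polynomial functions -/

section WeakDerivatives

variable {n k r : ℕ} {Ω : Set (E n)} {T : Finset (Finset (E n))}

theorem IsMesh.volume_lt_top (hT : IsMesh Ω T) : volume Ω < ⊤ := by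
  refine (measure_mono (subset_closure (s := Ω))).trans_lt ?_
  rw [← hT.cover]
  exact measure_biUnion_lt_top T.finite_toSet fun K _ => volume_simplex_lt_top K

theorem MemL2.integrableOn (hT : IsMesh Ω T) {f : E n → ℝ} (hf : MemL2 Ω f) :
    IntegrableOn f Ω := by
  have : IsFiniteMeasure (volume.restrict Ω) := ⟨by simpa using hT.volume_lt_top⟩
  exact MemLp.integrable one_le_two hf

theorem integrable_sum_smul_const {X F ι : Type*} [MeasurableSpace X] {μ : Measure X}
    [NormedAddCommGroup F] [NormedSpace ℝ F] [Fintype ι] {c : ι → X → ℝ} (e : ι → F)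
    (hc : ∀ i, Integrable (c i) μ) : Integrable (fun x => ∑ i, c i x • e i) μ :=
  integrable_finsetSum _ fun i _ => (hc i).smul_const (e i)

theorem MemL2Form.integrableOn (hT : IsMesh Ω T) {w : E n → Form n k} (hw : MemL2Form Ω w) :
    IntegrableOn w Ω :=
  (congrArg (fun u => Integrable u (volume.restrict Ω)) (form_expand_fun w)).mpr
    (integrable_sum_smul_const (μ := volume.restrict Ω)
      (fun σ : Fin k ↪o Fin n => (dx σ : Form n k)) fun σ => (hw σ).integrableOn hT)

theorem simplex_ae_eq_interior (K : Finset (E n)) :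
    interior (simplex K) =ᵐ[volume] simplex K :=
  interior_ae_eq_of_null_frontier ((convex_convexHull ℝ _).addHaar_frontier _)

theorem setIntegral_mul_eq {S : Set (E n)} {φ : E n → ℝ} (hφ : tsupport φ ⊆ S) {F : Type*}
    [NormedAddCommGroup F] [NormedSpace ℝ F] (g : E n → F) :
    ∫ x in S, φ x • g x = ∫ x, φ x • g x := by
  refine setIntegral_eq_integral_of_forall_compl_eq_zero fun x hx => ?_
  rw [image_eq_zero_of_notMem_tsupport fun h => hx (hφ h), zero_smul]

/-- On an element, the weak partial derivative is the classical one. -/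
theorem weakPartial_ae_eq (hT : IsMesh Ω T) (hΩ : interior (closure Ω) = Ω) {K : Finset (E n)}
    (hK : K ∈ T) {f q : E n → ℝ} (hf : MemH1 Ω f) (hq : ContDiff ℝ ∞ q)
    (hfq : f =ᵐ[volume.restrict (simplex K)] q) (i : Fin n) :
    weakPartial Ω i f =ᵐ[volume.restrict (simplex K)] fun x => fderiv ℝ q x (basisVec i) := by
  obtain ⟨hg, hw⟩ : MemL2 Ω (weakPartial Ω i f) ∧ HasWeakPartial Ω i f (weakPartial Ω i f) :=
    Classical.epsilon_spec (hf.2 i)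
  set g := weakPartial Ω i f
  have hU := hT.interior_simplex_subset hΩ hK
  have hq' : Continuous fun x => fderiv ℝ q x (basisVec i) :=
    (hq.continuous_fderiv (by simp)).clm_apply continuous_const
  have hgi := hg.integrableOn hT
  have hint : IntegrableOn (fun x => g x - fderiv ℝ q x (basisVec i)) (interior (simplex K)) :=
    (hgi.mono_set hU).sub ((integrableOn_simplex hq' K).mono_set interior_subset)
  -- Test functions supported in the interior of `K`, where `f` equals the smooth `q`, reduce the
  -- weak identity to classical integration by parts.
  have key : ∀ᵐ x, x ∈ interior (simplex K) → g x - fderiv ℝ q x (basisVec i) = 0 := by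
    refine isOpen_interior.ae_eq_zero_of_integral_contDiff_smul_eq_zero hint.locallyIntegrableOn
      fun φ hφ hφc hφU => ?_
    have htest : IsTest Ω φ := ⟨hφ, hφc, hφU.trans hU⟩
    obtain ⟨Cφ, hCφ⟩ := hφc.exists_bound_of_continuous hφ.continuous
    have hφ' : Continuous fun x => fderiv ℝ φ x (basisVec i) :=
      (hφ.continuous_fderiv (by simp)).clm_apply continuous_const
    have hφ'U : tsupport (fun x => fderiv ℝ φ x (basisVec i)) ⊆ interior (simplex K) := by
      refine (closure_minimal ?_ (isClosed_tsupport (fderiv ℝ φ))).trans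
        ((tsupport_fderiv_subset ℝ).trans hφU)
      intro x hx
      refine subset_tsupport _ fun h => hx ?_
      simp only [h]
      rfl
    have hφ'c : HasCompactSupport fun x => fderiv ℝ φ x (basisVec i) :=
      (hφc.fderiv ℝ).comp_left (g := fun L : E n →L[ℝ] ℝ => L (basisVec i)) rfl
    have i1 : IntegrableOn (fun x => φ x • g x) (interior (simplex K)) :=
      (hgi.mono_set hU).bdd_smul Cφ hφ.continuous.aestronglyMeasurable (.of_forall hCφ)
    have i2 : IntegrableOn (fun x => φ x • fderiv ℝ q x (basisVec i)) (interior (simplex K)) :=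
      (integrableOn_simplex (hφ.continuous.smul hq') K).mono_set interior_subset
    rw [← setIntegral_mul_eq hφU]
    simp only [smul_sub]
    rw [integral_sub i1 i2, setIntegral_mul_eq hφU, setIntegral_mul_eq hφU,
      ← setIntegral_mul_eq (hφU.trans hU) g]
    have h1 := hw φ htest
    have h2 : ∫ x in Ω, f x * fderiv ℝ φ x (basisVec i) =
        ∫ x, fderiv ℝ φ x (basisVec i) * q x := by
      have h3 := setIntegral_mul_eq (hφ'U.trans hU) f
      have h4 := setIntegral_mul_eq hφ'U f
      have h5 := setIntegral_mul_eq hφ'U q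
      simp only [smul_eq_mul] at h3 h4 h5
      simp only [mul_comm (f _)]
      rw [h3, ← h4, ← h5]
      refine integral_congr_ae ?_
      filter_upwards [ae_restrict_of_ae_restrict_of_subset interior_subset hfq] with x hx
      rw [hx]
    have h6 := integral_mul_fderiv_eq_neg_fderiv_mul_of_integrable (μ := volume) (f := φ) (g := q)
      (v := basisVec i)
      ((hφ'.mul hq.continuous).integrable_of_hasCompactSupport hφ'c.mul_right)
      ((hφ.continuous.mul hq').integrable_of_hasCompactSupport hφc.mul_right)
      ((hφ.continuous.mul hq.continuous).integrable_of_hasCompactSupport hφc.mul_right)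
      (fun x _ => hφ.differentiable (by simp) x) fun x _ => hq.differentiable (by simp) x
    simp only [smul_eq_mul]
    rw [h6, ← h2, h1, sub_eq_zero, neg_neg]
    exact integral_congr_ae (.of_forall fun x => mul_comm _ _)
  have h7 : ∀ᵐ x ∂volume.restrict (interior (simplex K)),
      g x = fderiv ℝ q x (basisVec i) := by
    rw [ae_restrict_iff' isOpen_interior.measurableSet]
    exact key.mono fun x hx hxU => sub_eq_zero.1 (hx hxU)
  rwa [Measure.restrict_congr_set (simplex_ae_eq_interior K)] at h7

/-- Uniqueness of the weak exterior derivative. -/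
theorem HasWeakExtDeriv.ae_eq (hT : IsMesh Ω T) (hΩ : interior (closure Ω) = Ω)
    {w : E n → Form n k} {η η' : E n → Form n (k + 1)} (hη : MemL2Form Ω η)
    (hη' : MemL2Form Ω η') (h : HasWeakExtDeriv Ω w η) (h' : HasWeakExtDeriv Ω w η') :
    η =ᵐ[volume.restrict Ω] η' := by
  have hi := hη.integrableOn hT
  have hi' := hη'.integrableOn hT
  have hΩo := IsMesh.isOpen hΩ
  have key : ∀ᵐ x, x ∈ Ω → η x - η' x = 0 := by
    refine hΩo.ae_eq_zero_of_integral_contDiff_smul_eq_zero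
      (f := fun x => η x - η' x) (hi.sub hi').locallyIntegrableOn fun φ hφ hφc hφU => ?_
    obtain ⟨Cφ, hCφ⟩ := hφc.exists_bound_of_continuous hφ.continuous
    have i1 : IntegrableOn (fun x => φ x • η x) Ω :=
      hi.bdd_smul Cφ hφ.continuous.aestronglyMeasurable (.of_forall hCφ)
    have i2 : IntegrableOn (fun x => φ x • η' x) Ω :=
      hi'.bdd_smul Cφ hφ.continuous.aestronglyMeasurable (.of_forall hCφ)
    rw [← setIntegral_mul_eq hφU]
    simp only [smul_sub]
    rw [integral_sub i1 i2,
      h φ ⟨hφ, hφc, hφU⟩, h' φ ⟨hφ, hφc, hφU⟩, sub_self]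
  exact (ae_restrict_iff' hΩo.measurableSet).2 (key.mono fun x hx hxU => sub_eq_zero.1 (hx hxU))

end WeakDerivatives

/-! ### Piecewise polynomial forms on a mesh -/

section Piecewise

variable {n k r : ℕ} {Ω : Set (E n)} {T : Finset (Finset (E n))}

theorem eq_zero_of_zeroTrace {A : Fin (n + 1) → E n} (hA : AffineIndependent ℝ A)
    {w : E n → Form n k} (h : ZeroTrace A w) (x : E n) : w x = 0 := by
  obtain ⟨B, hB⟩ := exists_affineEquiv hA
  have hedge : ∀ y, pt A (bary0 (B.symm y).ofLp) = y := fun y => by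
    rw [← edgeMap_apply, ← hB]
    exact B.apply_symm_apply y
  ext v
  have h1 := h (bary (B.symm (x - A 0)).ofLp) (sum_bary _) (fun i => bary0 (B.symm (v i)).ofLp)
    fun i => sum_bary0 _
  simp only [hedge, pt_bary, edgeMap_apply] at h1
  simpa using h1

/-- The function which equals `P K` on the element `K`, up to a null set. -/
def patch {F : Type*} [AddCommMonoid F] (T : Finset (Finset (E n))) (P : T → E n → F) (x : E n) :
    F :=
  ∑ K : T, (simplex K.1).indicator (P K) x

theorem patch_ae_eq {F : Type*} [AddCommMonoid F] (hT : IsMesh Ω T) (P : T → E n → F) (K : T) :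
    patch T P =ᵐ[volume.restrict (simplex K.1)] P K := by
  have h : ∀ᵐ x ∂volume, ∀ L : T, L ≠ K → x ∉ simplex K.1 ∩ simplex L.1 := by
    rw [ae_all_iff]
    intro L
    by_cases hLK : L = K
    · exact .of_forall fun x h => absurd hLK h
    · have h0 := hT.aedisjoint K.2 L.2 fun h => hLK (Subtype.ext h.symm)
      filter_upwards [measure_eq_zero_iff_ae_notMem.1 h0] with x hx _ using hx
  filter_upwards [ae_restrict_of_ae h, ae_restrict_mem (measurableSet_simplex K.1)] with x hx hxK
  rw [patch, Finset.sum_eq_single K, indicator_of_mem hxK]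
  · exact fun L _ hLK => indicator_of_notMem (fun hxL => hx L hLK ⟨hxK, hxL⟩) _
  · simp

theorem ae_eq_of_ae_eq_simplex (hT : IsMesh Ω T) (hΩ : interior (closure Ω) = Ω) {F : Type*}
    {f g : E n → F} {P : T → E n → F} (hf : ∀ K : T, f =ᵐ[volume.restrict (simplex K.1)] P K)
    (hg : ∀ K : T, g =ᵐ[volume.restrict (simplex K.1)] P K) : f =ᵐ[volume.restrict Ω] g :=
  (hT.ae_restrict_iff hΩ).2 fun K hK => (hf ⟨K, hK⟩).trans (hg ⟨K, hK⟩).symm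

theorem memL2_of_ae_eq_simplex (hT : IsMesh Ω T) (hΩ : interior (closure Ω) = Ω) {f : E n → ℝ}
    {P : T → E n → ℝ} (hP : ∀ K, Continuous (P K))
    (hf : ∀ K : T, f =ᵐ[volume.restrict (simplex K.1)] P K) : MemL2 Ω f := by
  have h : MemLp (patch T P) 2 (volume.restrict Ω) := by
    refine memLp_finsetSum _ fun K _ => ?_
    rw [memLp_indicator_iff_restrict (measurableSet_simplex K.1)]
    refine MemLp.mono_measure (Measure.restrict_mono_measure Measure.restrict_le_self _) ?_
    exact (memLp_two_iff_integrable_sq (hP K).aestronglyMeasurable).2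
      (integrableOn_simplex ((hP K).pow 2) K.1)
  exact h.ae_eq (ae_eq_of_ae_eq_simplex hT hΩ (patch_ae_eq hT P) hf)

theorem EqOnElement.comp {K : Finset (E n)} {w p : E n → Form n k} (h : EqOnElement K w p)
    (α : Fin k ↪o Fin n) : comp w α =ᵐ[volume.restrict (simplex K)] comp p α :=
  h.mono fun x hx => by simp only [FEEC.comp, hx]

theorem continuous_comp {w : E n → Form n k} (hw : Continuous w) (α : Fin k ↪o Fin n) :
    Continuous (comp w α) :=
  (ContinuousAlternatingMap.apply ℝ (E n) ℝ fun i => basisVec (α i)).continuous.comp hw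

theorem memL2Form_of_eqOnElement (hT : IsMesh Ω T) (hΩ : interior (closure Ω) = Ω)
    {w : E n → Form n k} {P : T → E n → Form n k} (hP : ∀ K, Continuous (P K))
    (hw : ∀ K : T, EqOnElement K.1 w (P K)) : MemL2Form Ω w := fun α =>
  memL2_of_ae_eq_simplex hT hΩ (fun K => continuous_comp (hP K) α) fun K => (hw K).comp α

theorem integral_sq_eq_sum (hT : IsMesh Ω T) (hΩ : interior (closure Ω) = Ω) {f : E n → ℝ}
    {P : T → E n → ℝ} (hP : ∀ K, Continuous (P K))
    (hf : ∀ K : T, f =ᵐ[volume.restrict (simplex K.1)] P K) :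
    ∫ x in Ω, f x ^ 2 = ∑ K : T, ∫ x in simplex K.1, P K x ^ 2 := by
  have hsq : ∀ K : T, (fun x => f x ^ 2) =ᵐ[volume.restrict (simplex K.1)] fun x => P K x ^ 2 :=
    fun K => (hf K).mono fun x hx => by simp only [hx]
  rw [hT.integral_eq hΩ fun K hK =>
    (integrableOn_simplex ((hP ⟨K, hK⟩).pow 2) K).congr (hsq ⟨K, hK⟩).symm, ← Finset.sum_coe_sort]
  exact Finset.sum_congr rfl fun K _ => integral_congr_ae (hsq K)

theorem l2Norm_sq (w : E n → Form n k) : l2Norm Ω w ^ 2 = ∑ α, ∫ x in Ω, comp w α x ^ 2 :=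
  Real.sq_sqrt (Finset.sum_nonneg fun _ _ => integral_nonneg fun _ => sq_nonneg _)

theorem l2Norm_sq_eq_sum (hT : IsMesh Ω T) (hΩ : interior (closure Ω) = Ω)
    {w : E n → Form n k} {P : T → E n → Form n k} (hP : ∀ K, Continuous (P K))
    (hw : ∀ K : T, EqOnElement K.1 w (P K)) :
    l2Norm Ω w ^ 2 = ∑ K : T, ∫ x in simplex K.1, ∑ α, comp (P K) α x ^ 2 := by
  rw [l2Norm_sq, Finset.sum_congr rfl fun α _ => integral_sq_eq_sum hT hΩ
    (fun K => continuous_comp (hP K) α) fun K => (hw K).comp α, Finset.sum_comm]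
  refine Finset.sum_congr rfl fun K _ => (integral_finsetSum _ fun α _ => ?_).symm
  exact integrableOn_simplex ((continuous_comp (hP K) α).pow 2) K.1

theorem continuous_sum_comp_sq {w : E n → Form n k} (hw : Continuous w) :
    Continuous fun x => ∑ α, comp w α x ^ 2 :=
  continuous_finsetSum _ fun α _ => (continuous_comp hw α).pow 2

/-- The norm of `L²(Ω, Λᵏ)` is equivalent to the one defined by operator norms. -/
theorem l2Norm_sq_equiv (n k : ℕ) : ∃ C : ℝ, 0 < C ∧ ∀ {Ω : Set (E n)} {T : Finset (Finset (E n))},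
    IsMesh Ω T → interior (closure Ω) = Ω → ∀ {w : E n → Form n k} {P : T → E n → Form n k},
      (∀ K, Continuous (P K)) → (∀ K : T, EqOnElement K.1 w (P K)) →
      l2Norm Ω w ^ 2 ≤ C * ∑ K : T, ∫ x in simplex K.1, ‖P K x‖ ^ 2 ∧
      ∑ K : T, ∫ x in simplex K.1, ‖P K x‖ ^ 2 ≤ C * l2Norm Ω w ^ 2 := by
  obtain ⟨C₁, hC₁, h₁⟩ := sum_sq_comp_le (n := n) (k := k)
  obtain ⟨C₂, hC₂, h₂⟩ := norm_sq_le_comp (n := n) (k := k)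
  refine ⟨max C₁ C₂, by positivity, fun {Ω T} hT hΩ {w P} hP hw => ?_⟩
  have hi : ∀ K : T, IntegrableOn (fun x => ‖P K x‖ ^ 2) (simplex K.1) :=
    fun K => integrableOn_simplex ((hP K).norm.pow 2) K.1
  have hj : ∀ K : T, IntegrableOn (fun x => ∑ α, comp (P K) α x ^ 2) (simplex K.1) :=
    fun K => integrableOn_simplex (continuous_sum_comp_sq (hP K)) K.1
  rw [l2Norm_sq_eq_sum hT hΩ hP hw, Finset.mul_sum, Finset.mul_sum]
  constructor
  · refine Finset.sum_le_sum fun K _ => ?_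
    rw [← integral_const_mul]
    refine integral_mono (hj K) ((hi K).const_mul _) fun x => (h₁ (P K) x).trans ?_
    exact mul_le_mul_of_nonneg_right (le_max_left _ _) (sq_nonneg _)
  · refine Finset.sum_le_sum fun K _ => ?_
    rw [← integral_const_mul]
    refine integral_mono (hi K) ((hj K).const_mul _) fun x => (h₂ (P K) x).trans ?_
    exact mul_le_mul_of_nonneg_right (le_max_right _ _) (Finset.sum_nonneg fun _ _ => sq_nonneg _)

theorem norm_sq_le_sum_basisVec {F : Type*} [NormedAddCommGroup F] [NormedSpace ℝ F]
    (L : E n →L[ℝ] F) : ‖L‖ ^ 2 ≤ n * ∑ i, ‖L (basisVec i)‖ ^ 2 := by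
  have h : ‖L‖ ≤ ∑ i, ‖L (basisVec i)‖ := by
    refine L.opNorm_le_bound (Finset.sum_nonneg fun _ _ => norm_nonneg _) fun x => ?_
    conv_lhs => rw [← sum_coord_smul_basisVec x]
    rw [map_sum, Finset.sum_mul]
    refine (norm_sum_le _ _).trans (Finset.sum_le_sum fun i _ => ?_)
    rw [map_smul, norm_smul, mul_comm]
    exact mul_le_mul_of_nonneg_left (PiLp.norm_apply_le x i) (norm_nonneg _)
  calc ‖L‖ ^ 2 ≤ (∑ i, ‖L (basisVec i)‖) ^ 2 := pow_le_pow_left₀ (norm_nonneg _) h 2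
    _ ≤ n * ∑ i, ‖L (basisVec i)‖ ^ 2 := by
      simpa using sq_sum_le_card_mul_sum_sq (s := Finset.univ) (f := fun i => ‖L (basisVec i)‖)

theorem h1Norm_sq (w : E n → Form n k) : h1Norm Ω w ^ 2 =
    ∑ α, ((∫ x in Ω, comp w α x ^ 2) + ∑ i, ∫ x in Ω, weakPartial Ω i (comp w α) x ^ 2) :=
  Real.sq_sqrt (Finset.sum_nonneg fun _ _ => add_nonneg (integral_nonneg fun _ => sq_nonneg _)
    (Finset.sum_nonneg fun _ _ => integral_nonneg fun _ => sq_nonneg _))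

/-- The broken `H¹` seminorm of a conforming piecewise smooth form is bounded by its `H¹` norm. -/
theorem sum_integral_fderiv_sq_le (n k : ℕ) : ∃ C : ℝ, 0 < C ∧
    ∀ {Ω : Set (E n)} {T : Finset (Finset (E n))}, IsMesh Ω T → interior (closure Ω) = Ω →
      ∀ {w : E n → Form n k} {P : T → E n → Form n k}, MemH1Form Ω w →
      (∀ K, ContDiff ℝ ∞ (P K)) → (∀ K : T, EqOnElement K.1 w (P K)) →
      ∑ K : T, ∫ x in simplex K.1, ‖fderiv ℝ (P K) x‖ ^ 2 ≤ C * h1Norm Ω w ^ 2 := by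
  obtain ⟨C, hC, h⟩ := norm_sq_le_comp (n := n) (k := k)
  -- The operator norm of the derivative costs a factor `n`; `n + 1` keeps the constant positive
  -- when `n = 0`.
  refine ⟨(n + 1) * C, by positivity, fun {Ω T} hT hΩ {w P} hw hP hwP => ?_⟩
  have hd : ∀ (K : T) (α : Fin k ↪o Fin n) (i : Fin n),
      Continuous fun x => fderiv ℝ (P K) x (basisVec i) fun j => basisVec (α j) := fun K α i =>
    continuous_comp (((hP K).continuous_fderiv (by simp)).clm_apply continuous_const) α
  have hweak : ∀ α i, ∫ x in Ω, weakPartial Ω i (comp w α) x ^ 2 = ∑ K : T,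
      ∫ x in simplex K.1, (fderiv ℝ (P K) x (basisVec i) fun j => basisVec (α j)) ^ 2 := by
    intro α i
    refine integral_sq_eq_sum hT hΩ (fun K => hd K α i) fun K => ?_
    have hPα : ContDiff ℝ ∞ (comp (P K) α) :=
      (ContinuousAlternatingMap.apply ℝ (E n) ℝ fun j => basisVec (α j)).contDiff.comp (hP K)
    refine (weakPartial_ae_eq hT hΩ K.2 (hw α) hPα ((hwP K).comp α) i).trans (.of_forall fun x => ?_)
    exact fderiv_form_apply ((hP K).differentiable (by simp) x) _ _
  have hpt : ∀ (K : T) (x : E n), ‖fderiv ℝ (P K) x‖ ^ 2 ≤ (n + 1) * C *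
      ∑ α : Fin k ↪o Fin n, ∑ i, (fderiv ℝ (P K) x (basisVec i) fun j => basisVec (α j)) ^ 2 := by
    intro K x
    rw [Finset.sum_comm, mul_assoc, Finset.mul_sum]
    refine (norm_sq_le_sum_basisVec _).trans (mul_le_mul (by simp) ?_
      (Finset.sum_nonneg fun _ _ => sq_nonneg _) (by positivity))
    exact Finset.sum_le_sum fun i _ => h (fun y => fderiv ℝ (P K) x y) (basisVec i)
  calc ∑ K : T, ∫ x in simplex K.1, ‖fderiv ℝ (P K) x‖ ^ 2
      ≤ ∑ K : T, ∫ x in simplex K.1, (n + 1) * C * ∑ α : Fin k ↪o Fin n, ∑ i,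
        (fderiv ℝ (P K) x (basisVec i) fun j => basisVec (α j)) ^ 2 := by
        refine Finset.sum_le_sum fun K _ => integral_mono ?_ ?_ (hpt K)
        · exact integrableOn_simplex (((hP K).continuous_fderiv (by simp)).norm.pow 2) K.1
        · exact integrableOn_simplex (continuous_const.mul (continuous_finsetSum _ fun α _ =>
            continuous_finsetSum _ fun i _ => (hd K α i).pow 2)) K.1
    _ = (n + 1) * C * ∑ α, ∑ i, ∫ x in Ω, weakPartial Ω i (comp w α) x ^ 2 := by
        simp only [hweak, integral_const_mul, ← Finset.mul_sum]
        congr 1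
        have e : ∀ K : T, ∫ x in simplex K.1, ∑ α : Fin k ↪o Fin n, ∑ i,
            (fderiv ℝ (P K) x (basisVec i) fun j => basisVec (α j)) ^ 2 =
            ∑ α : Fin k ↪o Fin n, ∑ i, ∫ x in simplex K.1,
              (fderiv ℝ (P K) x (basisVec i) fun j => basisVec (α j)) ^ 2 := by
          intro K
          have hi : ∀ (α : Fin k ↪o Fin n) i, IntegrableOn (fun x =>
            (fderiv ℝ (P K) x (basisVec i) fun j => basisVec (α j)) ^ 2) (simplex K.1) :=
            fun α i => integrableOn_simplex ((hd K α i).pow 2) K.1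
          rw [integral_finsetSum _ fun α _ => integrable_finsetSum _ fun i _ => hi α i]
          exact Finset.sum_congr rfl fun α _ => integral_finsetSum _ fun i _ => hi α i
        rw [Finset.sum_congr rfl fun K _ => e K, Finset.sum_comm]
        exact Finset.sum_congr rfl fun α _ => Finset.sum_comm
    _ ≤ (n + 1) * C * h1Norm Ω w ^ 2 := by
        rw [h1Norm_sq]
        refine mul_le_mul_of_nonneg_left (Finset.sum_le_sum fun α _ => ?_) (by positivity)
        exact le_add_of_nonneg_left (integral_nonneg fun _ => sq_nonneg _)

end Piecewise

/-! ### The canonical interpolant -/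

section Interpolant

variable {n k r : ℕ} {Ω : Set (E n)} {T : Finset (Finset (E n))}

theorem FaceMoments.symm {K : Set (E n)} {w w' : E n → Form n k}
    (h : FaceMoments r K fun x => w x - w' x) : FaceMoments r K fun x => w' x - w x := by
  have e : (fun x => w' x - w x) = fun x => (-1 : ℝ) • (w x - w' x) := funext fun x => by module
  rw [e]
  exact h.const_smul (-1)

theorem IsCanonicalInterpolant.exists_forms (hr : 1 ≤ r) (hT : IsMesh Ω T)
    {v u : E n → Form n k} (h : IsCanonicalInterpolant Ω T r v u) :
    ∃ p p' : T → E n → Form n k, (∀ K, IsPolyForm r (p K)) ∧ (∀ K : T, EqOnElement K.1 v (p K)) ∧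
      (∀ K, IsTrimmedForm r (p' K)) ∧ (∀ K : T, EqOnElement K.1 u (p' K)) ∧
      ∀ K : T, FaceMoments r (K.1 : Set (E n)) fun x => p K x - p' K x := by
  choose p p' hp hvp hp' hup' hdof using fun K : T => h.dofs K.1 K.2
  exact ⟨p, p', hp, hvp, hp', hup', fun K =>
    ((hdof K).faceMoments (hT.affineIndependent K.1 K.2) ((hp' K).isPolyForm hr).continuous
      (hp K).continuous).symm⟩

/-- The local interpolants are patched together. Membership in `H(d)` comes from their matching
facet traces, with the elementwise exterior derivative as witness. -/
theorem exists_isCanonicalInterpolant (hr : 1 ≤ r) (hT : IsMesh Ω T)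
    (hΩ : interior (closure Ω) = Ω) {v : E n → Form n k} (hv : MemLagrange Ω T r v) :
    ∃ u, IsCanonicalInterpolant Ω T r v u := by
  choose p hp hvp using fun K : T => hv.piecewise K.1 K.2
  have hex : ∀ K : T, ∃ w, IsTrimmedForm r w ∧
      FaceMoments r (K.1 : Set (E n)) fun x => p K x - w x := by
    intro K
    obtain ⟨A, hA, hAK⟩ := hT.exists_vertices K.2
    rw [← hAK]
    exact exists_trimmed_faceMoments hr hA (hp K)
  choose p' hp' hpp' using hex
  have hsm : ∀ K, ContDiff ℝ ∞ (p' K) := fun K => ((hp' K).isPolyForm hr).contDiff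
  have hu : ∀ K : T, EqOnElement K.1 (patch T p') (p' K) := patch_ae_eq hT p'
  have hη : ∀ K : T, EqOnElement K.1 (patch T fun K => extDeriv (p' K)) (extDeriv (p' K)) :=
    patch_ae_eq hT fun K => extDeriv (p' K)
  refine ⟨patch T p', ⟨⟨?_, patch T fun K => extDeriv (p' K), ?_, ?_⟩, fun K hK => ⟨p' ⟨K, hK⟩, hp' _, hu ⟨K, hK⟩⟩⟩,
    fun K hK => ⟨p ⟨K, hK⟩, p' ⟨K, hK⟩, hp _, hvp ⟨K, hK⟩, hp' _, hu ⟨K, hK⟩, ?_⟩⟩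
  · exact memL2Form_of_eqOnElement hT hΩ (fun K => (hsm K).continuous) hu
  · exact memL2Form_of_eqOnElement hT hΩ (fun K => continuous_extDeriv (hsm K)) hη
  · exact hasWeakExtDeriv_of_faceMoments hr hT hΩ hv.continuousOn hp hvp hp' hpp' hu hη
  · exact (hpp' ⟨K, hK⟩).symm.sameDofs (hsm _).continuous (hp _).continuous

theorem IsMesh.exists_bary_mem (hT : IsMesh Ω T) (hΩ : interior (closure Ω) = Ω)
    {K : Finset (E n)} (hK : K ∈ T) {A : Fin (n + 1) → E n} (hAK : Set.range A = K) :
    ∃ s ∈ unitSimplexInt n, pt A (bary s) ∈ Ω := by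
  obtain ⟨x, hx⟩ := hT.interior_simplex_nonempty hK
  obtain ⟨c, hc, hc1, rfl⟩ : ∃ c : Fin (n + 1) → ℝ, (∀ i, 0 ≤ c i) ∧ ∑ i, c i = 1 ∧ pt A c = x := by
    rw [← mem_convexHull_range_iff, hAK]
    exact interior_subset hx
  rw [← bary_tail hc1] at hc hx
  have hU : IsOpen ((fun s => pt A (bary s)) ⁻¹' interior (simplex K)) :=
    isOpen_interior.preimage (continuous_pt_bary A)
  obtain ⟨s, hs, hsU⟩ := mem_closure_iff.1
    (unitSimplex_subset_closure (mem_unitSimplex_iff.2 hc)) _ hU hx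
  exact ⟨s, hsU, hT.interior_simplex_subset hΩ hK hs⟩

/-- On each element, `zeroTrace_facet` is used with the element as both neighbours and all its
vertices as the face. -/
theorem IsCanonicalInterpolant.ae_eq (hr : 1 ≤ r) (hT : IsMesh Ω T)
    (hΩ : interior (closure Ω) = Ω) {v : E n → Form n k} (hv : ContinuousOn v Ω)
    {u u' : E n → Form n k} (h : IsCanonicalInterpolant Ω T r v u)
    (h' : IsCanonicalInterpolant Ω T r v u') : u =ᵐ[volume.restrict Ω] u' := by
  obtain ⟨p, p', hp, hvp, hp', hup', hpp'⟩ := h.exists_forms hr hT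
  obtain ⟨q, q', hq, hvq, hq', huq', hqq'⟩ := h'.exists_forms hr hT
  refine ae_eq_of_ae_eq_simplex hT hΩ hup' fun K => (huq' K).trans (.of_forall fun x => ?_)
  obtain ⟨A, hA, hAK⟩ := hT.exists_vertices K.2
  have h0 := eq_zero_of_zeroTrace hA (zeroTrace_facet hr hT hΩ hv K.2 K.2 (hp K) (hq K) (hvp K)
    (hvq K) (hp' K) (hq' K) (hpp' K) (hqq' K) hA.injective hAK.le hAK.le
    (hT.exists_bary_mem hΩ K.2 hAK)) x
  exact (sub_eq_zero.1 h0).symm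

theorem diam_simplex_le_meshSize (K : T) : Metric.diam (simplex K.1) ≤ meshSize T :=
  le_ciSup (f := fun K : T => Metric.diam (simplex K.1)) (Set.finite_range _).bddAbove K

theorem meshSize_nonneg (T : Finset (Finset (E n))) : 0 ≤ meshSize T :=
  Real.iSup_nonneg fun _ => Metric.diam_nonneg

/-- The estimates of the canonical interpolant in terms of norms over the elements. -/
theorem exists_mesh_bounds (n k : ℕ) (hr : 1 ≤ r) (σ : ℝ) : ∃ C : ℝ, 0 < C ∧
    ∀ {Ω : Set (E n)} {T : Finset (Finset (E n))}, IsMesh Ω T → ShapeRegular σ T →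
      ∀ p p' : T → E n → Form n k, (∀ K, IsPolyForm r (p K)) → (∀ K, IsTrimmedForm r (p' K)) →
        (∀ K : T, FaceMoments r (K.1 : Set (E n)) fun x => p K x - p' K x) →
        ∑ K : T, ∫ x in simplex K.1, ‖p' K x‖ ^ 2 ≤
          C * ∑ K : T, ∫ x in simplex K.1, ‖p K x‖ ^ 2 ∧
        ∑ K : T, ∫ x in simplex K.1, ‖p' K x - p K x‖ ^ 2 ≤
          C * meshSize T ^ 2 * ∑ K : T, ∫ x in simplex K.1, ‖fderiv ℝ (p K) x‖ ^ 2 ∧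
        ∑ K : T, ∫ x in simplex K.1, ‖fderiv ℝ (p' K) x‖ ^ 2 ≤
          C * ∑ K : T, ∫ x in simplex K.1, ‖fderiv ℝ (p K) x‖ ^ 2 := by
  obtain ⟨C, hC, h⟩ := exists_element_bounds n k hr σ
  refine ⟨C, hC, fun {Ω T} hT hσ p p' hp hp' hpp' => ?_⟩
  have key : ∀ K : T, ∫ x in simplex K.1, ‖p' K x‖ ^ 2 ≤ C * ∫ x in simplex K.1, ‖p K x‖ ^ 2 ∧
      ∫ x in simplex K.1, ‖p' K x - p K x‖ ^ 2 ≤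
        C * meshSize T ^ 2 * ∫ x in simplex K.1, ‖fderiv ℝ (p K) x‖ ^ 2 ∧
      ∫ x in simplex K.1, ‖fderiv ℝ (p' K) x‖ ^ 2 ≤
        C * ∫ x in simplex K.1, ‖fderiv ℝ (p K) x‖ ^ 2 := by
    intro K
    obtain ⟨A, hA, hAK⟩ := hT.exists_vertices K.2
    obtain ⟨c, ρ, hρ, hball, hdiam⟩ := hσ K.1 K.2
    have hs : simplex K.1 = convexHull ℝ (Set.range A) := by rw [hAK, simplex]
    have hmem : ∀ i, A i ∈ simplex K.1 := fun i => hs ▸ subset_convexHull ℝ _ ⟨i, rfl⟩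
    obtain ⟨h1, h2, h3⟩ := h A c ρ _ hA hρ (hs ▸ hball)
      (fun i j => Metric.dist_le_diam_of_mem (isCompact_simplex K.1).isBounded (hmem i) (hmem j))
      hdiam (p K) (p' K) (hp K) (hp' K) (hAK ▸ hpp' K)
    rw [← hs] at h1 h2 h3
    refine ⟨h1, h2.trans ?_, h3⟩
    have hd := pow_le_pow_left₀ Metric.diam_nonneg (diam_simplex_le_meshSize K) 2
    exact mul_le_mul_of_nonneg_right (mul_le_mul_of_nonneg_left hd hC.le)
      (integral_nonneg fun _ => sq_nonneg _)
  simp only [Finset.mul_sum]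
  exact ⟨Finset.sum_le_sum fun K _ => (key K).1, Finset.sum_le_sum fun K _ => (key K).2.1,
    Finset.sum_le_sum fun K _ => (key K).2.2⟩

theorem norm_sq_extDeriv_le (w : E n → Form n k) (x : E n) :
    ‖extDeriv w x‖ ^ 2 ≤ (k + 1 : ℝ) ^ 2 * ‖fderiv ℝ w x‖ ^ 2 := by
  rw [← mul_pow]
  refine pow_le_pow_left₀ (norm_nonneg _) ?_ 2
  exact_mod_cast ContinuousAlternatingMap.norm_alternatizeUncurryFin_le (fderiv ℝ w x)

/-- `weakExtDeriv` is an arbitrary choice among weak derivatives; uniqueness almost everywhere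
identifies it with the elementwise one, to which the local bounds apply. -/
theorem IsCanonicalInterpolant.weakExtDeriv_eqOnElement (hr : 1 ≤ r) (hT : IsMesh Ω T)
    (hΩ : interior (closure Ω) = Ω) {v u : E n → Form n k} (hv : ContinuousOn v Ω)
    (h : IsCanonicalInterpolant Ω T r v u) {p p' : T → E n → Form n k}
    (hp : ∀ K, IsPolyForm r (p K)) (hvp : ∀ K : T, EqOnElement K.1 v (p K))
    (hp' : ∀ K, IsTrimmedForm r (p' K)) (hup' : ∀ K : T, EqOnElement K.1 u (p' K))
    (hpp' : ∀ K : T, FaceMoments r (K.1 : Set (E n)) fun x => p K x - p' K x) (K : T) :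
    EqOnElement K.1 (weakExtDeriv Ω u) (extDeriv (p' K)) := by
  obtain ⟨hg, hw⟩ : MemL2Form Ω (weakExtDeriv Ω u) ∧ HasWeakExtDeriv Ω u (weakExtDeriv Ω u) :=
    Classical.epsilon_spec h.memVh.memHd.2
  have hη : ∀ K : T, EqOnElement K.1 (patch T fun K => extDeriv (p' K)) (extDeriv (p' K)) :=
    patch_ae_eq hT fun K => extDeriv (p' K)
  have hηL : MemL2Form Ω (patch T fun K => extDeriv (p' K)) := memL2Form_of_eqOnElement hT hΩ
    (fun K => continuous_extDeriv ((hp' K).isPolyForm hr).contDiff) hη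
  have h1 := hw.ae_eq hT hΩ hg hηL
    (hasWeakExtDeriv_of_faceMoments hr hT hΩ hv hp hvp hp' hpp' hup' hη)
  exact Filter.EventuallyEq.trans ((hT.ae_restrict_iff hΩ).1 h1 K.1 K.2) (hη K)

theorem l2Norm_nonneg (w : E n → Form n k) : 0 ≤ l2Norm Ω w := Real.sqrt_nonneg _

theorem h1Norm_nonneg (w : E n → Form n k) : 0 ≤ h1Norm Ω w := Real.sqrt_nonneg _

/-- Avoids square roots of constants, since `C ≤ (C + 1)²`. -/
theorem le_mul_of_sq_le {a b C : ℝ} (hb : 0 ≤ b) (hC : 0 ≤ C) (h : a ^ 2 ≤ C * b ^ 2) :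
    a ≤ (C + 1) * b := by
  refine le_of_sq_le_sq (h.trans ?_) (by positivity)
  rw [mul_pow]
  exact mul_le_mul_of_nonneg_right (by nlinarith) (sq_nonneg b)

/-- Stability and approximation of the canonical interpolant. -/
theorem exists_interpolant_bounds (n k : ℕ) (hr : 1 ≤ r) (σ : ℝ) : ∃ C : ℝ, 0 < C ∧
    ∀ (Ω : Set (E n)) (T : Finset (Finset (E n))), interior (closure Ω) = Ω → IsMesh Ω T →
      ShapeRegular σ T → ∀ v : E n → Form n k, MemLagrange Ω T r v →
        ∀ u, IsCanonicalInterpolant Ω T r v u →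
          l2Norm Ω u ≤ C * l2Norm Ω v ∧
          l2Norm Ω (fun x => u x - v x) ≤ C * meshSize T * h1Norm Ω v ∧
          l2Norm Ω (weakExtDeriv Ω u) ≤ C * h1Norm Ω v := by
  obtain ⟨C₀, hC₀, hel⟩ := exists_mesh_bounds n k hr σ
  obtain ⟨C₁, hC₁, hL⟩ := l2Norm_sq_equiv n k
  obtain ⟨C₂, hC₂, hL'⟩ := l2Norm_sq_equiv n (k + 1)
  obtain ⟨C₃, hC₃, hH⟩ := sum_integral_fderiv_sq_le n k
  -- Each constant is the local bound `C₀` between the two comparisons of component norms with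
  -- operator norms; `D₃` also carries the bound of `d` by the full derivative.
  set D₁ := C₁ * (C₀ * C₁) with hD₁
  set D₂ := C₁ * (C₀ * C₃) with hD₂
  set D₃ := C₂ * ((k + 1) ^ 2 * (C₀ * C₃)) with hD₃
  have hD₁' : 0 < D₁ := by positivity
  have hD₂' : 0 < D₂ := by positivity
  have hD₃' : 0 < D₃ := by positivity
  refine ⟨D₁ + D₂ + D₃ + 1, by positivity, fun Ω T hΩ hT hσ v hv u hu => ?_⟩
  obtain ⟨p, p', hp, hvp, hp', hup', hpp'⟩ := hu.exists_forms hr hT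
  have hsm : ∀ K, ContDiff ℝ ∞ (p' K) := fun K => ((hp' K).isPolyForm hr).contDiff
  obtain ⟨h1, h2, h3⟩ := hel hT hσ p p' hp hp' hpp'
  have hH1 := hH hT hΩ hv.memH1 (fun K => (hp K).contDiff) hvp
  have hC : 0 ≤ D₁ + D₂ + D₃ := by positivity
  refine ⟨le_mul_of_sq_le (l2Norm_nonneg v) hC ?_, ?_, le_mul_of_sq_le (h1Norm_nonneg v) hC ?_⟩
  · calc l2Norm Ω u ^ 2 ≤ C₁ * ∑ K : T, ∫ x in simplex K.1, ‖p' K x‖ ^ 2 :=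
          (hL hT hΩ (fun K => (hsm K).continuous) hup').1
      _ ≤ C₁ * (C₀ * (C₁ * l2Norm Ω v ^ 2)) := by
          have := (hL hT hΩ (fun K => (hp K).continuous) hvp).2
          gcongr
          exact h1.trans (by gcongr)
      _ = D₁ * l2Norm Ω v ^ 2 := by rw [hD₁]; ring
      _ ≤ (D₁ + D₂ + D₃) * l2Norm Ω v ^ 2 :=
          mul_le_mul_of_nonneg_right (by linarith) (sq_nonneg _)
  · rw [mul_assoc]
    refine le_mul_of_sq_le (mul_nonneg (meshSize_nonneg T) (h1Norm_nonneg v)) hC ?_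
    calc l2Norm Ω (fun x => u x - v x) ^ 2
        ≤ C₁ * ∑ K : T, ∫ x in simplex K.1, ‖p' K x - p K x‖ ^ 2 :=
          (hL hT hΩ (P := fun K x => p' K x - p K x)
            (fun K => (hsm K).continuous.sub (hp K).continuous)
            fun K => (hup' K).sub (hvp K)).1
      _ ≤ C₁ * (C₀ * meshSize T ^ 2 * (C₃ * h1Norm Ω v ^ 2)) := by
          gcongr
          exact h2.trans (by gcongr)
      _ = D₂ * (meshSize T * h1Norm Ω v) ^ 2 := by rw [hD₂]; ring
      _ ≤ (D₁ + D₂ + D₃) * (meshSize T * h1Norm Ω v) ^ 2 :=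
          mul_le_mul_of_nonneg_right (by linarith) (sq_nonneg _)
  · have hd := hu.weakExtDeriv_eqOnElement hr hT hΩ hv.continuousOn hp hvp hp' hup' hpp'
    calc l2Norm Ω (weakExtDeriv Ω u) ^ 2
        ≤ C₂ * ∑ K : T, ∫ x in simplex K.1, ‖extDeriv (p' K) x‖ ^ 2 :=
          (hL' hT hΩ (fun K => continuous_extDeriv (hsm K)) hd).1
      _ ≤ C₂ * ((k + 1) ^ 2 * ∑ K : T, ∫ x in simplex K.1, ‖fderiv ℝ (p' K) x‖ ^ 2) := by
          refine mul_le_mul_of_nonneg_left ?_ hC₂.le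
          rw [Finset.mul_sum]
          refine Finset.sum_le_sum fun K _ => ?_
          rw [← integral_const_mul]
          exact integral_mono
            (integrableOn_simplex ((continuous_extDeriv (hsm K)).norm.pow 2) K.1)
            ((integrableOn_simplex (((hsm K).continuous_fderiv (by simp)).norm.pow 2) K.1).const_mul
              _) (norm_sq_extDeriv_le (p' K))
      _ ≤ C₂ * ((k + 1) ^ 2 * (C₀ * (C₃ * h1Norm Ω v ^ 2))) := by
          gcongr
          exact h3.trans (by gcongr)
      _ = D₃ * h1Norm Ω v ^ 2 := by rw [hD₃]; ring
      _ ≤ (D₁ + D₂ + D₃) * h1Norm Ω v ^ 2 :=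
          mul_le_mul_of_nonneg_right (by linarith) (sq_nonneg _)

end Interpolant

end FEEC

end

/-! ### The theorem: existence, uniqueness and the three estimates. -/

theorem lemma3p3 (n k r : ℕ) (hk : k ≤ n) (hr : 1 ≤ r) (σ : ℝ) :
    ∃ C : ℝ, 0 < C ∧
      ∀ (Ω : Set (FEEC.E n)) (T : Finset (Finset (FEEC.E n))),
        interior (closure Ω) = Ω → FEEC.IsMesh Ω T → FEEC.ShapeRegular σ T →
        ∀ v : FEEC.E n → FEEC.Form n k, FEEC.MemLagrange Ω T r v →
          (∃ u, FEEC.IsCanonicalInterpolant Ω T r v u) ∧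
          (∀ u u', FEEC.IsCanonicalInterpolant Ω T r v u →
            FEEC.IsCanonicalInterpolant Ω T r v u' → u =ᵐ[volume.restrict Ω] u') ∧
          (∀ u, FEEC.IsCanonicalInterpolant Ω T r v u →
            FEEC.l2Norm Ω u ≤ C * FEEC.l2Norm Ω v ∧
            FEEC.l2Norm Ω (fun x => u x - v x) ≤
              C * FEEC.meshSize T * FEEC.h1Norm Ω v ∧
            FEEC.l2Norm Ω (FEEC.weakExtDeriv Ω u) ≤ C * FEEC.h1Norm Ω v) := by
  obtain ⟨C, hC, h⟩ := FEEC.exists_interpolant_bounds n k hr σ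
  exact ⟨C, hC, fun Ω T hΩ hT hσ v hv => ⟨FEEC.exists_isCanonicalInterpolant hr hT hΩ hv,
    fun _ _ hu hu' => hu.ae_eq hr hT hΩ hv.continuousOn hu', h Ω T hΩ hT hσ v hv⟩⟩
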